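/- **Conventions.** Let $k$ be a field; algebras are associative unital $k$-algebras and $\otimes=\otimes_k$. A *quasi-bialgebra* is an algebra $H$ with algebra maps $\Delta:H\to H\otimes H$, $\varepsilon:H\to k$ and an invertible $\Phi\in H^{\otimes 3}$ such that $(id\otimes\Delta)\Delta(h)=\Phi\,(\Delta\otimes id)\Delta(h)\,\Phi^{-1}$, $(id\otimes\varepsilon)\Delta=id=(\varepsilon\otimes id)\Delta$, $(1\otimes\Phi)(id\otimes\Delta\otimes id)(\Phi)(\Phi\otimes1)=(id\otimes id\otimes\Delta)(\Phi)(\Delta\otimes id\otimes id)(\Phi)$ and $(id\otimes\varepsilon\otimes id)(\Phi)=1\otimes 1$. It is a *quasi-Hopf algebra* if it is equipped with an anti-automorphism $S$ of the algebra $H$ and $\alpha,\beta\in H$ with $S(h_1)\alpha h_2=\varepsilon(h)\alpha$, $h_1\beta S(h_2)=\varepsilon(h)\beta$, $X^1\beta S(X^2)\alpha X^3=1$ and $S(x^1)\alpha x^2\beta S(x^3)=1$, where $\Phi=X^1\otimes X^2\otimes X^3$, $\Phi^{-1}=x^1\otimes x^2\otimes x^3$ (summation understood). We assume the usual normalization $\varepsilon(\alpha)=1$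 (hence $\varepsilon(\beta)=1$). $H^{\rm op}$ is the quasi-bialgebra with opposite multiplication, the same $\Delta,\varepsilon$, and reassociator $\Phi^{-1}$; $H^{\rm op}\otimes H$ has the componentwise tensor product structure. A *right comodule algebra* over a quasi-bialgebra $H$ is an algebra $A$ with an algebra map $\rho:A\to A\otimes H$ and an invertible $\Phi_\rho\in A\otimes H\otimes H$ such that $\Phi_\rho(\rho\otimes id)\rho(a)=(id\otimes\Delta)\rho(a)\Phi_\rho$, $(1\otimes\Phi)(id\otimes\Delta\otimes id)(\Phi_\rho)(\Phi_\rho\otimes1)=(id\otimes id\otimes\Delta)(\Phi_\rho)(\rho\otimes id\otimes id)(\Phi_\rho)$, $(id\otimes\varepsilon)\rho=id$ and $(id\otimes\varepsilon\otimes id)(\Phi_\rho)=(id\otimes id\otimes\varepsilon)(\Phi_\rho)=1\otimes 1$. A *left comodule algebra* is an algebra $A$ with an algebra map $\lambda:A\to H\otimes A$ and an invertible $\Phi_\lambda\in H\otimes H\otimes A$ such that $(id\otimes\lambda)\lambda(a)\Phi_\lambda=\Phi_\lambda(\Delta\otimes id)\lambda(a)$, $(1\otimes\Phi_\lambda)(id\otimes\Delta\otimes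 id)(\Phi_\lambda)(\Phi\otimes1)=(id\otimes id\otimes\lambda)(\Phi_\lambda)(\Delta\otimes id\otimes id)(\Phi_\lambda)$, $(\varepsilon\otimes id)\lambda=id$ and $(id\otimes\varepsilon\otimes id)(\Phi_\lambda)=(\varepsilon\otimes id\otimes id)(\Phi_\lambda)=1\otimes 1$. An *$H$-bicomodule algebra* $(\mathbb A,\lambda,\rho,\Phi_\lambda,\Phi_\rho,\Phi_{\lambda,\rho})$ is both a left and a right $H$-comodule algebra, with an invertible $\Phi_{\lambda,\rho}\in H\otimes\mathbb A\otimes H$ such that $$\Phi_{\lambda,\rho}(\lambda\otimes id)(\rho(u))=(id\otimes\rho)(\lambda(u))\Phi_{\lambda,\rho},$$ $$(1\otimes\Phi_{\lambda,\rho})(id\otimes\lambda\otimes id)(\Phi_{\lambda,\rho})(\Phi_\lambda\otimes1)=(id\otimes id\otimes\rho)(\Phi_\lambda)(\Delta\otimes id\otimes id)(\Phi_{\lambda,\rho}),$$ $$(1\otimes\Phi_\rho)(id\otimes\rho\otimes id)(\Phi_{\lambda,\rho})(\Phi_{\lambda,\rho}\otimes1)=(id\otimes id\otimes\Delta)(\Phi_{\lambda,\rho})(\lambda\otimes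 id\otimes id)(\Phi_\rho).$$ Right comodule algebras $(A,\rho,\Phi_\rho)$ and $(A,\rho',\Phi_{\rho'})$ over $H$ are *twist equivalent* if there is an invertible $\mathbb V\in A\otimes H$ with $(id\otimes\varepsilon)(\mathbb V)=1$, $\rho'(a)=\mathbb V\rho(a)\mathbb V^{-1}$ for all $a\in A$, and $\Phi_{\rho'}=(id\otimes\Delta)(\mathbb V)\,\Phi_\rho\,(\rho\otimes id)(\mathbb V^{-1})(\mathbb V^{-1}\otimes1)$. Write $\rho(u)=u_{\langle0\rangle}\otimes u_{\langle1\rangle}$, $\lambda(u)=u_{[-1]}\otimes u_{[0]}$, $\Phi_\rho=\tilde X^1_\rho\otimes\tilde X^2_\rho\otimes\tilde X^3_\rho$, $\Phi_\lambda^{-1}=\tilde x^1_\lambda\otimes\tilde x^2_\lambda\otimes\tilde x^3_\lambda$, $\Phi_{\lambda,\rho}=\Theta^1\otimes\Theta^2\otimes\Theta^3$, $\Phi_{\lambda,\rho}^{-1}=\theta^1\otimes\theta^2\otimes\theta^3$. Let $f=f^1\otimes f^2\in H\otimes H$ be the Drinfeld twist $$f=(S\otimes S)(\Delta^{\rm cop}(x^1))\,\gamma\,\Delta(x^2\beta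 S(x^3)),\qquad \gamma=S(A^2)\alpha A^3\otimes S(A^1)\alpha A^4,$$ where $A^1\otimes A^2\otimes A^3\otimes A^4=(\Phi\otimes1)(\Delta\otimes id\otimes id)(\Phi^{-1})$ and $\Delta^{\rm cop}(h)=h_2\otimes h_1$. **Proposition 3.3.** Let $H$ be a quasi-Hopf algebra and $(\mathbb A,\lambda,\rho,\Phi_\lambda,\Phi_\rho,\Phi_{\lambda,\rho})$ an $H$-bicomodule algebra. Define $\rho_1,\rho_2:\mathbb A\to\mathbb A\otimes(H^{\rm op}\otimes H)$ and $\Phi_{\rho_1},\Phi_{\rho_2}\in\mathbb A\otimes(H^{\rm op}\otimes H)\otimes(H^{\rm op}\otimes H)$ by $$\rho_1(u)=u_{\langle0\rangle_{[0]}}\otimes\bigl(S^{-1}(u_{\langle0\rangle_{[-1]}})\otimes u_{\langle1\rangle}\bigr),\qquad \rho_2(u)=u_{[0]_{\langle0\rangle}}\otimes\bigl(S^{-1}(u_{[-1]})\otimes u_{[0]_{\langle1\rangle}}\bigr),$$ $$\Phi_{\rho_1}=(\tilde X^1_\rho)_{[0]}\tilde x^3_\lambda\theta^2_{[0]}\otimes\bigl(S^{-1}(f^2(\tilde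 X^1_\rho)_{[-1]_2}\tilde x^2_\lambda\theta^2_{[-1]})\otimes\tilde X^2_\rho\theta^3\bigr)\otimes\bigl(S^{-1}(f^1(\tilde X^1_\rho)_{[-1]_1}\tilde x^1_\lambda\theta^1)\otimes\tilde X^3_\rho\bigr),$$ $$\Phi_{\rho_2}=(\tilde x^3_\lambda)_{\langle0\rangle}\tilde X^1_\rho\Theta^2_{\langle0\rangle}\otimes\bigl(S^{-1}(f^2\tilde x^2_\lambda\Theta^1)\otimes(\tilde x^3_\lambda)_{\langle1\rangle_1}\tilde X^2_\rho\Theta^2_{\langle1\rangle}\bigr)\otimes\bigl(S^{-1}(f^1\tilde x^1_\lambda)\otimes(\tilde x^3_\lambda)_{\langle1\rangle_2}\tilde X^3_\rho\Theta^3\bigr),$$ where the products displayed inside the $H^{\rm op}$-legs are taken in $H$. Then $\mathbb A^1=(\mathbb A,\rho_1,\Phi_{\rho_1})$ and $\mathbb A^2=(\mathbb A,\rho_2,\Phi_{\rho_2})$ are right $H^{\rm op}\otimes H$-comodule algebras (in particular $\Phi_{\rho_1}$ and $\Phi_{\rho_2}$ are invertible), and they are twist equivalent. -/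

import Mathlib

open scoped TensorProduct

set_option maxSynthPendingDepth 20
set_option synthInstance.maxHeartbeats 200000

namespace QuasiHopfTheory

noncomputable section

/-! ### Operations on tensor legs

Iterated tensor products are bracketed to the right. -/

section Legs

variable {k : Type*} [Field k]

/-- `id ⊗ f`. -/
def onTail {A B : Type*} [Ring A] [Algebra k A] [Ring B] [Algebra k B]
    (D : Type*) [Ring D] [Algebra k D] (f : A →ₐ[k] B) : D ⊗[k] A →ₐ[k] D ⊗[k] B :=
  Algebra.TensorProduct.map (AlgHom.id k D) f

/-- `f ⊗ id` for a map `f : A → B ⊗ C`, followed by `(B ⊗ C) ⊗ D = B ⊗ (C ⊗ D)`. -/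
def onHead {A B C : Type*} [Ring A] [Algebra k A] [Ring B] [Algebra k B] [Ring C] [Algebra k C]
    (D : Type*) [Ring D] [Algebra k D] (f : A →ₐ[k] B ⊗[k] C) :
    A ⊗[k] D →ₐ[k] B ⊗[k] (C ⊗[k] D) :=
  (Algebra.TensorProduct.assoc k k k B C D).toAlgHom.comp
    (Algebra.TensorProduct.map f (AlgHom.id k D))

/-- `e ⊗ id : H ⊗ D → k ⊗ D = D`. -/
def counitHead {H : Type*} [Ring H] [Algebra k H] (D : Type*) [Ring D] [Algebra k D]
    (e : H →ₐ[k] k) : H ⊗[k] D →ₐ[k] D :=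
  (Algebra.TensorProduct.lid k D).toAlgHom.comp (Algebra.TensorProduct.map e (AlgHom.id k D))

/-- `id ⊗ e : D ⊗ H → D ⊗ k = D`. -/
def counitTail {H : Type*} [Ring H] [Algebra k H] (D : Type*) [Ring D] [Algebra k D]
    (e : H →ₐ[k] k) : D ⊗[k] H →ₐ[k] D :=
  (Algebra.TensorProduct.rid k k D).toAlgHom.comp (Algebra.TensorProduct.map (AlgHom.id k D) e)

/-- The map `a ↦ a ⊗ 1`. -/
abbrev padOne (A : Type*) [Ring A] [Algebra k A] (D : Type*) [Ring D] [Algebra k D] :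
    A →ₐ[k] A ⊗[k] D :=
  Algebra.TensorProduct.includeLeft

@[simp] theorem onTail_tmul {A B D : Type*} [Ring A] [Algebra k A] [Ring B] [Algebra k B]
    [Ring D] [Algebra k D] (f : A →ₐ[k] B) (d : D) (a : A) :
    onTail D f (d ⊗ₜ a) = d ⊗ₜ f a := rfl

theorem onHead_tmul {A B C D : Type*} [Ring A] [Algebra k A] [Ring B] [Algebra k B]
    [Ring C] [Algebra k C] [Ring D] [Algebra k D] (f : A →ₐ[k] B ⊗[k] C) (a : A) (d : D) :
    onHead D f (a ⊗ₜ d) = Algebra.TensorProduct.assoc k k k B C D (f a ⊗ₜ d) := rfl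

@[simp] theorem counitHead_tmul {H D : Type*} [Ring H] [Algebra k H] [Ring D] [Algebra k D]
    (e : H →ₐ[k] k) (h : H) (d : D) : counitHead D e (h ⊗ₜ d) = e h • d := by
  simp [counitHead]

@[simp] theorem counitTail_tmul {H D : Type*} [Ring H] [Algebra k H] [Ring D] [Algebra k D]
    (e : H →ₐ[k] k) (d : D) (h : H) : counitTail D e (d ⊗ₜ h) = e h • d := by
  simp [counitTail]

end Legs

/-! ### Quasi-bialgebras and quasi-Hopf algebras -/

/-- A quasi-bialgebra structure on the `k`-algebra `H`. -/
structure QuasiBialgebra (k H : Type*) [Field k] [Ring H] [Algebra k H] where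
  comul : H →ₐ[k] H ⊗[k] H
  counit : H →ₐ[k] k
  /-- the reassociator -/
  Φ : (H ⊗[k] (H ⊗[k] H))ˣ
  /-- `(id ⊗ Δ)(Δ h) = Φ (Δ ⊗ id)(Δ h) Φ⁻¹` -/
  quasi_coassoc : ∀ h : H,
    onTail H comul (comul h) = Φ * onHead H comul (comul h) * Φ⁻¹.val
  counit_right : ∀ h : H, counitTail H counit (comul h) = h
  counit_left : ∀ h : H, counitHead H counit (comul h) = h
  /-- `(1 ⊗ Φ)(id ⊗ Δ ⊗ id)(Φ)(Φ ⊗ 1) = (id ⊗ id ⊗ Δ)(Φ)(Δ ⊗ id ⊗ id)(Φ)` -/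
  pentagon :
    ((1 : H) ⊗ₜ[k] (Φ : H ⊗[k] (H ⊗[k] H))) * onTail H (onHead H comul) Φ
        * onTail H (onTail H (padOne H H)) Φ
      = onTail H (onTail H comul) Φ * onHead (H ⊗[k] H) comul Φ
  /-- `(id ⊗ ε ⊗ id)(Φ) = 1 ⊗ 1` -/
  counit_Φ : onTail H (counitHead H counit) Φ = 1

/-- The linear map `H → H` underlying an anti-automorphism of `H`. -/
def antiLin {k H : Type*} [Field k] [Ring H] [Algebra k H] (S : H ≃ₐ[k] Hᵐᵒᵖ) : H →ₗ[k] H :=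
  (MulOpposite.opLinearEquiv k).symm.toLinearMap.comp S.toLinearMap

/-- `x ⊗ y ↦ S(x) a y`. -/
def antiLeft {k H : Type*} [Field k] [Ring H] [Algebra k H] (S : H ≃ₐ[k] Hᵐᵒᵖ) (a : H) :
    H ⊗[k] H →ₗ[k] H :=
  (LinearMap.mul' k H).comp
    (TensorProduct.map ((LinearMap.mulRight k a).comp (antiLin S)) LinearMap.id)

/-- `x ⊗ y ↦ x b S(y)`. -/
def antiRight {k H : Type*} [Field k] [Ring H] [Algebra k H] (S : H ≃ₐ[k] Hᵐᵒᵖ) (b : H) :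
    H ⊗[k] H →ₗ[k] H :=
  (LinearMap.mul' k H).comp (TensorProduct.map (LinearMap.mulRight k b) (antiLin S))

/-- `x ⊗ y ⊗ z ↦ x b S(y) a z`. -/
def zigzagLeft {k H : Type*} [Field k] [Ring H] [Algebra k H] (S : H ≃ₐ[k] Hᵐᵒᵖ) (a b : H) :
    H ⊗[k] (H ⊗[k] H) →ₗ[k] H :=
  (LinearMap.mul' k H).comp (TensorProduct.map (LinearMap.mulRight k b) (antiLeft S a))

/-- `x ⊗ y ⊗ z ↦ S(x) a y b S(z)`. -/
def zigzagRight {k H : Type*} [Field k] [Ring H] [Algebra k H] (S : H ≃ₐ[k] Hᵐᵒᵖ) (a b : H) :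
    H ⊗[k] (H ⊗[k] H) →ₗ[k] H :=
  (LinearMap.mul' k H).comp
    (TensorProduct.map ((LinearMap.mulRight k a).comp (antiLin S)) (antiRight S b))

section AntiFormulas

variable {k H : Type*} [Field k] [Ring H] [Algebra k H] (S : H ≃ₐ[k] Hᵐᵒᵖ) (a b x y z : H)

@[simp] theorem antiLin_apply : antiLin S x = (S x).unop := rfl

@[simp] theorem antiLeft_tmul : antiLeft S a (x ⊗ₜ y) = (S x).unop * a * y := by
  simp [antiLeft]

@[simp] theorem antiRight_tmul : antiRight S b (x ⊗ₜ y) = x * b * (S y).unop := by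
  simp [antiRight]

@[simp] theorem zigzagLeft_tmul :
    zigzagLeft S a b (x ⊗ₜ (y ⊗ₜ z)) = x * b * ((S y).unop * a * z) := by
  simp [zigzagLeft]

@[simp] theorem zigzagRight_tmul :
    zigzagRight S a b (x ⊗ₜ (y ⊗ₜ z)) = (S x).unop * a * (y * b * (S z).unop) := by
  simp [zigzagRight]

end AntiFormulas

/-- A quasi-Hopf algebra structure on the `k`-algebra `H`. -/
structure QuasiHopf (k H : Type*) [Field k] [Ring H] [Algebra k H] extends
    QuasiBialgebra k H where
  /-- the antipode, an anti-automorphism of the algebra `H` -/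
  S : H ≃ₐ[k] Hᵐᵒᵖ
  α : H
  β : H
  /-- `S(h₁) α h₂ = ε(h) α` -/
  antipode_left : ∀ h : H, antiLeft S α (comul h) = counit h • α
  /-- `h₁ β S(h₂) = ε(h) β` -/
  antipode_right : ∀ h : H, antiRight S β (comul h) = counit h • β
  /-- `X¹ β S(X²) α X³ = 1` where `Φ = X¹ ⊗ X² ⊗ X³` -/
  zigzag_left : zigzagLeft S α β Φ = 1
  /-- `S(x¹) α x² β S(x³) = 1` where `Φ⁻¹ = x¹ ⊗ x² ⊗ x³` -/
  zigzag_right : zigzagRight S α β Φ⁻¹.val = 1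

/-! ### Comodule algebras -/

/-- A right `H`-comodule algebra structure on the `k`-algebra `A`. -/
structure RightComoduleAlgebra {k H : Type*} [Field k] [Ring H] [Algebra k H]
    (Q : QuasiBialgebra k H) (A : Type*) [Ring A] [Algebra k A] where
  ρ : A →ₐ[k] A ⊗[k] H
  Φρ : (A ⊗[k] (H ⊗[k] H))ˣ
  /-- `Φρ (ρ ⊗ id)(ρ a) = (id ⊗ Δ)(ρ a) Φρ` -/
  quasi_coassoc_ρ : ∀ a : A, Φρ * onHead H ρ (ρ a) = onTail A Q.comul (ρ a) * Φρ
  /-- `(1 ⊗ Φ)(id ⊗ Δ ⊗ id)(Φρ)(Φρ ⊗ 1) = (id ⊗ id ⊗ Δ)(Φρ)(ρ ⊗ id ⊗ id)(Φρ)` -/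
  pentagon_ρ :
    ((1 : A) ⊗ₜ[k] (Q.Φ : H ⊗[k] (H ⊗[k] H))) * onTail A (onHead H Q.comul) Φρ
        * onTail A (onTail H (padOne H H)) Φρ
      = onTail A (onTail H Q.comul) Φρ * onHead (H ⊗[k] H) ρ Φρ
  /-- `(id ⊗ ε) ∘ ρ = id` -/
  counit_ρ : ∀ a : A, counitTail A Q.counit (ρ a) = a
  /-- `(id ⊗ ε ⊗ id)(Φρ) = 1 ⊗ 1` -/
  counit_Φρ_mid : onTail A (counitHead H Q.counit) Φρ = 1
  /-- `(id ⊗ id ⊗ ε)(Φρ) = 1 ⊗ 1` -/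
  counit_Φρ_last : onTail A (counitTail H Q.counit) Φρ = 1

/-- A left `H`-comodule algebra structure on the `k`-algebra `B`. -/
structure LeftComoduleAlgebra {k H : Type*} [Field k] [Ring H] [Algebra k H]
    (Q : QuasiBialgebra k H) (B : Type*) [Ring B] [Algebra k B] where
  lam : B →ₐ[k] H ⊗[k] B
  Φlam : (H ⊗[k] (H ⊗[k] B))ˣ
  /-- `(id ⊗ λ)(λ b) Φλ = Φλ (Δ ⊗ id)(λ b)` -/
  quasi_coassoc_lam : ∀ b : B, onTail H lam (lam b) * Φlam = Φlam * onHead B Q.comul (lam b)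
  /-- `(1 ⊗ Φλ)(id ⊗ Δ ⊗ id)(Φλ)(Φ ⊗ 1) = (id ⊗ id ⊗ λ)(Φλ)(Δ ⊗ id ⊗ id)(Φλ)` -/
  pentagon_lam :
    ((1 : H) ⊗ₜ[k] (Φlam : H ⊗[k] (H ⊗[k] B))) * onTail H (onHead B Q.comul) Φlam
        * onTail H (onTail H (padOne H B)) Q.Φ
      = onTail H (onTail H lam) Φlam * onHead (H ⊗[k] B) Q.comul Φlam
  /-- `(ε ⊗ id) ∘ λ = id` -/
  counit_lam : ∀ b : B, counitHead B Q.counit (lam b) = b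
  /-- `(id ⊗ ε ⊗ id)(Φλ) = 1 ⊗ 1` -/
  counit_Φlam_mid : onTail H (counitHead B Q.counit) Φlam = 1
  /-- `(ε ⊗ id ⊗ id)(Φλ) = 1 ⊗ 1` -/
  counit_Φlam_first : counitHead (H ⊗[k] B) Q.counit Φlam = 1

/-- An `H`-bicomodule algebra structure on the `k`-algebra `A`. -/
structure BicomoduleAlgebra {k H : Type*} [Field k] [Ring H] [Algebra k H]
    (Q : QuasiBialgebra k H) (A : Type*) [Ring A] [Algebra k A] extends
    LeftComoduleAlgebra Q A, RightComoduleAlgebra Q A where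
  Φlr : (H ⊗[k] (A ⊗[k] H))ˣ
  /-- `Φλρ (λ ⊗ id)(ρ u) = (id ⊗ ρ)(λ u) Φλρ` -/
  compat : ∀ u : A, Φlr * onHead H lam (ρ u) = onTail H ρ (lam u) * Φlr
  /-- `(1 ⊗ Φλρ)(id ⊗ λ ⊗ id)(Φλρ)(Φλ ⊗ 1) = (id ⊗ id ⊗ ρ)(Φλ)(Δ ⊗ id ⊗ id)(Φλρ)` -/
  pentagon_lr_lam :
    ((1 : H) ⊗ₜ[k] (Φlr : H ⊗[k] (A ⊗[k] H))) * onTail H (onHead H lam) Φlr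
        * onTail H (onTail H (padOne A H)) Φlam
      = onTail H (onTail H ρ) Φlam * onHead (A ⊗[k] H) Q.comul Φlr
  /-- `(1 ⊗ Φρ)(id ⊗ ρ ⊗ id)(Φλρ)(Φλρ ⊗ 1) = (id ⊗ id ⊗ Δ)(Φλρ)(λ ⊗ id ⊗ id)(Φρ)` -/
  pentagon_lr_ρ :
    ((1 : H) ⊗ₜ[k] (Φρ : A ⊗[k] (H ⊗[k] H))) * onTail H (onHead H ρ) Φlr
        * onTail H (onTail A (padOne H H)) Φlr
      = onTail H (onTail A Q.comul) Φlr * onHead (H ⊗[k] H) lam Φρ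

/-- `R'` is obtained from `R` by twisting with an invertible `V ∈ A ⊗ H` such that
`(id ⊗ ε)(V) = 1`:  `ρ'(a) = V ρ(a) V⁻¹` and
`Φρ' = (id ⊗ Δ)(V) Φρ (ρ ⊗ id)(V⁻¹) (V⁻¹ ⊗ 1)`. -/
def TwistEquivalent {k H : Type*} [Field k] [Ring H] [Algebra k H] {Q : QuasiBialgebra k H}
    {A : Type*} [Ring A] [Algebra k A] (R R' : RightComoduleAlgebra Q A) : Prop :=
  ∃ V : (A ⊗[k] H)ˣ,
    counitTail A Q.counit V = 1 ∧
    (∀ a : A, R'.ρ a = V * R.ρ a * V⁻¹.val) ∧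
    R'.Φρ.val = onTail A Q.comul V.val * R.Φρ.val * onHead H R.ρ V⁻¹.val
        * onTail A (padOne H H) V⁻¹.val

/-! ### The quasi-bialgebra with opposite multiplication -/

section Opposite

variable {k H M M' N N' : Type*} [Field k] [Ring H] [Algebra k H] [Ring M] [Algebra k M]
  [Ring M'] [Algebra k M'] [Ring N] [Algebra k N] [Ring N'] [Algebra k N']

/-- The identity map `H → Hᵒᵖ`. -/
def op₁ (k H : Type*) [Field k] [Ring H] [Algebra k H] : H →ₗ[k] Hᵐᵒᵖ :=
  (MulOpposite.opLinearEquiv k).toLinearMap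

@[simp] theorem op₁_apply (h : H) : op₁ k H h = MulOpposite.op h := rfl

/-- `h ⊗ m ↦ h ⊗ g(m)`, from `H ⊗ M` to `Hᵒᵖ ⊗ M'`. -/
def opGlue (H : Type*) [Ring H] [Algebra k H] (g : M →ₗ[k] M') : H ⊗[k] M →ₗ[k] Hᵐᵒᵖ ⊗[k] M' :=
  TensorProduct.map (op₁ k H) g

@[simp] theorem opGlue_tmul (g : M →ₗ[k] M') (h : H) (m : M) :
    opGlue H g (h ⊗ₜ[k] m) = MulOpposite.op h ⊗ₜ g m := rfl

theorem opGlue_mul (g : M →ₗ[k] M') (hg : ∀ x y, g (x * y) = g y * g x) (x y : H ⊗[k] M) :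
    opGlue H g (x * y) = opGlue H g y * opGlue H g x := by
  induction x with
  | zero => simp
  | add x₁ x₂ h₁ h₂ => simp [add_mul, mul_add, h₁, h₂]
  | tmul a b =>
    induction y with
    | zero => simp
    | add y₁ y₂ h₁ h₂ => simp [add_mul, mul_add, h₁, h₂]
    | tmul c d => simp [hg]

theorem opGlue_one (g : M →ₗ[k] M') (hg : g 1 = 1) : opGlue H g (1 : H ⊗[k] M) = 1 := by
  rw [Algebra.TensorProduct.one_def, opGlue_tmul, hg]; rfl

/-- `x ⊗ y ↦ x ⊗ y`, from `H ⊗ H` to `Hᵒᵖ ⊗ Hᵒᵖ`. -/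
def op₂ (k H : Type*) [Field k] [Ring H] [Algebra k H] : H ⊗[k] H →ₗ[k] Hᵐᵒᵖ ⊗[k] Hᵐᵒᵖ :=
  opGlue H (op₁ k H)

/-- `x ⊗ y ⊗ z ↦ x ⊗ y ⊗ z`, from `H ⊗ H ⊗ H` to `Hᵒᵖ ⊗ Hᵒᵖ ⊗ Hᵒᵖ`. -/
def op₃ (k H : Type*) [Field k] [Ring H] [Algebra k H] :
    H ⊗[k] (H ⊗[k] H) →ₗ[k] Hᵐᵒᵖ ⊗[k] (Hᵐᵒᵖ ⊗[k] Hᵐᵒᵖ) :=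
  opGlue H (op₂ k H)

/-- The same on four tensor factors. -/
def op₄ (k H : Type*) [Field k] [Ring H] [Algebra k H] :
    H ⊗[k] (H ⊗[k] (H ⊗[k] H)) →ₗ[k] Hᵐᵒᵖ ⊗[k] (Hᵐᵒᵖ ⊗[k] (Hᵐᵒᵖ ⊗[k] Hᵐᵒᵖ)) :=
  opGlue H (op₃ k H)

theorem op₂_mul (x y : H ⊗[k] H) : op₂ k H (x * y) = op₂ k H y * op₂ k H x :=
  opGlue_mul (op₁ k H) (fun _ _ => rfl) x y

theorem op₃_mul (x y : H ⊗[k] (H ⊗[k] H)) : op₃ k H (x * y) = op₃ k H y * op₃ k H x :=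
  opGlue_mul (op₂ k H) op₂_mul x y

theorem op₄_mul (x y : H ⊗[k] (H ⊗[k] (H ⊗[k] H))) : op₄ k H (x * y) = op₄ k H y * op₄ k H x :=
  opGlue_mul (op₃ k H) op₃_mul x y

theorem op₂_one : op₂ k H (1 : H ⊗[k] H) = 1 := opGlue_one _ rfl

theorem op₃_one : op₃ k H (1 : H ⊗[k] (H ⊗[k] H)) = 1 := opGlue_one (op₂ k H) op₂_one

/-- The comultiplication `h ↦ h₁ ⊗ h₂`, as an algebra map `Hᵒᵖ → Hᵒᵖ ⊗ Hᵒᵖ`. -/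
def opComul (Δ : H →ₐ[k] H ⊗[k] H) : Hᵐᵒᵖ →ₐ[k] Hᵐᵒᵖ ⊗[k] Hᵐᵒᵖ :=
  AlgHom.ofLinearMap ((op₂ k H).comp
    (Δ.toLinearMap.comp (MulOpposite.opLinearEquiv k).symm.toLinearMap))
    (by simp [op₂_one]) (by intro x y; simp [op₂_mul])

/-- The counit, as an algebra map `Hᵒᵖ → k`. -/
def opCounit (e : H →ₐ[k] k) : Hᵐᵒᵖ →ₐ[k] k :=
  e.fromOpposite fun _ _ => Commute.all _ _

theorem opComul_op (Δ : H →ₐ[k] H ⊗[k] H) (h : H) :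
    opComul Δ (MulOpposite.op h) = op₂ k H (Δ h) := rfl

theorem opCounit_op (e : H →ₐ[k] k) (h : H) :
    opCounit e (MulOpposite.op h) = e h := rfl

/-- The invertible element `u` of `H ⊗ H ⊗ H`, as an invertible element of
`Hᵒᵖ ⊗ Hᵒᵖ ⊗ Hᵒᵖ`. -/
def opUnit (u : (H ⊗[k] (H ⊗[k] H))ˣ) : (Hᵐᵒᵖ ⊗[k] (Hᵐᵒᵖ ⊗[k] Hᵐᵒᵖ))ˣ where
  val := op₃ k H u.val
  inv := op₃ k H u⁻¹.val
  val_inv := by rw [← op₃_mul, Units.inv_mul, op₃_one]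
  inv_val := by rw [← op₃_mul, Units.mul_inv, op₃_one]

theorem opGlue_onTail (g : M →ₗ[k] M') (g' : N →ₗ[k] N') (f : M →ₐ[k] N) (f' : M' →ₐ[k] N')
    (hf : ∀ m, f' (g m) = g' (f m)) (t : H ⊗[k] M) :
    onTail Hᵐᵒᵖ f' (opGlue H g t) = opGlue H g' (onTail H f t) := by
  induction t with
  | zero => simp
  | add x y hx hy => simp [hx, hy]
  | tmul a b => simp [hf]

theorem opGlue_assoc (g : M →ₗ[k] M') (t : H ⊗[k] H) (m : M) :
    Algebra.TensorProduct.assoc k k k Hᵐᵒᵖ Hᵐᵒᵖ M' (op₂ k H t ⊗ₜ g m)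
      = opGlue H (opGlue H g) (Algebra.TensorProduct.assoc k k k H H M (t ⊗ₜ m)) := by
  induction t with
  | zero => simp
  | add x y hx hy => simp [TensorProduct.add_tmul, hx, hy]
  | tmul a b => simp [op₂]

theorem opGlue_onHead (g : M →ₗ[k] M') (Δ : H →ₐ[k] H ⊗[k] H) (t : H ⊗[k] M) :
    onHead M' (opComul Δ) (opGlue H g t) = opGlue H (opGlue H g) (onHead M Δ t) := by
  induction t with
  | zero => simp
  | add x y hx hy => simp [hx, hy]
  | tmul a b => simp [onHead_tmul, opComul_op, opGlue_assoc]

theorem opGlue_counitHead (g : M →ₗ[k] M') (e : H →ₐ[k] k) (t : H ⊗[k] M) :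
    counitHead M' (opCounit e) (opGlue H g t) = g (counitHead M e t) := by
  induction t with
  | zero => simp
  | add x y hx hy => simp [hx, hy]
  | tmul a b => simp [opCounit_op]

theorem counitTail_op (e : H →ₐ[k] k) (t : H ⊗[k] H) :
    counitTail Hᵐᵒᵖ (opCounit e) (op₂ k H t) = MulOpposite.op (counitTail H e t) := by
  induction t with
  | zero => simp
  | add x y hx hy => simp [hx, hy]
  | tmul a b => simp [op₂, opCounit_op]

end Opposite

/-- The pentagon identity for `Φ`, inverted. -/
theorem QuasiBialgebra.pentagon_inv {k H : Type*} [Field k] [Ring H] [Algebra k H]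
    (Q : QuasiBialgebra k H) :
    onTail H (onTail H (padOne H H)) Q.Φ⁻¹.val
        * onTail H (onHead H Q.comul) Q.Φ⁻¹.val
        * ((1 : H) ⊗ₜ[k] (Q.Φ⁻¹.val : H ⊗[k] (H ⊗[k] H)))
      = onHead (H ⊗[k] H) Q.comul Q.Φ⁻¹.val
        * onTail H (onTail H Q.comul) Q.Φ⁻¹.val := by
  let F (g : H ⊗[k] (H ⊗[k] H) →ₐ[k] H ⊗[k] (H ⊗[k] (H ⊗[k] H))) :
      (H ⊗[k] (H ⊗[k] (H ⊗[k] H)))ˣ :=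
    Units.map (g : H ⊗[k] (H ⊗[k] H) →* H ⊗[k] (H ⊗[k] (H ⊗[k] H))) Q.Φ
  have key : F Algebra.TensorProduct.includeRight * F (onTail H (onHead H Q.comul))
      * F (onTail H (onTail H (padOne H H)))
      = F (onTail H (onTail H Q.comul)) * F (onHead (H ⊗[k] H) Q.comul) :=
    Units.ext Q.pentagon
  have key' := congrArg (fun u => ((u⁻¹ : (H ⊗[k] (H ⊗[k] (H ⊗[k] H)))ˣ) :
    H ⊗[k] (H ⊗[k] (H ⊗[k] H)))) key
  simp only [mul_inv_rev, Units.val_mul, ← mul_assoc] at key'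
  exact key'

/-- The quasi-bialgebra `Hᵒᵖ`: opposite multiplication, the same comultiplication and counit,
and reassociator `Φ⁻¹`. -/
def QuasiBialgebra.op {k H : Type*} [Field k] [Ring H] [Algebra k H]
    (Q : QuasiBialgebra k H) : QuasiBialgebra k Hᵐᵒᵖ where
  comul := opComul Q.comul
  counit := opCounit Q.counit
  Φ := opUnit Q.Φ⁻¹
  quasi_coassoc h := by
    have h1 : onTail Hᵐᵒᵖ (opComul Q.comul) (op₂ k H (Q.comul h.unop))
        = op₃ k H (onTail H Q.comul (Q.comul h.unop)) := 
      opGlue_onTail (op₁ k H) (op₂ k H) Q.comul (opComul Q.comul)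
        (fun _ => rfl) _
    have h2 : onHead Hᵐᵒᵖ (opComul Q.comul) (op₂ k H (Q.comul h.unop))
        = op₃ k H (onHead H Q.comul (Q.comul h.unop)) 
      := opGlue_onHead (op₁ k H) Q.comul _
    have h3 : onHead H Q.comul (Q.comul h.unop)
        = Q.Φ⁻¹.val * (onTail H Q.comul (Q.comul h.unop) * Q.Φ.val) := by
      rw [Q.quasi_coassoc]; simp [mul_assoc]
    refine h1.trans (Eq.symm ?_)
    change op₃ k H Q.Φ⁻¹.val * onHead Hᵐᵒᵖ (opComul Q.comul) (op₂ k H (Q.comul h.unop))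
      * op₃ k H Q.Φ.val = _
    rw [h2, ← op₃_mul, ← op₃_mul, h3, mul_assoc, mul_assoc, Units.mul_inv, mul_one,
      Units.mul_inv_cancel_left]
  counit_right h := (counitTail_op _ _).trans (congrArg MulOpposite.op (Q.counit_right h.unop))
  counit_left h :=
    (opGlue_counitHead (op₁ k H) _ _).trans (congrArg MulOpposite.op (Q.counit_left h.unop))
  pentagon := by
    have h1 : onTail Hᵐᵒᵖ (onHead Hᵐᵒᵖ (opComul Q.comul)) (op₃ k H Q.Φ⁻¹.val)
        = op₄ k H (onTail H (onHead H Q.comul) Q.Φ⁻¹.val) :=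
      opGlue_onTail (op₂ k H) (op₃ k H) (onHead H Q.comul) (onHead Hᵐᵒᵖ (opComul Q.comul))
        (opGlue_onHead (op₁ k H) Q.comul) _
    have h2 : onTail Hᵐᵒᵖ (onTail Hᵐᵒᵖ (padOne (k := k) Hᵐᵒᵖ Hᵐᵒᵖ)) (op₃ k H Q.Φ⁻¹.val)
        = op₄ k H (onTail H (onTail H (padOne H H)) Q.Φ⁻¹.val) :=
      opGlue_onTail (op₂ k H) (op₃ k H) (onTail H (padOne H H)) (onTail Hᵐᵒᵖ (padOne Hᵐᵒᵖ Hᵐᵒᵖ))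
        (opGlue_onTail (op₁ k H) (op₂ k H) (padOne H H)
          (padOne Hᵐᵒᵖ Hᵐᵒᵖ) (fun _ => rfl)) _
    have h3 : onTail Hᵐᵒᵖ (onTail Hᵐᵒᵖ (opComul Q.comul)) (op₃ k H Q.Φ⁻¹.val)
        = op₄ k H (onTail H (onTail H Q.comul) Q.Φ⁻¹.val) :=
      opGlue_onTail (op₂ k H) (op₃ k H) (onTail H Q.comul) (onTail Hᵐᵒᵖ (opComul Q.comul))
        (opGlue_onTail (op₁ k H) (op₂ k H) Q.comul
          (opComul Q.comul) (fun _ => rfl)) _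
    have h4 : onHead (Hᵐᵒᵖ ⊗[k] Hᵐᵒᵖ) (opComul Q.comul) (op₃ k H Q.Φ⁻¹.val)
        = op₄ k H (onHead (H ⊗[k] H) Q.comul Q.Φ⁻¹.val) := opGlue_onHead (op₂ k H) Q.comul _
    have h5 : (1 : Hᵐᵒᵖ) ⊗ₜ[k] op₃ k H Q.Φ⁻¹.val = op₄ k H ((1 : H) ⊗ₜ[k] Q.Φ⁻¹.val) := rfl
    have h6 := congrArg (op₄ k H) Q.pentagon_inv
    rw [op₄_mul, op₄_mul, op₄_mul, ← h1, ← h2, ← h3, ← h4, ← h5, ← mul_assoc] at h6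
    exact h6
  counit_Φ := by
    have h : Units.map (onTail H (counitHead H Q.counit) :
        H ⊗[k] (H ⊗[k] H) →* H ⊗[k] H) Q.Φ = 1 := Units.ext Q.counit_Φ
    have h' : onTail H (counitHead H Q.counit) Q.Φ⁻¹.val = 1 :=
      (congrArg (fun u : (H ⊗[k] H)ˣ => u⁻¹.val) h).trans (by simp)
    have h1 : onTail Hᵐᵒᵖ (counitHead Hᵐᵒᵖ (opCounit Q.counit)) (op₃ k H Q.Φ⁻¹.val)
        = op₂ k H (onTail H (counitHead H Q.counit) Q.Φ⁻¹.val) :=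
      opGlue_onTail (op₂ k H) (op₁ k H) (counitHead H Q.counit)
        (counitHead Hᵐᵒᵖ (opCounit Q.counit))
        (opGlue_counitHead (op₁ k H) Q.counit) _
    exact h1.trans (by rw [h', op₂_one])

/-! ### The tensor product of two quasi-bialgebras -/

section Tensor

variable {k H K M N P M' N' P' : Type*} [Field k] [Ring H] [Algebra k H] [Ring K] [Algebra k K]
  [Ring M] [Algebra k M] [Ring N] [Algebra k N] [Ring P] [Algebra k P]
  [Ring M'] [Algebra k M'] [Ring N'] [Algebra k N'] [Ring P'] [Algebra k P']

/-- `(h ⊗ m) ⊗ (h' ⊗ n) ↦ (h ⊗ h') ⊗ g(m ⊗ n)`. -/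
def glue (H K : Type*) [Ring H] [Algebra k H] [Ring K] [Algebra k K]
    (g : M ⊗[k] N →ₐ[k] P) : (H ⊗[k] M) ⊗[k] (K ⊗[k] N) →ₐ[k] (H ⊗[k] K) ⊗[k] P :=
  (onTail (H ⊗[k] K) g).comp
    (Algebra.TensorProduct.tensorTensorTensorComm k k k k H M K N).toAlgHom

@[simp] theorem glue_tmul (g : M ⊗[k] N →ₐ[k] P) (h : H) (m : M) (h' : K) (n : N) :
    glue H K g ((h ⊗ₜ[k] m) ⊗ₜ[k] (h' ⊗ₜ[k] n)) = (h ⊗ₜ h') ⊗ₜ g (m ⊗ₜ n) := rfl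

/-- `(a ⊗ b) ⊗ (a' ⊗ b') ↦ (a ⊗ a') ⊗ (b ⊗ b')`. -/
def shuffle₂ (k H K : Type*) [Field k] [Ring H] [Algebra k H] [Ring K] [Algebra k K] :
    (H ⊗[k] H) ⊗[k] (K ⊗[k] K) →ₐ[k] (H ⊗[k] K) ⊗[k] (H ⊗[k] K) :=
  glue H K (AlgHom.id k (H ⊗[k] K))

/-- `(a ⊗ b ⊗ c) ⊗ (a' ⊗ b' ⊗ c') ↦ (a ⊗ a') ⊗ (b ⊗ b') ⊗ (c ⊗ c')`. -/
def shuffle₃ (k H K : Type*) [Field k] [Ring H] [Algebra k H] [Ring K] [Algebra k K] :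
    (H ⊗[k] (H ⊗[k] H)) ⊗[k] (K ⊗[k] (K ⊗[k] K)) →ₐ[k]
    (H ⊗[k] K) ⊗[k] ((H ⊗[k] K) ⊗[k] (H ⊗[k] K)) :=
  glue H K (shuffle₂ k H K)

/-- The same with four factors on each side. -/
def shuffle₄ (k H K : Type*) [Field k] [Ring H] [Algebra k H] [Ring K] [Algebra k K] :
    (H ⊗[k] (H ⊗[k] (H ⊗[k] H))) ⊗[k] (K ⊗[k] (K ⊗[k] (K ⊗[k] K))) →ₐ[k]
    (H ⊗[k] K) ⊗[k] ((H ⊗[k] K) ⊗[k] ((H ⊗[k] K) ⊗[k] (H ⊗[k] K))) :=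
  glue H K (shuffle₃ k H K)

@[simp] theorem shuffle₂_tmul (a b : H) (a' b' : K) :
    shuffle₂ k H K ((a ⊗ₜ[k] b) ⊗ₜ[k] (a' ⊗ₜ[k] b')) = (a ⊗ₜ a') ⊗ₜ (b ⊗ₜ b') := rfl

/-- The comultiplication `(h ⊗ h') ↦ (h₁ ⊗ h'₁) ⊗ (h₂ ⊗ h'₂)` of `H ⊗ K`. -/
def tensorComul (Δ : H →ₐ[k] H ⊗[k] H) (Δ' : K →ₐ[k] K ⊗[k] K) :
    H ⊗[k] K →ₐ[k] (H ⊗[k] K) ⊗[k] (H ⊗[k] K) :=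
  (shuffle₂ k H K).comp (Algebra.TensorProduct.map Δ Δ')

/-- The counit `h ⊗ h' ↦ ε(h) ε(h')` of `H ⊗ K`. -/
def tensorCounit (e : H →ₐ[k] k) (e' : K →ₐ[k] k) : H ⊗[k] K →ₐ[k] k :=
  (Algebra.TensorProduct.lid k k).toAlgHom.comp (Algebra.TensorProduct.map e e')

theorem tensorComul_tmul (Δ : H →ₐ[k] H ⊗[k] H) (Δ' : K →ₐ[k] K ⊗[k] K) (h : H) (h' : K) :
    tensorComul Δ Δ' (h ⊗ₜ h') = shuffle₂ k H K (Δ h ⊗ₜ Δ' h') := rfl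

theorem tensorCounit_tmul (e : H →ₐ[k] k) (e' : K →ₐ[k] k) (h : H) (h' : K) :
    tensorCounit e e' (h ⊗ₜ h') = e h * e' h' := rfl

/-- An algebra map applied to `x ⊗ y`, for invertible `x` and `y`. -/
def tensorUnit (g : M ⊗[k] N →ₐ[k] P) (u : Mˣ) (v : Nˣ) : Pˣ where
  val := g (u.val ⊗ₜ v.val)
  inv := g (u⁻¹.val ⊗ₜ v⁻¹.val)
  val_inv := by
    rw [← map_mul, Algebra.TensorProduct.tmul_mul_tmul, Units.mul_inv, Units.mul_inv,
      ← Algebra.TensorProduct.one_def, map_one]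
  inv_val := by
    rw [← map_mul, Algebra.TensorProduct.tmul_mul_tmul, Units.inv_mul, Units.inv_mul,
      ← Algebra.TensorProduct.one_def, map_one]

/-- Algebra maps on `(M₁ ⊗ M₂) ⊗ (N₁ ⊗ N₂)` that agree on pure tensors are equal. -/
theorem tmul_ext {M₁ M₂ N₁ N₂ P : Type*} [Ring M₁] [Algebra k M₁] [Ring M₂] [Algebra k M₂]
    [Ring N₁] [Algebra k N₁] [Ring N₂] [Algebra k N₂] [Ring P] [Algebra k P]
    (f g : (M₁ ⊗[k] M₂) ⊗[k] (N₁ ⊗[k] N₂) →ₐ[k] P)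
    (h : ∀ a b c d, f ((a ⊗ₜ b) ⊗ₜ (c ⊗ₜ d)) = g ((a ⊗ₜ b) ⊗ₜ (c ⊗ₜ d))) (x : M₁ ⊗[k] M₂)
    (y : N₁ ⊗[k] N₂) : f (x ⊗ₜ y) = g (x ⊗ₜ y) := by
  induction x with
  | zero => simp
  | add x₁ x₂ h₁ h₂ => simp [TensorProduct.add_tmul, h₁, h₂]
  | tmul a b =>
    induction y with
    | zero => simp
    | add y₁ y₂ h₁ h₂ => simp [TensorProduct.tmul_add, h₁, h₂]
    | tmul c d => exact h a b c d

theorem glue_onTail (g : M ⊗[k] N →ₐ[k] P) (g' : M' ⊗[k] N' →ₐ[k] P') (f : M →ₐ[k] M')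
    (f' : N →ₐ[k] N') (F : P →ₐ[k] P') (hF : ∀ m n, F (g (m ⊗ₜ n)) = g' (f m ⊗ₜ f' n))
    (x : H ⊗[k] M) (y : K ⊗[k] N) :
    onTail (H ⊗[k] K) F (glue H K g (x ⊗ₜ y)) = glue H K g' (onTail H f x ⊗ₜ onTail K f' y) :=
  tmul_ext ((onTail (H ⊗[k] K) F).comp (glue H K g))
    ((glue H K g').comp (Algebra.TensorProduct.map (onTail H f) (onTail K f')))
    (by intro a b c d; simp [hF]) x y

theorem glue_assoc (g : M ⊗[k] N →ₐ[k] P) (x : H ⊗[k] H) (y : K ⊗[k] K) (m : M) (n : N) :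
    Algebra.TensorProduct.assoc k k k (H ⊗[k] K) (H ⊗[k] K) P
        (shuffle₂ k H K (x ⊗ₜ y) ⊗ₜ g (m ⊗ₜ n))
      = glue H K (glue H K g) (Algebra.TensorProduct.assoc k k k H H M (x ⊗ₜ m) ⊗ₜ
          Algebra.TensorProduct.assoc k k k K K N (y ⊗ₜ n)) := by
  induction x with
  | zero => simp
  | add x₁ x₂ h₁ h₂ => simp only [TensorProduct.add_tmul, map_add, h₁, h₂]
  | tmul a b =>
    induction y with
    | zero => simp
    | add y₁ y₂ h₁ h₂ =>
      simp only [TensorProduct.tmul_add, TensorProduct.add_tmul, map_add, h₁, h₂]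
    | tmul c d => simp

theorem glue_onHead (g : M ⊗[k] N →ₐ[k] P) (Δ : H →ₐ[k] H ⊗[k] H) (Δ' : K →ₐ[k] K ⊗[k] K)
    (x : H ⊗[k] M) (y : K ⊗[k] N) :
    onHead P (tensorComul Δ Δ') (glue H K g (x ⊗ₜ y))
      = glue H K (glue H K g) (onHead M Δ x ⊗ₜ onHead N Δ' y) :=
  tmul_ext ((onHead P (tensorComul Δ Δ')).comp (glue H K g))
    ((glue H K (glue H K g)).comp (Algebra.TensorProduct.map (onHead M Δ) (onHead N Δ')))
    (by
      intro a b c d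
      simp only [AlgHom.comp_apply, glue_tmul, onHead_tmul, tensorComul_tmul, glue_assoc,
        Algebra.TensorProduct.map_tmul]) x y

theorem glue_counitHead (g : M ⊗[k] N →ₐ[k] P) (e : H →ₐ[k] k) (e' : K →ₐ[k] k)
    (x : H ⊗[k] M) (y : K ⊗[k] N) :
    counitHead P (tensorCounit e e') (glue H K g (x ⊗ₜ y))
      = g (counitHead M e x ⊗ₜ counitHead N e' y) :=
  tmul_ext ((counitHead P (tensorCounit e e')).comp (glue H K g))
    (g.comp (Algebra.TensorProduct.map (counitHead M e) (counitHead N e')))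
    (by
      intro a b c d
      simp only [AlgHom.comp_apply, glue_tmul, counitHead_tmul, Algebra.TensorProduct.map_tmul,
        TensorProduct.smul_tmul_smul, tensorCounit_tmul, map_smul]) x y

theorem counitTail_tensor (e : H →ₐ[k] k) (e' : K →ₐ[k] k) (x : H ⊗[k] H) (y : K ⊗[k] K) :
    counitTail (H ⊗[k] K) (tensorCounit e e') (shuffle₂ k H K (x ⊗ₜ y))
      = counitTail H e x ⊗ₜ counitTail K e' y :=
  tmul_ext ((counitTail (H ⊗[k] K) (tensorCounit e e')).comp (shuffle₂ k H K))
    (Algebra.TensorProduct.map (counitTail H e) (counitTail K e'))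
    (by
      intro a b c d
      rw [AlgHom.comp_apply, shuffle₂_tmul, counitTail_tmul, Algebra.TensorProduct.map_tmul,
        counitTail_tmul, counitTail_tmul, TensorProduct.smul_tmul_smul, tensorCounit_tmul]) x y

/-- An identity in `M` and one in `N` give an identity in `P`. -/
theorem conj_tensor (g : M ⊗[k] N →ₐ[k] P) {a b : M} {a' b' : N} (u : Mˣ) (v : Nˣ)
    (h : a = u.val * b * u⁻¹.val) (h' : a' = v.val * b' * v⁻¹.val) :
    g (a ⊗ₜ a') = (tensorUnit g u v).val * g (b ⊗ₜ b') * (tensorUnit g u v)⁻¹.val := by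
  change _ = g _ * g _ * g _
  rw [← map_mul, ← map_mul, Algebra.TensorProduct.tmul_mul_tmul,
    Algebra.TensorProduct.tmul_mul_tmul, ← h, ← h']

theorem pentagon_tensor (g : M ⊗[k] N →ₐ[k] P) {a b c d e : M} {a' b' c' d' e' : N}
    (h : a * b * c = d * e) (h' : a' * b' * c' = d' * e') :
    g (a ⊗ₜ a') * g (b ⊗ₜ b') * g (c ⊗ₜ c') = g (d ⊗ₜ d') * g (e ⊗ₜ e') := by
  rw [← map_mul, ← map_mul, ← map_mul, Algebra.TensorProduct.tmul_mul_tmul,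
    Algebra.TensorProduct.tmul_mul_tmul, Algebra.TensorProduct.tmul_mul_tmul, h, h']

/-- The tensor product quasi-bialgebra `H ⊗ K`, with reassociator
`(X¹ ⊗ Y¹) ⊗ (X² ⊗ Y²) ⊗ (X³ ⊗ Y³)` for `Φ_H = X¹ ⊗ X² ⊗ X³` and `Φ_K = Y¹ ⊗ Y² ⊗ Y³`. -/
def QuasiBialgebra.tensor (Q : QuasiBialgebra k H) (R : QuasiBialgebra k K) :
    QuasiBialgebra k (H ⊗[k] K) where
  comul := tensorComul Q.comul R.comul
  counit := tensorCounit Q.counit R.counit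
  Φ := tensorUnit (shuffle₃ k H K) Q.Φ R.Φ
  quasi_coassoc h := by
    induction h with
    | zero => simp only [map_zero, mul_zero, zero_mul]
    | add x y hx hy => simp only [map_add, hx, hy, mul_add, add_mul]
    | tmul a b =>
      have h1 : onTail (H ⊗[k] K) (tensorComul Q.comul R.comul)
          (shuffle₂ k H K (Q.comul a ⊗ₜ R.comul b))
          = shuffle₃ k H K (onTail H Q.comul (Q.comul a) ⊗ₜ onTail K R.comul (R.comul b)) :=
        glue_onTail (AlgHom.id k (H ⊗[k] K)) (shuffle₂ k H K) Q.comul R.comul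
          (tensorComul Q.comul R.comul) (fun _ _ => rfl) _ _
      have h2 : onHead (H ⊗[k] K) (tensorComul Q.comul R.comul)
          (shuffle₂ k H K (Q.comul a ⊗ₜ R.comul b))
          = shuffle₃ k H K (onHead H Q.comul (Q.comul a) ⊗ₜ onHead K R.comul (R.comul b)) :=
        glue_onHead (AlgHom.id k (H ⊗[k] K)) Q.comul R.comul _ _
      rw [tensorComul_tmul, h1, h2]
      exact conj_tensor (shuffle₃ k H K) Q.Φ R.Φ (Q.quasi_coassoc a) (R.quasi_coassoc b)
  counit_right h := by
    induction h with
    | zero => simp only [map_zero]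
    | add x y hx hy => simp only [map_add, hx, hy]
    | tmul a b => rw [tensorComul_tmul, counitTail_tensor, Q.counit_right, R.counit_right]
  counit_left h := by
    induction h with
    | zero => simp only [map_zero]
    | add x y hx hy => simp only [map_add, hx, hy]
    | tmul a b =>
      rw [tensorComul_tmul]
      exact (glue_counitHead (AlgHom.id k (H ⊗[k] K)) _ _ _ _).trans (by rw [Q.counit_left, R.counit_left]; rfl)
  pentagon := by
    have h1 : onTail (H ⊗[k] K) (onHead (H ⊗[k] K) (tensorComul Q.comul R.comul))
        (shuffle₃ k H K (Q.Φ.val ⊗ₜ R.Φ.val))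
        = shuffle₄ k H K (onTail H (onHead H Q.comul) Q.Φ.val ⊗ₜ
            onTail K (onHead K R.comul) R.Φ.val) :=
      glue_onTail (shuffle₂ k H K) (shuffle₃ k H K) (onHead H Q.comul) (onHead K R.comul)
        (onHead (H ⊗[k] K) (tensorComul Q.comul R.comul))
        (glue_onHead (AlgHom.id k (H ⊗[k] K)) Q.comul R.comul) _ _
    have h2 : onTail (H ⊗[k] K) (onTail (H ⊗[k] K) (padOne (k := k) (H ⊗[k] K) (H ⊗[k] K)))
        (shuffle₃ k H K (Q.Φ.val ⊗ₜ R.Φ.val))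
        = shuffle₄ k H K (onTail H (onTail H (padOne H H)) Q.Φ.val ⊗ₜ
            onTail K (onTail K (padOne K K)) R.Φ.val) :=
      glue_onTail (shuffle₂ k H K) (shuffle₃ k H K) (onTail H (padOne H H))
        (onTail K (padOne K K)) (onTail (H ⊗[k] K) (padOne (H ⊗[k] K) (H ⊗[k] K)))
        (glue_onTail (AlgHom.id k (H ⊗[k] K)) (shuffle₂ k H K) (padOne H H) (padOne K K)
          (padOne (H ⊗[k] K) (H ⊗[k] K)) (fun _ _ => rfl)) _ _
    have h3 : onTail (H ⊗[k] K) (onTail (H ⊗[k] K) (tensorComul Q.comul R.comul))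
        (shuffle₃ k H K (Q.Φ.val ⊗ₜ R.Φ.val))
        = shuffle₄ k H K (onTail H (onTail H Q.comul) Q.Φ.val ⊗ₜ
            onTail K (onTail K R.comul) R.Φ.val) :=
      glue_onTail (shuffle₂ k H K) (shuffle₃ k H K) (onTail H Q.comul) (onTail K R.comul)
        (onTail (H ⊗[k] K) (tensorComul Q.comul R.comul))
        (glue_onTail (AlgHom.id k (H ⊗[k] K)) (shuffle₂ k H K) Q.comul R.comul
          (tensorComul Q.comul R.comul) (fun _ _ => rfl)) _ _
    have h4 : onHead ((H ⊗[k] K) ⊗[k] (H ⊗[k] K)) (tensorComul Q.comul R.comul)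
        (shuffle₃ k H K (Q.Φ.val ⊗ₜ R.Φ.val))
        = shuffle₄ k H K (onHead (H ⊗[k] H) Q.comul Q.Φ.val ⊗ₜ
            onHead (K ⊗[k] K) R.comul R.Φ.val) :=
      glue_onHead (shuffle₂ k H K) Q.comul R.comul _ _
    have h5 := pentagon_tensor (shuffle₄ k H K) Q.pentagon R.pentagon
    rw [← h1, ← h2, ← h3, ← h4] at h5
    exact h5
  counit_Φ := by
    have h1 : onTail (H ⊗[k] K)
        (counitHead (H ⊗[k] K) (tensorCounit Q.counit R.counit))
        (shuffle₃ k H K (Q.Φ.val ⊗ₜ R.Φ.val))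
        = shuffle₂ k H K (onTail H (counitHead H Q.counit) Q.Φ.val ⊗ₜ
            onTail K (counitHead K R.counit) R.Φ.val) :=
      glue_onTail (shuffle₂ k H K) (AlgHom.id k (H ⊗[k] K)) (counitHead H Q.counit)
        (counitHead K R.counit) (counitHead (H ⊗[k] K) (tensorCounit Q.counit R.counit))
        (glue_counitHead (AlgHom.id k (H ⊗[k] K)) Q.counit R.counit) _ _
    exact h1.trans (by
      rw [Q.counit_Φ, R.counit_Φ, ← Algebra.TensorProduct.one_def, map_one])

end Tensor

/-! ### The Drinfeld twist -/

section DrinfeldTwist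

variable {k H : Type*} [Field k] [Ring H] [Algebra k H] (Q : QuasiHopf k H)

/-- `A¹ ⊗ A² ⊗ A³ ⊗ A⁴ = (Φ ⊗ 1)(Δ ⊗ id ⊗ id)(Φ⁻¹)`. -/
def QuasiHopf.elemA : H ⊗[k] (H ⊗[k] (H ⊗[k] H)) :=
  onTail H (onTail H (padOne H H)) Q.Φ
    * onHead (H ⊗[k] H) Q.comul Q.Φ⁻¹.val

/-- `a ⊗ b ⊗ c ⊗ d ↦ S(b) α c ⊗ S(a) α d`. -/
def QuasiHopf.gammaMap : H ⊗[k] (H ⊗[k] (H ⊗[k] H)) →ₗ[k] H ⊗[k] H :=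
  (TensorProduct.map (antiLeft Q.S Q.α) (antiLeft Q.S Q.α)).comp
    ((TensorProduct.assoc k H H (H ⊗[k] H)).symm.toLinearMap.comp
      ((TensorProduct.map LinearMap.id (TensorProduct.leftComm k H H H).toLinearMap).comp
        (TensorProduct.leftComm k H H (H ⊗[k] H)).toLinearMap))

theorem QuasiHopf.gammaMap_tmul (a b c d : H) :
    Q.gammaMap (a ⊗ₜ (b ⊗ₜ (c ⊗ₜ d)))
      = ((Q.S b).unop * Q.α * c) ⊗ₜ ((Q.S a).unop * Q.α * d) := by
  simp [QuasiHopf.gammaMap]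

/-- `γ = S(A²) α A³ ⊗ S(A¹) α A⁴`. -/
def QuasiHopf.gamma : H ⊗[k] H := Q.gammaMap Q.elemA

/-- `h ↦ (S ⊗ S)(Δᶜᵒᵖ(h)) = S(h₂) ⊗ S(h₁)`. -/
def QuasiHopf.antiComulCop : H →ₗ[k] H ⊗[k] H :=
  (TensorProduct.map (antiLin Q.S) (antiLin Q.S)).comp
    ((TensorProduct.comm k H H).toLinearMap.comp Q.comul.toLinearMap)

/-- `x ⊗ y ⊗ z ↦ (S ⊗ S)(Δᶜᵒᵖ(x)) γ Δ(y β S(z))`. -/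
def QuasiHopf.twistMap : H ⊗[k] (H ⊗[k] H) →ₗ[k] H ⊗[k] H :=
  (LinearMap.mul' k (H ⊗[k] H)).comp
    (TensorProduct.map ((LinearMap.mulRight k Q.gamma).comp Q.antiComulCop)
      (Q.comul.toLinearMap.comp (antiRight Q.S Q.β)))

theorem QuasiHopf.twistMap_tmul (x y z : H) :
    Q.twistMap (x ⊗ₜ (y ⊗ₜ z))
      = Q.antiComulCop x * Q.gamma * Q.comul (y * Q.β * (Q.S z).unop) := by
  simp [QuasiHopf.twistMap]

/-- The Drinfeld twist `f = (S ⊗ S)(Δᶜᵒᵖ(x¹)) γ Δ(x² β S(x³))`, where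
`Φ⁻¹ = x¹ ⊗ x² ⊗ x³`. -/
def QuasiHopf.drinfeldTwist : H ⊗[k] H :=
  Q.twistMap Q.Φ⁻¹.val

/-- `S⁻¹`, as an algebra map `H → Hᵒᵖ`. -/
def QuasiHopf.Sinv : H →ₐ[k] Hᵐᵒᵖ :=
  (AlgEquiv.op Q.S.symm).toAlgHom.comp (AlgEquiv.opOp k H).toAlgHom

theorem QuasiHopf.unop_Sinv (h : H) : (Q.Sinv h).unop = Q.S.symm (MulOpposite.op h) := rfl

end DrinfeldTwist

/-! ### The two coactions of `Hᵒᵖ ⊗ H` -/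

section TwoCoactions

variable {k H A : Type*} [Field k] [Ring H] [Algebra k H] [Ring A] [Algebra k A]
  (Q : QuasiHopf k H)

/-- `h ⊗ a ⊗ g ↦ a ⊗ (S⁻¹(h) ⊗ g)`. -/
def QuasiHopf.arrange₃ : H ⊗[k] (A ⊗[k] H) →ₐ[k] A ⊗[k] (Hᵐᵒᵖ ⊗[k] H) :=
  (Algebra.TensorProduct.leftComm k Hᵐᵒᵖ A H).toAlgHom.comp
    (Algebra.TensorProduct.map Q.Sinv (AlgHom.id k (A ⊗[k] H)))

@[simp] theorem QuasiHopf.arrange₃_tmul (h g : H) (a : A) :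
    Q.arrange₃ (h ⊗ₜ (a ⊗ₜ g)) = a ⊗ₜ (Q.Sinv h ⊗ₜ g) := by
  simp [QuasiHopf.arrange₃]

/-- `h ⊗ h' ⊗ a ⊗ g ⊗ g' ↦ a ⊗ (S⁻¹(h') ⊗ g) ⊗ (S⁻¹(h) ⊗ g')`. -/
def QuasiHopf.arrange₅ : H ⊗[k] (H ⊗[k] (A ⊗[k] (H ⊗[k] H))) →ₐ[k]
    A ⊗[k] ((Hᵐᵒᵖ ⊗[k] H) ⊗[k] (Hᵐᵒᵖ ⊗[k] H)) :=
  (onTail A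
    ((Algebra.TensorProduct.assoc k k k Hᵐᵒᵖ H (Hᵐᵒᵖ ⊗[k] H)).symm.toAlgHom.comp
      ((onTail Hᵐᵒᵖ (Algebra.TensorProduct.leftComm k Hᵐᵒᵖ H H).toAlgHom).comp
        (Algebra.TensorProduct.leftComm k Hᵐᵒᵖ Hᵐᵒᵖ (H ⊗[k] H)).toAlgHom))).comp
  ((Algebra.TensorProduct.leftComm k Hᵐᵒᵖ A (Hᵐᵒᵖ ⊗[k] (H ⊗[k] H))).toAlgHom.comp
    ((onTail Hᵐᵒᵖ (Algebra.TensorProduct.leftComm k Hᵐᵒᵖ A (H ⊗[k] H)).toAlgHom).comp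
      (Algebra.TensorProduct.map Q.Sinv
        (Algebra.TensorProduct.map Q.Sinv (AlgHom.id k (A ⊗[k] (H ⊗[k] H)))))))

@[simp] theorem QuasiHopf.arrange₅_tmul (h h' g g' : H) (a : A) :
    Q.arrange₅ (h ⊗ₜ (h' ⊗ₜ (a ⊗ₜ (g ⊗ₜ g'))))
      = a ⊗ₜ ((Q.Sinv h' ⊗ₜ g) ⊗ₜ (Q.Sinv h ⊗ₜ g')) := by
  simp [QuasiHopf.arrange₅]

/-- `f¹ ⊗ f² ⊗ 1 ⊗ 1 ⊗ 1`, where `f` is the Drinfeld twist. -/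
def QuasiHopf.twist₅ (A : Type*) [Ring A] [Algebra k A] :
    H ⊗[k] (H ⊗[k] (A ⊗[k] (H ⊗[k] H))) :=
  onTail H (padOne H (A ⊗[k] (H ⊗[k] H))) Q.drinfeldTwist

variable (B : BicomoduleAlgebra Q.toQuasiBialgebra A)

/-- `ρ₁(u) = u_{<0>[0]} ⊗ (S⁻¹(u_{<0>[-1]}) ⊗ u_{<1>})`. -/
def rho₁ : A →ₐ[k] A ⊗[k] (Hᵐᵒᵖ ⊗[k] H) :=
  Q.arrange₃.comp ((onHead H B.lam).comp B.ρ)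

/-- `ρ₂(u) = u_{[0]<0>} ⊗ (S⁻¹(u_{[-1]}) ⊗ u_{[0]<1>})`. -/
def rho₂ : A →ₐ[k] A ⊗[k] (Hᵐᵒᵖ ⊗[k] H) :=
  Q.arrange₃.comp ((onTail H B.ρ).comp B.lam)

/-- With `Φρ = X¹ ⊗ X² ⊗ X³`, `Φλ⁻¹ = x¹ ⊗ x² ⊗ x³`, `Φλρ⁻¹ = θ¹ ⊗ θ² ⊗ θ³`:
`X¹_{[0]} x³ θ²_{[0]} ⊗ (S⁻¹(f² X¹_{[-1]2} x² θ²_{[-1]}) ⊗ X² θ³)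
  ⊗ (S⁻¹(f¹ X¹_{[-1]1} x¹ θ¹) ⊗ X³)`. -/
def phiRho₁ : A ⊗[k] ((Hᵐᵒᵖ ⊗[k] H) ⊗[k] (Hᵐᵒᵖ ⊗[k] H)) :=
  Q.arrange₅
    (Q.twist₅ A
      * onHead (A ⊗[k] (H ⊗[k] H)) Q.comul (onHead (H ⊗[k] H) B.lam B.Φρ)
      * onTail H (onTail H (padOne A (H ⊗[k] H))) B.Φlam⁻¹.val
      * onTail H (onHead (H ⊗[k] H) B.lam)
          (onTail H (onTail A (padOne H H)) B.Φlr⁻¹.val))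

/-- With `Φρ = X¹ ⊗ X² ⊗ X³`, `Φλ⁻¹ = x¹ ⊗ x² ⊗ x³`, `Φλρ = Θ¹ ⊗ Θ² ⊗ Θ³`:
`x³_{<0>} X¹ Θ²_{<0>} ⊗ (S⁻¹(f² x² Θ¹) ⊗ x³_{<1>1} X² Θ²_{<1>})
  ⊗ (S⁻¹(f¹ x¹) ⊗ x³_{<1>2} X³ Θ³)`. -/
def phiRho₂ : A ⊗[k] ((Hᵐᵒᵖ ⊗[k] H) ⊗[k] (Hᵐᵒᵖ ⊗[k] H)) :=
  Q.arrange₅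
    (Q.twist₅ A
      * onTail H (onTail H ((onTail A Q.comul).comp B.ρ)) B.Φlam⁻¹.val
      * ((1 : H) ⊗ₜ[k] ((1 : H) ⊗ₜ[k] (B.Φρ : A ⊗[k] (H ⊗[k] H))))
      * ((1 : H) ⊗ₜ[k] onTail H (onHead H B.ρ) B.Φlr))

end TwoCoactions

end

end QuasiHopfTheory

/-! Regard an algebra map from `H` into an algebra `C` as an object: `Δ` gives tensor products of
objects with commuting images, and `Φ` gives invertible elements of `C` that behave as associativity
constraints. In a bicomodule algebra, objects over `H` act from the left and from the right on
objects over `A`, written `x ▷ a` and `a ◁ p`, with constraints `Φλ`, `Φρ` and the mixed one `Φλρ`.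
An object `κ` over `Hᵒᵖ ⊗ H` has a left part `x` (through `S⁻¹`) and a right part `p`. Then `ρ₂` is
the action `x ▷ (a ◁ p)`, `ρ₁` is `(x ▷ a) ◁ p`, and `Φλρ` is the isomorphism between them.

The right part of `κ₁ ⊗ κ₂` is the tensor product of the right parts. The left part is the tensor
product of the left parts in reverse order, up to conjugation by the Drinfeld twist `f`. The
pentagon for `Φρ₂` therefore splits into a coherence identity for `Φ`, `Φλ`, `Φρ`, `Φλρ`
(`coherence_pentagon`) and the identity `(1 ⊗ f)(id ⊗ Δ)(f) Φ = (S ⊗ S ⊗ S)(X³ ⊗ X² ⊗ X¹)(f ⊗ 1)(Δ ⊗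
id)(f)` (`tw_pentagon`). Once `(A, ρ₂, Φρ₂)` is a comodule algebra, so is its twist by the image of
`Φλρ⁻¹`; that image conjugates `ρ₂` to `ρ₁`, and `coherence_twist` shows that the twisted
reassociator is `Φρ₁`. Twist equivalence is then built in.

The properties of `f` come from comparing antipodes. Both `((S ⊗ S)Δᶜᵒᵖ, γ, δ)` and `(ΔS, Δ(α),
Δ(β))` are antipodes relative to `Δ : H → H ⊗ H`. Two relative antipodes differ by an invertible
element (`RelAntipode.compareUnit`), and here that element is `f`. So `f` is invertible, it
intertwines the two maps, and `f Δ(α) = γ`. An element with such an intertwining property is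
determined by its product with the image of `α` (`eq_of_mul_α_eq`). Hence `tw_pentagon` need only be
checked after multiplication by `α`, where it equates two orders of nested evaluation
(`nested_contraction`). The normalization `ε(α) = 1` gives `ε ∘ S = ε` and is used for the counit
conditions only. -/

namespace QuasiHopfTheory

noncomputable section

/-! ### Tensor products of algebra maps with commuting images

An algebra map `u : X → C` is thought of as an object "sitting in `C`".  If `d : P → X ⊗ Y` is a
comultiplication or a coaction, then `ten d u v : P → C` is the tensor product of `u` and `v`, and
an invertible `Φ ∈ X ⊗ Y ⊗ Z` gives an invertible element `cell Φ u v w` of `C`, the associativity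
constraint of the three objects. -/

section Cells

variable {k : Type*} [Field k] {C E X Y Z P X' Y' : Type*}
  [Ring C] [Algebra k C] [Ring E] [Algebra k E] [Ring X] [Algebra k X] [Ring Y] [Algebra k Y]
  [Ring Z] [Algebra k Z] [Ring P] [Algebra k P] [Ring X'] [Algebra k X'] [Ring Y'] [Algebra k Y']

/-- The images of `u` and `v` commute. -/
class CommHom (u : X →ₐ[k] C) (v : Y →ₐ[k] C) : Prop where
  comm : ∀ x y, Commute (u x) (v y)

theorem CommHom.symm (u : X →ₐ[k] C) (v : Y →ₐ[k] C) [h : CommHom u v] : CommHom v u :=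
  ⟨fun y x => (h.comm x y).symm⟩

/-- `x ⊗ y ↦ u(x) v(y)`. -/
def lift2 (u : X →ₐ[k] C) (v : Y →ₐ[k] C) [CommHom u v] : X ⊗[k] Y →ₐ[k] C :=
  Algebra.TensorProduct.lift u v CommHom.comm

@[simp] theorem lift2_tmul (u : X →ₐ[k] C) (v : Y →ₐ[k] C) [CommHom u v] (x : X) (y : Y) :
    lift2 u v (x ⊗ₜ y) = u x * v y := rfl

/-- The tensor product of `u` and `v` along `d`. -/
def ten (d : P →ₐ[k] X ⊗[k] Y) (u : X →ₐ[k] C) (v : Y →ₐ[k] C) [CommHom u v] : P →ₐ[k] C :=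
  (lift2 u v).comp d

theorem ten_apply (d : P →ₐ[k] X ⊗[k] Y) (u : X →ₐ[k] C) (v : Y →ₐ[k] C) [CommHom u v] (p : P) :
    ten d u v p = lift2 u v (d p) := rfl

instance CommHom.lift2_left (u : X →ₐ[k] C) (v : Y →ₐ[k] C) (w : Z →ₐ[k] C) [CommHom u v]
    [CommHom u w] [CommHom v w] : CommHom (lift2 u v) w where
  comm t z := by
    induction t with
    | zero => simp
    | add x y hx hy => rw [map_add]; exact hx.add_left hy
    | tmul a b => exact (CommHom.comm a z).mul_left (CommHom.comm b z)

instance CommHom.lift2_right (u : X →ₐ[k] C) (v : Y →ₐ[k] C) (w : Z →ₐ[k] C) [CommHom v w]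
    [CommHom u v] [CommHom u w] : CommHom u (lift2 v w) where
  comm x t := by
    induction t with
    | zero => simp
    | add x y hx hy => rw [map_add]; exact hx.add_right hy
    | tmul a b => exact (CommHom.comm x a).mul_right (CommHom.comm x b)

instance CommHom.ten_left (d : P →ₐ[k] X ⊗[k] Y) (u : X →ₐ[k] C) (v : Y →ₐ[k] C) (w : Z →ₐ[k] C)
    [CommHom u v] [CommHom u w] [CommHom v w] : CommHom (ten d u v) w where
  comm _ z := CommHom.comm (u := lift2 u v) _ z

instance CommHom.ten_right (d : P →ₐ[k] Y ⊗[k] Z) (u : X →ₐ[k] C) (v : Y →ₐ[k] C) (w : Z →ₐ[k] C)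
    [CommHom v w] [CommHom u v] [CommHom u w] : CommHom u (ten d v w) where
  comm x _ := CommHom.comm (v := lift2 v w) x _

instance CommHom.comp (f : C →ₐ[k] E) (u : X →ₐ[k] C) (v : Y →ₐ[k] C) [CommHom u v] :
    CommHom (f.comp u) (f.comp v) where
  comm x y := (CommHom.comm (u := u) (v := v) x y).map f

instance CommHom.includeLeft_includeRight :
    CommHom (Algebra.TensorProduct.includeLeft : X →ₐ[k] X ⊗[k] Y)
      (Algebra.TensorProduct.includeRight : Y →ₐ[k] X ⊗[k] Y) where
  comm x y := by simp [Commute, SemiconjBy]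

theorem lift2_congr {u u' : X →ₐ[k] C} {v v' : Y →ₐ[k] C} [CommHom u v] [CommHom u' v']
    (hu : u = u') (hv : v = v') : lift2 u v = lift2 u' v' := by
  subst hu; subst hv; rfl

instance CommHom.comp_right (u : X →ₐ[k] C) (v : Y →ₐ[k] C) (f : Z →ₐ[k] Y) [CommHom u v] :
    CommHom u (v.comp f) where
  comm x z := CommHom.comm x (f z)

instance CommHom.comp_left (u : X →ₐ[k] C) (v : Y →ₐ[k] C) (f : Z →ₐ[k] X) [CommHom u v] :
    CommHom (u.comp f) v where
  comm x z := CommHom.comm (f x) z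

theorem lift2_comp_onTail (u : X →ₐ[k] C) (v : Y →ₐ[k] C) [CommHom u v] (f : Z →ₐ[k] Y) :
    (lift2 u v).comp (onTail X f) = lift2 u (v.comp f) :=
  Algebra.TensorProduct.ext' fun _ _ => rfl

theorem lift2_assoc (u : X →ₐ[k] C) (v : Y →ₐ[k] C) (w : Z →ₐ[k] C)
    [CommHom u v] [CommHom u w] [CommHom v w] (t : X ⊗[k] Y) (z : Z) :
    lift2 u (lift2 v w) (Algebra.TensorProduct.assoc k k k X Y Z (t ⊗ₜ z))
      = lift2 u v t * w z := by
  induction t with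
  | zero => simp
  | add x y hx hy => rw [TensorProduct.add_tmul, map_add, map_add, hx, hy, map_add, add_mul]
  | tmul a b => simp [mul_assoc]

theorem lift2_comp_onHead (u : X →ₐ[k] C) (v : Y →ₐ[k] C) (w : Z →ₐ[k] C)
    [CommHom u v] [CommHom u w] [CommHom v w] (d : P →ₐ[k] X ⊗[k] Y) :
    (lift2 u (lift2 v w)).comp (onHead Z d) = lift2 (ten d u v) w :=
  Algebra.TensorProduct.ext' fun _ _ => lift2_assoc u v w _ _

theorem lift2_comp_padOne (u : X →ₐ[k] C) (v : Y →ₐ[k] C) [CommHom u v] :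
    (lift2 u v).comp (padOne X Y) = u :=
  AlgHom.ext fun x => by simp

theorem lift2_one_tmul (u : X →ₐ[k] C) (v : Y →ₐ[k] C) [CommHom u v] (y : Y) :
    lift2 u v (1 ⊗ₜ y) = v y := by simp

theorem comp_lift2 (f : C →ₐ[k] E) (u : X →ₐ[k] C) (v : Y →ₐ[k] C) [CommHom u v] :
    f.comp (lift2 u v) = lift2 (f.comp u) (f.comp v) :=
  Algebra.TensorProduct.ext' fun _ _ => by simp

theorem comp_ten (f : C →ₐ[k] E) (d : P →ₐ[k] X ⊗[k] Y) (u : X →ₐ[k] C) (v : Y →ₐ[k] C)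
    [CommHom u v] : f.comp (ten d u v) = ten d (f.comp u) (f.comp v) := by
  rw [ten, ten, ← comp_lift2]; rfl

theorem lift2_includeLeft_includeRight :
    lift2 (Algebra.TensorProduct.includeLeft : X →ₐ[k] X ⊗[k] Y)
      (Algebra.TensorProduct.includeRight : Y →ₐ[k] X ⊗[k] Y) = AlgHom.id k _ :=
  Algebra.TensorProduct.ext' fun _ _ => by simp

/-- The invertible element of `C` given by `Φ ∈ X ⊗ Y ⊗ Z`. -/
def cell (Φ : (X ⊗[k] (Y ⊗[k] Z))ˣ) (u : X →ₐ[k] C) (v : Y →ₐ[k] C) (w : Z →ₐ[k] C)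
    [CommHom u v] [CommHom u w] [CommHom v w] : Cˣ :=
  Units.map (lift2 u (lift2 v w) : X ⊗[k] (Y ⊗[k] Z) →* C) Φ

theorem cell_val (Φ : (X ⊗[k] (Y ⊗[k] Z))ˣ) (u : X →ₐ[k] C) (v : Y →ₐ[k] C) (w : Z →ₐ[k] C)
    [CommHom u v] [CommHom u w] [CommHom v w] :
    (cell Φ u v w).val = lift2 u (lift2 v w) Φ.val := rfl

theorem cell_inv_val (Φ : (X ⊗[k] (Y ⊗[k] Z))ˣ) (u : X →ₐ[k] C) (v : Y →ₐ[k] C) (w : Z →ₐ[k] C)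
    [CommHom u v] [CommHom u w] [CommHom v w] :
    (cell Φ u v w)⁻¹.val = lift2 u (lift2 v w) Φ⁻¹.val := rfl

theorem cell_congr (Φ : (X ⊗[k] (Y ⊗[k] Z))ˣ) {u u' : X →ₐ[k] C} {v v' : Y →ₐ[k] C}
    {w w' : Z →ₐ[k] C} [CommHom u v] [CommHom u w] [CommHom v w] [CommHom u' v'] [CommHom u' w']
    [CommHom v' w'] (hu : u = u') (hv : v = v') (hw : w = w') :
    cell Φ u v w = cell Φ u' v' w' := by
  subst hu; subst hv; subst hw; rfl

theorem map_cell (f : C →ₐ[k] E) (Φ : (X ⊗[k] (Y ⊗[k] Z))ˣ) (u : X →ₐ[k] C) (v : Y →ₐ[k] C)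
    (w : Z →ₐ[k] C) [CommHom u v] [CommHom u w] [CommHom v w] :
    Units.map (f : C →* E) (cell Φ u v w) = cell Φ (f.comp u) (f.comp v) (f.comp w) := by
  apply Units.ext
  change (f.comp (lift2 u (lift2 v w))) Φ.val = lift2 (f.comp u) (lift2 (f.comp v) (f.comp w)) Φ.val
  rw [comp_lift2]
  exact DFunLike.congr_fun (lift2_congr rfl (comp_lift2 _ _ _)) _

/-- The pentagon axiom, in terms of cells. -/
theorem lift_pentagon_iff {X₁ X₂ X₃ X₄ P₁₂ P₂₃ P₃₄ : Type*} [Ring X₁] [Algebra k X₁] [Ring X₂]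
    [Algebra k X₂] [Ring X₃] [Algebra k X₃] [Ring X₄] [Algebra k X₄] [Ring P₁₂] [Algebra k P₁₂]
    [Ring P₂₃] [Algebra k P₂₃] [Ring P₃₄] [Algebra k P₃₄]
    (d₁₂ : P₁₂ →ₐ[k] X₁ ⊗[k] X₂) (d₂₃ : P₂₃ →ₐ[k] X₂ ⊗[k] X₃) (d₃₄ : P₃₄ →ₐ[k] X₃ ⊗[k] X₄)
    (Φ₁ : (X₂ ⊗[k] (X₃ ⊗[k] X₄))ˣ) (Φ₂ : (X₁ ⊗[k] (P₂₃ ⊗[k] X₄))ˣ)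
    (Φ₃ : (X₁ ⊗[k] (X₂ ⊗[k] X₃))ˣ) (Φ₄ : (X₁ ⊗[k] (X₂ ⊗[k] P₃₄))ˣ)
    (Φ₅ : (P₁₂ ⊗[k] (X₃ ⊗[k] X₄))ˣ)
    (a : X₁ →ₐ[k] C) (b : X₂ →ₐ[k] C) (c : X₃ →ₐ[k] C) (d : X₄ →ₐ[k] C)
    [CommHom a b] [CommHom a c] [CommHom a d] [CommHom b c] [CommHom b d] [CommHom c d] :
    lift2 a (lift2 b (lift2 c d)) (((1 : X₁) ⊗ₜ[k] (Φ₁ : X₂ ⊗[k] (X₃ ⊗[k] X₄)))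
        * onTail X₁ (onHead X₄ d₂₃) Φ₂.val * onTail X₁ (onTail X₂ (padOne X₃ X₄)) Φ₃.val)
      = lift2 a (lift2 b (lift2 c d))
        (onTail X₁ (onTail X₂ d₃₄) Φ₄.val * onHead (X₃ ⊗[k] X₄) d₁₂ Φ₅.val) ↔
    cell Φ₁ b c d * cell Φ₂ a (ten d₂₃ b c) d * cell Φ₃ a b c
      = cell Φ₄ a b (ten d₃₄ c d) * cell Φ₅ (ten d₁₂ a b) c d := by
  simp only [map_mul, lift2_one_tmul]
  -- A comultiplication on a leg becomes a tensor product in that slot of the cell, and a factor `1`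
  -- disappears. The spaces are kept distinct so that one statement serves the pentagons of `Φ`,
  -- `Φλ`, `Φρ` and both mixed ones.
  have e2 : (lift2 a (lift2 b (lift2 c d))).comp (onTail X₁ (onHead X₄ d₂₃))
      = lift2 a (lift2 (ten d₂₃ b c) d) :=
    (lift2_comp_onTail _ _ _).trans (lift2_congr rfl (lift2_comp_onHead _ _ _ _))
  have e3 : (lift2 a (lift2 b (lift2 c d))).comp (onTail X₁ (onTail X₂ (padOne X₃ X₄)))
      = lift2 a (lift2 b c) :=
    (lift2_comp_onTail _ _ _).trans (lift2_congr rfl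
      ((lift2_comp_onTail _ _ _).trans (lift2_congr rfl (lift2_comp_padOne _ _))))
  have e4 : (lift2 a (lift2 b (lift2 c d))).comp (onTail X₁ (onTail X₂ d₃₄))
      = lift2 a (lift2 b (ten d₃₄ c d)) :=
    (lift2_comp_onTail _ _ _).trans (lift2_congr rfl (lift2_comp_onTail _ _ _))
  have e5 : (lift2 a (lift2 b (lift2 c d))).comp (onHead (X₃ ⊗[k] X₄) d₁₂)
      = lift2 (ten d₁₂ a b) (lift2 c d) := lift2_comp_onHead _ _ _ _
  rw [← AlgHom.comp_apply, e2, ← AlgHom.comp_apply, e3, ← AlgHom.comp_apply, e4,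
    ← AlgHom.comp_apply, e5]
  exact ⟨fun h => Units.ext h, fun h => congrArg Units.val h⟩

/-- The pentagon identity for the cells of five elements satisfying the pentagon axiom. -/
theorem cell_pentagon {X₁ X₂ X₃ X₄ P₁₂ P₂₃ P₃₄ : Type*} [Ring X₁] [Algebra k X₁] [Ring X₂]
    [Algebra k X₂] [Ring X₃] [Algebra k X₃] [Ring X₄] [Algebra k X₄] [Ring P₁₂] [Algebra k P₁₂]
    [Ring P₂₃] [Algebra k P₂₃] [Ring P₃₄] [Algebra k P₃₄]
    {d₁₂ : P₁₂ →ₐ[k] X₁ ⊗[k] X₂} {d₂₃ : P₂₃ →ₐ[k] X₂ ⊗[k] X₃} {d₃₄ : P₃₄ →ₐ[k] X₃ ⊗[k] X₄}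
    {Φ₁ : (X₂ ⊗[k] (X₃ ⊗[k] X₄))ˣ} {Φ₂ : (X₁ ⊗[k] (P₂₃ ⊗[k] X₄))ˣ}
    {Φ₃ : (X₁ ⊗[k] (X₂ ⊗[k] X₃))ˣ} {Φ₄ : (X₁ ⊗[k] (X₂ ⊗[k] P₃₄))ˣ}
    {Φ₅ : (P₁₂ ⊗[k] (X₃ ⊗[k] X₄))ˣ}
    (h : ((1 : X₁) ⊗ₜ[k] (Φ₁ : X₂ ⊗[k] (X₃ ⊗[k] X₄))) * onTail X₁ (onHead X₄ d₂₃) Φ₂.val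
        * onTail X₁ (onTail X₂ (padOne X₃ X₄)) Φ₃.val
      = onTail X₁ (onTail X₂ d₃₄) Φ₄.val * onHead (X₃ ⊗[k] X₄) d₁₂ Φ₅.val)
    (a : X₁ →ₐ[k] C) (b : X₂ →ₐ[k] C) (c : X₃ →ₐ[k] C) (d : X₄ →ₐ[k] C)
    [CommHom a b] [CommHom a c] [CommHom a d] [CommHom b c] [CommHom b d] [CommHom c d] :
    cell Φ₁ b c d * cell Φ₂ a (ten d₂₃ b c) d * cell Φ₃ a b c
      = cell Φ₄ a b (ten d₃₄ c d) * cell Φ₅ (ten d₁₂ a b) c d :=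
  (lift_pentagon_iff d₁₂ d₂₃ d₃₄ Φ₁ Φ₂ Φ₃ Φ₄ Φ₅ a b c d).mp (congrArg _ h)

/-! ### Naturality -/

/-- `c` intertwines `u` and `u'`. -/
def Intw (c : Cˣ) (u u' : X →ₐ[k] C) : Prop := ∀ x, c.val * u x = u' x * c.val

theorem Intw.inv {c : Cˣ} {u u' : X →ₐ[k] C} (h : Intw c u u') : Intw c⁻¹ u' u := fun x => by
  rw [Units.inv_mul_eq_iff_eq_mul, ← mul_assoc, h x, mul_assoc, Units.mul_inv, mul_one]

theorem Intw.mul {c c' : Cˣ} {u u' u'' : X →ₐ[k] C} (h' : Intw c' u' u'') (h : Intw c u u') :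
    Intw (c' * c) u u'' := fun x => by
  rw [Units.val_mul, mul_assoc, h x, ← mul_assoc, h' x, mul_assoc]

theorem Intw.lift2 {c : Cˣ} {u u' : X →ₐ[k] C} {v v' : Y →ₐ[k] C} [CommHom u v] [CommHom u' v']
    (hu : Intw c u u') (hv : Intw c v v') : Intw c (lift2 u v) (lift2 u' v') := fun t => by
  induction t with
  | zero => simp
  | add x y hx hy => rw [map_add, mul_add, hx, hy, map_add, add_mul]
  | tmul a b =>
    rw [lift2_tmul, lift2_tmul, ← mul_assoc, hu, mul_assoc, hv, mul_assoc]

theorem Intw.ten {c : Cˣ} {u u' : X →ₐ[k] C} {v v' : Y →ₐ[k] C} [CommHom u v] [CommHom u' v']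
    (d : P →ₐ[k] X ⊗[k] Y) (hu : Intw c u u') (hv : Intw c v v') :
    Intw c (ten d u v) (ten d u' v') := fun p => hu.lift2 hv (d p)

theorem Intw.cell {c : Cˣ} {u u' : X →ₐ[k] C} {v v' : Y →ₐ[k] C} {w w' : Z →ₐ[k] C}
    [CommHom u v] [CommHom u w] [CommHom v w] [CommHom u' v'] [CommHom u' w'] [CommHom v' w']
    (Φ : (X ⊗[k] (Y ⊗[k] Z))ˣ) (hu : Intw c u u') (hv : Intw c v v') (hw : Intw c w w') :
    c * cell Φ u v w = cell Φ u' v' w' * c :=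
  Units.ext (hu.lift2 (hv.lift2 hw) Φ.val)

/-- An equivalence, because both directions serve: forwards to use an axiom on arbitrary objects,
backwards on the universal legs, where the lift is the identity, to establish the axiom for a new
structure. -/
theorem lift_intw_iff {X₁ X₂ X₃ P₁₂ P₂₃ : Type*} [Ring X₁] [Algebra k X₁] [Ring X₂]
    [Algebra k X₂] [Ring X₃] [Algebra k X₃] [Ring P₁₂] [Algebra k P₁₂]
    [Ring P₂₃] [Algebra k P₂₃] (d₁₂ : P₁₂ →ₐ[k] X₁ ⊗[k] X₂) (d₂₃ : P₂₃ →ₐ[k] X₂ ⊗[k] X₃)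
    (d : P →ₐ[k] P₁₂ ⊗[k] X₃) (d' : P →ₐ[k] X₁ ⊗[k] P₂₃) (Φ : (X₁ ⊗[k] (X₂ ⊗[k] X₃))ˣ)
    (u : X₁ →ₐ[k] C) (v : X₂ →ₐ[k] C) (w : X₃ →ₐ[k] C)
    [CommHom u v] [CommHom u w] [CommHom v w] :
    (∀ p, lift2 u (lift2 v w) (Φ.val * onHead X₃ d₁₂ (d p))
      = lift2 u (lift2 v w) (onTail X₁ d₂₃ (d' p) * Φ.val)) ↔
    Intw (cell Φ u v w) (ten d (ten d₁₂ u v) w) (ten d' u (ten d₂₃ v w)) := by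
  refine forall_congr' fun p => ?_
  rw [map_mul, map_mul, ← AlgHom.comp_apply, lift2_comp_onHead,
    ← AlgHom.comp_apply (lift2 u (lift2 v w)) (onTail X₁ d₂₃), lift2_comp_onTail]
  rfl

/-- The cell intertwines the two bracketings. -/
theorem cell_intw {X₁ X₂ X₃ P₁₂ P₂₃ : Type*} [Ring X₁] [Algebra k X₁] [Ring X₂]
    [Algebra k X₂] [Ring X₃] [Algebra k X₃] [Ring P₁₂] [Algebra k P₁₂]
    [Ring P₂₃] [Algebra k P₂₃] {d₁₂ : P₁₂ →ₐ[k] X₁ ⊗[k] X₂} {d₂₃ : P₂₃ →ₐ[k] X₂ ⊗[k] X₃}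
    {d : P →ₐ[k] P₁₂ ⊗[k] X₃} {d' : P →ₐ[k] X₁ ⊗[k] P₂₃} {Φ : (X₁ ⊗[k] (X₂ ⊗[k] X₃))ˣ}
    (h : ∀ p, Φ.val * onHead X₃ d₁₂ (d p) = onTail X₁ d₂₃ (d' p) * Φ.val)
    (u : X₁ →ₐ[k] C) (v : X₂ →ₐ[k] C) (w : X₃ →ₐ[k] C)
    [CommHom u v] [CommHom u w] [CommHom v w] :
    Intw (cell Φ u v w) (ten d (ten d₁₂ u v) w) (ten d' u (ten d₂₃ v w)) :=
  (lift_intw_iff d₁₂ d₂₃ d d' Φ u v w).mp fun p => congrArg _ (h p)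

/-- An object on legs disjoint from those of a cell is fixed by it. Together with `Intw.ten` and
`Intw.cell`, this supplies the naturality squares of the coherence proofs. -/
theorem cell_intw_left (Φ : (X ⊗[k] (Y ⊗[k] Z))ˣ) (u : X →ₐ[k] C) (v : Y →ₐ[k] C) (w : Z →ₐ[k] C)
    [CommHom u v] [CommHom u w] [CommHom v w] (z : P →ₐ[k] C) [CommHom z u] [CommHom z v]
    [CommHom z w] : Intw (cell Φ u v w) z z := fun p =>
  ((CommHom.comm (u := z) (v := lift2 u (lift2 v w)) p Φ.val).eq).symm

/-! ### Counits -/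

/-- The unit object: `x ↦ ε(x) 1`. -/
def unitHom (C : Type*) [Ring C] [Algebra k C] (ε : X →ₐ[k] k) : X →ₐ[k] C :=
  (Algebra.ofId k C).comp ε

theorem unitHom_apply (ε : X →ₐ[k] k) (x : X) : unitHom C ε x = ε x • (1 : C) :=
  Algebra.algebraMap_eq_smul_one _

instance CommHom.unit_left (ε : X →ₐ[k] k) (v : Y →ₐ[k] C) : CommHom (unitHom C ε) v where
  comm _ _ := Algebra.commute_algebraMap_left _ _

instance CommHom.unit_right (ε : X →ₐ[k] k) (v : Y →ₐ[k] C) : CommHom v (unitHom C ε) where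
  comm _ _ := Algebra.commute_algebraMap_right _ _

theorem lift2_unit_left (ε : X →ₐ[k] k) (v : Y →ₐ[k] C) :
    lift2 (unitHom C ε) v = v.comp (counitHead Y ε) :=
  Algebra.TensorProduct.ext' fun x y => by simp [unitHom_apply]

theorem lift2_unit_right (ε : Y →ₐ[k] k) (v : X →ₐ[k] C) :
    lift2 v (unitHom C ε) = v.comp (counitTail X ε) :=
  Algebra.TensorProduct.ext' fun x y => by simp [unitHom_apply]

theorem ten_unit_left {ε : X →ₐ[k] k} {d : Y →ₐ[k] X ⊗[k] Y} (h : ∀ y, counitHead Y ε (d y) = y)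
    (v : Y →ₐ[k] C) : ten d (unitHom C ε) v = v := by
  ext y
  rw [ten_apply, lift2_unit_left, AlgHom.comp_apply, h]

theorem ten_unit_right {ε : X →ₐ[k] k} {d : Y →ₐ[k] Y ⊗[k] X} (h : ∀ y, counitTail Y ε (d y) = y)
    (v : Y →ₐ[k] C) : ten d v (unitHom C ε) = v := by
  ext y
  rw [ten_apply, lift2_unit_right, AlgHom.comp_apply, h]

theorem cell_unit_first {Φ : (X ⊗[k] (Y ⊗[k] Z))ˣ} {ε : X →ₐ[k] k}
    (h : counitHead (Y ⊗[k] Z) ε Φ.val = 1) (v : Y →ₐ[k] C) (w : Z →ₐ[k] C) [CommHom v w] :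
    cell Φ (unitHom C ε) v w = 1 := by
  apply Units.ext
  rw [cell_val, lift2_unit_left, AlgHom.comp_apply, h, map_one]; rfl

theorem cell_unit_mid {Φ : (X ⊗[k] (Y ⊗[k] Z))ˣ} {ε : Y →ₐ[k] k}
    (h : onTail X (counitHead Z ε) Φ.val = 1) (u : X →ₐ[k] C) (w : Z →ₐ[k] C) [CommHom u w] :
    cell Φ u (unitHom C ε) w = 1 := by
  apply Units.ext
  have e : lift2 u (lift2 (unitHom C ε) w) = (lift2 u w).comp (onTail X (counitHead Z ε)) :=
    (lift2_congr rfl (lift2_unit_left ε w)).trans (lift2_comp_onTail _ _ _).symm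
  rw [cell_val, e, AlgHom.comp_apply, h, map_one]; rfl

theorem cell_unit_last {Φ : (X ⊗[k] (Y ⊗[k] Z))ˣ} {ε : Z →ₐ[k] k}
    (h : onTail X (counitTail Y ε) Φ.val = 1) (u : X →ₐ[k] C) (v : Y →ₐ[k] C) [CommHom u v] :
    cell Φ u v (unitHom C ε) = 1 := by
  apply Units.ext
  have e : lift2 u (lift2 v (unitHom C ε)) = (lift2 u v).comp (onTail X (counitTail Y ε)) :=
    (lift2_congr rfl (lift2_unit_right ε v)).trans (lift2_comp_onTail _ _ _).symm
  rw [cell_val, e, AlgHom.comp_apply, h, map_one]; rfl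

/-! ### Functionals that absorb an object -/

variable {V : Type*} [AddCommGroup V] [Module k V]

/-- On the left, the functional `G` does not distinguish `u` from `u'`. -/
def LAbs (G : C →ₗ[k] V) (u u' : X →ₐ[k] C) : Prop := ∀ x t, G (u x * t) = G (u' x * t)

/-- On the right, the functional `G` does not distinguish `u` from `u'`. -/
def RAbs (G : C →ₗ[k] V) (u u' : X →ₐ[k] C) : Prop := ∀ x t, G (t * u x) = G (t * u' x)

theorem LAbs.lift2_left {G : C →ₗ[k] V} {u u' : X →ₐ[k] C} (h : LAbs G u u') (v : Y →ₐ[k] C)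
    [CommHom u v] [CommHom u' v] : LAbs G (lift2 u v) (lift2 u' v) := fun s t => by
  induction s with
  | zero => simp
  | add x y hx hy => simp only [map_add, add_mul, hx, hy]
  | tmul a b => rw [lift2_tmul, lift2_tmul, mul_assoc, h, mul_assoc]

/-- Absorption acts on the outermost left factor only; commutation with `u` brings `v` there. -/
theorem LAbs.lift2_right {G : C →ₗ[k] V} {v v' : Y →ₐ[k] C} (h : LAbs G v v') (u : X →ₐ[k] C)
    [CommHom u v] [CommHom u v'] : LAbs G (lift2 u v) (lift2 u v') := fun s t => by
  induction s with
  | zero => simp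
  | add x y hx hy => simp only [map_add, add_mul, hx, hy]
  | tmul a b =>
    rw [lift2_tmul, lift2_tmul, (CommHom.comm (u := u) (v := v) a b).eq,
      (CommHom.comm (u := u) (v := v') a b).eq, mul_assoc, h, mul_assoc]

theorem RAbs.lift2_left {G : C →ₗ[k] V} {u u' : X →ₐ[k] C} (h : RAbs G u u') (v : Y →ₐ[k] C)
    [CommHom u v] [CommHom u' v] : RAbs G (lift2 u v) (lift2 u' v) := fun s t => by
  induction s with
  | zero => simp
  | add x y hx hy => simp only [map_add, mul_add, hx, hy]
  | tmul a b =>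
    rw [lift2_tmul, lift2_tmul, (CommHom.comm (u := u) (v := v) a b).eq,
      (CommHom.comm (u := u') (v := v) a b).eq, ← mul_assoc, h, mul_assoc]

theorem RAbs.lift2_right {G : C →ₗ[k] V} {v v' : Y →ₐ[k] C} (h : RAbs G v v') (u : X →ₐ[k] C)
    [CommHom u v] [CommHom u v'] : RAbs G (lift2 u v) (lift2 u v') := fun s t => by
  induction s with
  | zero => simp
  | add x y hx hy => simp only [map_add, mul_add, hx, hy]
  | tmul a b => rw [lift2_tmul, lift2_tmul, ← mul_assoc, h, mul_assoc]

theorem LAbs.ten_left {G : C →ₗ[k] V} {u u' : X →ₐ[k] C} (h : LAbs G u u') (d : P →ₐ[k] X ⊗[k] Y)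
    (v : Y →ₐ[k] C) [CommHom u v] [CommHom u' v] : LAbs G (ten d u v) (ten d u' v) :=
  fun p t => h.lift2_left v (d p) t

theorem LAbs.ten_right {G : C →ₗ[k] V} {v v' : Y →ₐ[k] C} (h : LAbs G v v')
    (d : P →ₐ[k] X ⊗[k] Y) (u : X →ₐ[k] C) [CommHom u v] [CommHom u v'] :
    LAbs G (ten d u v) (ten d u v') := fun p t => h.lift2_right u (d p) t

theorem RAbs.ten_left {G : C →ₗ[k] V} {u u' : X →ₐ[k] C} (h : RAbs G u u') (d : P →ₐ[k] X ⊗[k] Y)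
    (v : Y →ₐ[k] C) [CommHom u v] [CommHom u' v] : RAbs G (ten d u v) (ten d u' v) :=
  fun p t => h.lift2_left v (d p) t

theorem RAbs.ten_right {G : C →ₗ[k] V} {v v' : Y →ₐ[k] C} (h : RAbs G v v')
    (d : P →ₐ[k] X ⊗[k] Y) (u : X →ₐ[k] C) [CommHom u v] [CommHom u v'] :
    RAbs G (ten d u v) (ten d u v') := fun p t => h.lift2_right u (d p) t

/-- Left absorption persists behind a factor that commutes with both objects. -/
theorem LAbs.mul_left {G : C →ₗ[k] V} {u u' : X →ₐ[k] C} (h : LAbs G u u') {p : Cˣ}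
    (hu : Intw p u u) (hu' : Intw p u' u') : LAbs (G.comp (LinearMap.mulLeft k p.val)) u u' :=
  fun x t => by
    rw [LinearMap.comp_apply, LinearMap.comp_apply, LinearMap.mulLeft_apply,
      LinearMap.mulLeft_apply, ← mul_assoc, ← mul_assoc, hu, hu', mul_assoc, mul_assoc, h]

theorem RAbs.mul_right {G : C →ₗ[k] V} {u u' : X →ₐ[k] C} (h : RAbs G u u') {p : Cˣ}
    (hu : Intw p u u) (hu' : Intw p u' u') : RAbs (G.comp (LinearMap.mulRight k p.val)) u u' :=
  fun x t => by
    rw [LinearMap.comp_apply, LinearMap.comp_apply, LinearMap.mulRight_apply,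
      LinearMap.mulRight_apply, mul_assoc, mul_assoc, ← hu, ← hu', ← mul_assoc, ← mul_assoc, h]

section AbsCell

variable {G : C →ₗ[k] V} {Φ : (X ⊗[k] (Y ⊗[k] Z))ˣ} {u u' : X →ₐ[k] C} {v v' : Y →ₐ[k] C}
  {w w' : Z →ₐ[k] C}

/-- These replacements are how the antipode axioms erase cells: a tensor product that `G` contracts
is replaced by the unit object, and a cell with a unit slot is `1`. -/
theorem LAbs.cell_first [CommHom u v] [CommHom u w] [CommHom v w] [CommHom u' v] [CommHom u' w]
    (h : LAbs G u u') (t : C) :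
    G ((cell Φ u v w).val * t) = G ((cell Φ u' v w).val * t) := h.lift2_left _ _ _

theorem LAbs.cell_mid [CommHom u v] [CommHom u w] [CommHom v w] [CommHom u v'] [CommHom v' w]
    (h : LAbs G v v') (t : C) :
    G ((cell Φ u v w).val * t) = G ((cell Φ u v' w).val * t) :=
  (h.lift2_left w).lift2_right u _ _

theorem LAbs.cell_last [CommHom u v] [CommHom u w] [CommHom v w] [CommHom u w'] [CommHom v w']
    (h : LAbs G w w') (t : C) :
    G ((cell Φ u v w).val * t) = G ((cell Φ u v w').val * t) :=
  (h.lift2_right v).lift2_right u _ _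

theorem LAbs.cell_inv_first [CommHom u v] [CommHom u w] [CommHom v w] [CommHom u' v]
    [CommHom u' w] (h : LAbs G u u') (t : C) :
    G ((cell Φ u v w)⁻¹.val * t) = G ((cell Φ u' v w)⁻¹.val * t) := h.cell_first (Φ := Φ⁻¹) t

theorem LAbs.cell_inv_mid [CommHom u v] [CommHom u w] [CommHom v w] [CommHom u v'] [CommHom v' w]
    (h : LAbs G v v') (t : C) :
    G ((cell Φ u v w)⁻¹.val * t) = G ((cell Φ u v' w)⁻¹.val * t) := h.cell_mid (Φ := Φ⁻¹) t

theorem LAbs.cell_inv_last [CommHom u v] [CommHom u w] [CommHom v w] [CommHom u w'] [CommHom v w']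
    (h : LAbs G w w') (t : C) :
    G ((cell Φ u v w)⁻¹.val * t) = G ((cell Φ u v w')⁻¹.val * t) := h.cell_last (Φ := Φ⁻¹) t

theorem RAbs.cell_first [CommHom u v] [CommHom u w] [CommHom v w] [CommHom u' v] [CommHom u' w]
    (h : RAbs G u u') (t : C) :
    G (t * (cell Φ u v w).val) = G (t * (cell Φ u' v w).val) := h.lift2_left _ _ _

theorem RAbs.cell_mid [CommHom u v] [CommHom u w] [CommHom v w] [CommHom u v'] [CommHom v' w]
    (h : RAbs G v v') (t : C) :
    G (t * (cell Φ u v w).val) = G (t * (cell Φ u v' w).val) :=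
  (h.lift2_left w).lift2_right u _ _

theorem RAbs.cell_last [CommHom u v] [CommHom u w] [CommHom v w] [CommHom u w'] [CommHom v w']
    (h : RAbs G w w') (t : C) :
    G (t * (cell Φ u v w).val) = G (t * (cell Φ u v w').val) :=
  (h.lift2_right v).lift2_right u _ _

theorem RAbs.cell_inv_first [CommHom u v] [CommHom u w] [CommHom v w] [CommHom u' v]
    [CommHom u' w] (h : RAbs G u u') (t : C) :
    G (t * (cell Φ u v w)⁻¹.val) = G (t * (cell Φ u' v w)⁻¹.val) := h.cell_first (Φ := Φ⁻¹) t

theorem RAbs.cell_inv_mid [CommHom u v] [CommHom u w] [CommHom v w] [CommHom u v'] [CommHom v' w]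
    (h : RAbs G v v') (t : C) :
    G (t * (cell Φ u v w)⁻¹.val) = G (t * (cell Φ u v' w)⁻¹.val) := h.cell_mid (Φ := Φ⁻¹) t

theorem RAbs.cell_inv_last [CommHom u v] [CommHom u w] [CommHom v w] [CommHom u w'] [CommHom v w']
    (h : RAbs G w w') (t : C) :
    G (t * (cell Φ u v w)⁻¹.val) = G (t * (cell Φ u v w')⁻¹.val) := h.cell_last (Φ := Φ⁻¹) t

end AbsCell

end Cells

end

end QuasiHopfTheory

/-! ### Coherence over a quasi-bialgebra, and cells under contracting functionals. -/

namespace QuasiHopfTheory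

noncomputable section

section Coherence

variable {k : Type*} [Field k] {C H X Y Z P : Type*} [Ring C] [Algebra k C] [Ring H] [Algebra k H]
  [Ring X] [Algebra k X] [Ring Y] [Algebra k Y] [Ring Z] [Algebra k Z] [Ring P] [Algebra k P]

theorem cell_intw_right (Φ : (X ⊗[k] (Y ⊗[k] Z))ˣ) (u : X →ₐ[k] C) (v : Y →ₐ[k] C)
    (w : Z →ₐ[k] C) [CommHom u v] [CommHom u w] [CommHom v w] (z : P →ₐ[k] C) [CommHom u z]
    [CommHom v z] [CommHom w z] : Intw (cell Φ u v w) z z := fun p =>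
  (CommHom.comm (u := lift2 u (lift2 v w)) (v := z) Φ.val p).eq

variable (Q : QuasiBialgebra k H)

local infixr:75 "⋄" => ten (QuasiBialgebra.comul Q)
local notation:max "⦅" u "," v "," w "⦆" => cell (QuasiBialgebra.Φ Q) u v w

/-- The unit object over a quasi-bialgebra. -/
abbrev QuasiBialgebra.unit (C : Type*) [Ring C] [Algebra k C] : H →ₐ[k] C :=
  unitHom C Q.counit

theorem QuasiBialgebra.assoc_pentagon (a b c d : H →ₐ[k] C) [CommHom a b] [CommHom a c]
    [CommHom a d] [CommHom b c] [CommHom b d] [CommHom c d] :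
    ⦅b, c, d⦆ * ⦅a, b ⋄ c, d⦆ * ⦅a, b, c⦆ = ⦅a, b, c ⋄ d⦆ * ⦅a ⋄ b, c, d⦆ :=
  cell_pentagon Q.pentagon a b c d

theorem QuasiBialgebra.assoc_intw (u v w : H →ₐ[k] C) [CommHom u v] [CommHom u w] [CommHom v w] :
    Intw ⦅u, v, w⦆ ((u ⋄ v) ⋄ w) (u ⋄ v ⋄ w) :=
  cell_intw (fun h => by rw [Q.quasi_coassoc, mul_assoc, Units.inv_mul, mul_one]) u v w

theorem QuasiBialgebra.unit_tens (u : H →ₐ[k] C) : Q.unit C ⋄ u = u :=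
  ten_unit_left Q.counit_left u

theorem QuasiBialgebra.tens_unit (u : H →ₐ[k] C) : u ⋄ Q.unit C = u :=
  ten_unit_right Q.counit_right u

theorem QuasiBialgebra.assoc_unit_mid (u v : H →ₐ[k] C) [CommHom u v] :
    ⦅u, Q.unit C, v⦆ = 1 := cell_unit_mid Q.counit_Φ u v

/-- The pentagon with two unit objects makes this invertible element idempotent, hence `1`. Only the
middle counit condition is an axiom for `Φ`. -/
theorem QuasiBialgebra.assoc_unit_first (v w : H →ₐ[k] C) [CommHom v w] :
    ⦅Q.unit C, v, w⦆ = 1 := by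
  have h := Q.assoc_pentagon (Q.unit C) (Q.unit C) v w
  rw [Q.assoc_unit_mid, mul_one, cell_congr Q.Φ rfl (Q.unit_tens v) rfl, Q.assoc_unit_mid,
    one_mul, cell_congr Q.Φ (Q.unit_tens (Q.unit C)) rfl rfl] at h
  exact mul_eq_left.mp h

theorem QuasiBialgebra.assoc_unit_last (u v : H →ₐ[k] C) [CommHom u v] :
    ⦅u, v, Q.unit C⦆ = 1 := by
  have h := Q.assoc_pentagon u v (Q.unit C) (Q.unit C)
  rw [Q.assoc_unit_mid, one_mul, cell_congr Q.Φ rfl (Q.tens_unit v) rfl,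
    cell_congr Q.Φ rfl rfl (Q.unit_tens (Q.unit C)), Q.assoc_unit_mid, mul_one] at h
  exact mul_eq_right.mp h

section SixLegs

variable (u₁ u₂ u₃ u₄ u₅ u₆ : H →ₐ[k] C) [CommHom u₁ u₂] [CommHom u₁ u₃] [CommHom u₁ u₄]
  [CommHom u₁ u₅] [CommHom u₁ u₆] [CommHom u₂ u₃] [CommHom u₂ u₄] [CommHom u₂ u₅] [CommHom u₂ u₆]
  [CommHom u₃ u₄] [CommHom u₃ u₅] [CommHom u₃ u₆] [CommHom u₄ u₅] [CommHom u₄ u₆] [CommHom u₅ u₆]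

/-- The isomorphism `((1 (2 3)) 4) (5 6) → (1 2) ((3 (4 5)) 6)`, computed in two ways. -/
theorem QuasiBialgebra.coherence_zigzag :
    ⦅u₃, u₄, u₅⦆ * ⦅u₃ ⋄ u₄, u₅, u₆⦆⁻¹ * ⦅u₁ ⋄ u₂, u₃ ⋄ u₄, u₅ ⋄ u₆⦆ * ⦅u₁ ⋄ u₂, u₃, u₄⦆
        * ⦅u₁, u₂, u₃⦆⁻¹
      = ⦅u₃, u₄ ⋄ u₅, u₆⦆⁻¹ * ⦅u₁ ⋄ u₂, u₃, (u₄ ⋄ u₅) ⋄ u₆⦆ * ⦅u₁, u₂, u₃⦆⁻¹ * ⦅u₄, u₅, u₆⦆⁻¹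
        * ⦅u₁ ⋄ u₂ ⋄ u₃, u₄, u₅ ⋄ u₆⦆ := by
  -- Two pentagons, two naturality squares, and the fact that associators on disjoint legs commute.
  -- After the last two cells to be exchanged are swapped, each remaining identity is solved for one
  -- cell, and the product cancels.
  have p1 := Q.assoc_pentagon (u₁ ⋄ u₂) u₃ u₄ (u₅ ⋄ u₆)
  have p2 := Q.assoc_pentagon u₃ u₄ u₅ u₆
  have n1 := (Q.assoc_intw u₁ u₂ u₃).cell Q.Φ (cell_intw_right Q.Φ u₁ u₂ u₃ u₄)
    (cell_intw_right Q.Φ u₁ u₂ u₃ (u₅ ⋄ u₆))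
  have n2 := Intw.cell Q.Φ (cell_intw_left Q.Φ u₄ u₅ u₆ (u₁ ⋄ u₂))
    (cell_intw_left Q.Φ u₄ u₅ u₆ u₃) (Q.assoc_intw u₄ u₅ u₆)
  have n3 : ⦅u₁, u₂, u₃⦆⁻¹ * ⦅u₄, u₅, u₆⦆⁻¹ = ⦅u₄, u₅, u₆⦆⁻¹ * ⦅u₁, u₂, u₃⦆⁻¹ := by
    rw [← mul_inv_rev, ← mul_inv_rev]
    exact congrArg _ (Intw.cell Q.Φ (cell_intw_left Q.Φ u₄ u₅ u₆ u₁)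
      (cell_intw_left Q.Φ u₄ u₅ u₆ u₂) (cell_intw_left Q.Φ u₄ u₅ u₆ u₃))
  rw [mul_assoc _ ⦅u₁, u₂, u₃⦆⁻¹ ⦅u₄, u₅, u₆⦆⁻¹, n3,
    eq_inv_mul_iff_mul_eq.mpr (eq_mul_inv_iff_mul_eq.mpr p1), eq_inv_mul_iff_mul_eq.mpr n1,
    eq_mul_inv_iff_mul_eq.mpr n2.symm, eq_mul_inv_iff_mul_eq.mpr p2.symm]
  simp only [mul_assoc, mul_inv_rev, inv_inv, inv_mul_cancel_left, mul_inv_cancel_left,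
    mul_inv_cancel, inv_mul_cancel, mul_one]

variable {V : Type*} [AddCommGroup V] [Module k V] {G : C →ₗ[k] V}

variable {u₁ u₂ u₃ u₄ u₅ u₆} in
/-- A functional that contracts `2 3`, `1 4`, `4 5`, `3 6` reduces the double zigzag to two
single ones. -/
theorem QuasiBialgebra.double_zigzag
    (h₄₅ : LAbs G (u₄ ⋄ u₅) (Q.unit C)) (h₃₆ : LAbs G (u₃ ⋄ u₆) (Q.unit C))
    (h₂₃ : RAbs G (u₂ ⋄ u₃) (Q.unit C)) (h₁₄ : RAbs G (u₁ ⋄ u₄) (Q.unit C)) :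
    G (⦅u₃, u₄, u₅⦆ * ⦅u₃ ⋄ u₄, u₅, u₆⦆⁻¹ * ⦅u₁ ⋄ u₂, u₃ ⋄ u₄, u₅ ⋄ u₆⦆ * ⦅u₁ ⋄ u₂, u₃, u₄⦆
        * ⦅u₁, u₂, u₃⦆⁻¹ : Cˣ)
      = G (⦅u₂, u₃, u₆⦆ * ⦅u₁, u₄, u₅⦆ : Cˣ) := by
  have h₄₅' : LAbs G ((u₄ ⋄ u₅) ⋄ u₆) u₆ := by
    simpa only [Q.unit_tens] using h₄₅.ten_left Q.comul u₆
  have h₂₃' : RAbs G (u₁ ⋄ u₂ ⋄ u₃) u₁ := by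
    simpa only [Q.tens_unit] using h₂₃.ten_right Q.comul u₁
  have q1 : ⦅u₁ ⋄ u₂, u₃, u₆⦆ * ⦅u₁, u₂, u₃⦆⁻¹
      = ⦅u₁, u₂, u₃ ⋄ u₆⦆⁻¹ * (⦅u₂, u₃, u₆⦆ * ⦅u₁, u₂ ⋄ u₃, u₆⦆) := by
    rw [eq_inv_mul_iff_mul_eq, ← mul_assoc, mul_inv_eq_iff_eq_mul, Q.assoc_pentagon]
  have q2 : ⦅u₄, u₅, u₆⦆⁻¹ * ⦅u₁, u₄, u₅ ⋄ u₆⦆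
      = ⦅u₁, u₄ ⋄ u₅, u₆⦆ * ⦅u₁, u₄, u₅⦆ * ⦅u₁ ⋄ u₄, u₅, u₆⦆⁻¹ := by
    rw [eq_mul_inv_iff_mul_eq, mul_assoc, ← Q.assoc_pentagon, mul_assoc, inv_mul_cancel_left]
  have c45 : Intw (⦅u₂, u₃, u₆⦆ * ⦅u₁, u₂ ⋄ u₃, u₆⦆) (u₄ ⋄ u₅) (u₄ ⋄ u₅) := by
    have := CommHom.symm (u₄ ⋄ u₅) u₆
    exact Intw.mul (fun p => (CommHom.comm (v := u₄ ⋄ u₅) (u := lift2 u₂ (lift2 u₃ u₆)) _ p).eq)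
      (fun p => (CommHom.comm (v := u₄ ⋄ u₅) (u := lift2 u₁ (lift2 (u₂ ⋄ u₃) u₆)) _ p).eq)
  have c23 : Intw ⦅u₁, u₄, u₅⦆ (u₂ ⋄ u₃) (u₂ ⋄ u₃) := by
    have := CommHom.symm (u₂ ⋄ u₃) u₄
    have := CommHom.symm (u₂ ⋄ u₃) u₅
    exact cell_intw_right Q.Φ u₁ u₄ u₅ (u₂ ⋄ u₃)
  -- The other side of `coherence_zigzag` exposes `4 5` on the left and `2 3` on the right.
  -- Absorbing them removes the first cell and shortens the second and the last to the cells to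
  -- which `q1` and `q2` apply. The outer cells so produced contain `3 6` and `1 4` next to an end
  -- slot and become `1` as well.
  rw [Q.coherence_zigzag]
  simp only [Units.val_mul, mul_assoc]
  rw [h₄₅.cell_inv_mid, Q.assoc_unit_mid, inv_one, Units.val_one, one_mul, h₄₅'.cell_last]
  simp only [← mul_assoc]
  rw [h₂₃'.cell_first]
  simp only [← Units.val_mul]
  rw [q1, mul_assoc _ ⦅u₄, u₅, u₆⦆⁻¹, q2]
  simp only [Units.val_mul, mul_assoc]
  rw [h₃₆.cell_inv_last, Q.assoc_unit_last, inv_one, Units.val_one, one_mul]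
  simp only [← mul_assoc]
  rw [h₁₄.cell_inv_first, Q.assoc_unit_first, inv_one, Units.val_one, mul_one]
  -- What remains to be removed are the interior cells `⦅u₁, u₄ ⋄ u₅, u₆⦆` and `⦅u₁, u₂ ⋄ u₃, u₆⦆`.
  -- The factors to the left of the first commute with `4 5`, those to the right of the second
  -- commute with `2 3`, so absorption reaches through them.
  have s1 := (h₄₅.mul_left c45 fun p => by
    exact (CommHom.comm (v := Q.unit C) (u := AlgHom.id k C) _ p).eq).cell_mid (Φ := Q.Φ)
      (u := u₁) (w := u₆) ⦅u₁, u₄, u₅⦆.val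
  have s2 := (h₂₃.mul_right c23 fun p => by
    exact (CommHom.comm (v := Q.unit C) (u := AlgHom.id k C) _ p).eq).cell_mid (Φ := Q.Φ)
      (u := u₁) (w := u₆) ⦅u₂, u₃, u₆⦆.val
  rw [Q.assoc_unit_mid] at s1 s2
  simp only [LinearMap.comp_apply, LinearMap.mulLeft_apply, LinearMap.mulRight_apply,
    Units.val_mul, Units.val_one, one_mul, mul_one, ← mul_assoc] at s1 s2
  rw [s1, s2]

variable {u₁ u₂ u₃ u₄ u₅ u₆} in
/-- The inverse isomorphism, under a functional that contracts `2 3`, `1 4`, `4 5`, `3 6`. -/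
theorem QuasiBialgebra.double_zigzag_inv
    (h₄₅ : RAbs G (u₄ ⋄ u₅) (Q.unit C)) (h₃₆ : RAbs G (u₃ ⋄ u₆) (Q.unit C))
    (h₂₃ : LAbs G (u₂ ⋄ u₃) (Q.unit C)) (h₁₄ : LAbs G (u₁ ⋄ u₄) (Q.unit C)) :
    G (⦅u₃, u₄, u₅⦆ * ⦅u₃ ⋄ u₄, u₅, u₆⦆⁻¹ * ⦅u₁ ⋄ u₂, u₃ ⋄ u₄, u₅ ⋄ u₆⦆ * ⦅u₁ ⋄ u₂, u₃, u₄⦆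
        * ⦅u₁, u₂, u₃⦆⁻¹ : Cˣ)⁻¹.val
      = G (⦅u₁, u₄, u₅⦆⁻¹ * ⦅u₂, u₃, u₆⦆⁻¹ : Cˣ) := by
  have h₄₅' : RAbs G ((u₄ ⋄ u₅) ⋄ u₆) u₆ := by
    simpa only [Q.unit_tens] using h₄₅.ten_left Q.comul u₆
  have h₂₃' : LAbs G (u₁ ⋄ u₂ ⋄ u₃) u₁ := by
    simpa only [Q.tens_unit] using h₂₃.ten_right Q.comul u₁
  have q1 : ⦅u₁, u₂, u₃⦆ * ⦅u₁ ⋄ u₂, u₃, u₆⦆⁻¹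
      = ⦅u₁, u₂ ⋄ u₃, u₆⦆⁻¹ * ⦅u₂, u₃, u₆⦆⁻¹ * ⦅u₁, u₂, u₃ ⋄ u₆⦆ := by
    rw [mul_inv_eq_iff_eq_mul, mul_assoc, ← Q.assoc_pentagon, mul_assoc, mul_assoc,
      inv_mul_cancel_left, inv_mul_cancel_left]
  have q2 : ⦅u₁, u₄, u₅ ⋄ u₆⦆⁻¹ * ⦅u₄, u₅, u₆⦆
      = ⦅u₁ ⋄ u₄, u₅, u₆⦆ * (⦅u₁, u₄, u₅⦆⁻¹ * ⦅u₁, u₄ ⋄ u₅, u₆⦆⁻¹) := by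
    rw [inv_mul_eq_iff_eq_mul, ← mul_assoc, ← Q.assoc_pentagon, mul_assoc, mul_assoc,
      mul_inv_cancel_left, mul_inv_cancel, mul_one]
  have c45 : Intw (⦅u₁, u₂ ⋄ u₃, u₆⦆⁻¹ * ⦅u₂, u₃, u₆⦆⁻¹) (u₄ ⋄ u₅) (u₄ ⋄ u₅) := by
    have := CommHom.symm (u₄ ⋄ u₅) u₆
    exact (cell_intw_right Q.Φ u₁ (u₂ ⋄ u₃) u₆ (u₄ ⋄ u₅)).inv.mul
      (cell_intw_right Q.Φ u₂ u₃ u₆ (u₄ ⋄ u₅)).inv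
  have c23 : Intw ⦅u₁, u₄, u₅⦆⁻¹ (u₂ ⋄ u₃) (u₂ ⋄ u₃) := by
    have := CommHom.symm (u₂ ⋄ u₃) u₄
    have := CommHom.symm (u₂ ⋄ u₃) u₅
    exact (cell_intw_right Q.Φ u₁ u₄ u₅ (u₂ ⋄ u₃)).inv
  -- The argument of `double_zigzag` with left and right interchanged: inversion reverses the
  -- product, so `2 3` and `1 4` are now absorbed on the left, `4 5` and `3 6` on the right.
  rw [Q.coherence_zigzag]
  simp only [Units.val_mul, mul_assoc, mul_inv_rev, inv_inv]
  rw [h₂₃'.cell_inv_first]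
  simp only [← mul_assoc]
  rw [h₄₅.cell_mid, Q.assoc_unit_mid, Units.val_one, mul_one, h₄₅'.cell_inv_last]
  simp only [← Units.val_mul]
  rw [mul_assoc _ ⦅u₁, u₂, u₃⦆, q1, q2]
  simp only [Units.val_mul, mul_assoc]
  rw [h₁₄.cell_first, Q.assoc_unit_first, Units.val_one, one_mul]
  simp only [← mul_assoc]
  rw [h₃₆.cell_last, Q.assoc_unit_last, Units.val_one, mul_one]
  have s1 := (h₄₅.mul_right c45 fun p => by
    exact (CommHom.comm (v := Q.unit C) (u := AlgHom.id k C) _ p).eq).cell_inv_mid (Φ := Q.Φ)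
      (u := u₁) (w := u₆) ⦅u₁, u₄, u₅⦆⁻¹.val
  have s2 := (h₂₃.mul_left c23 fun p => by
    exact (CommHom.comm (v := Q.unit C) (u := AlgHom.id k C) _ p).eq).cell_inv_mid (Φ := Q.Φ)
      (u := u₁) (w := u₆) ⦅u₂, u₃, u₆⦆⁻¹.val
  rw [Q.assoc_unit_mid] at s1 s2
  simp only [LinearMap.comp_apply, LinearMap.mulLeft_apply, LinearMap.mulRight_apply,
    Units.val_mul, Units.val_one, inv_one, one_mul, mul_one, ← mul_assoc] at s1 s2
  rw [s1, s2]

/-- The isomorphism `((1 2) 3) ((4 5) 6) → (1 ((2 (3 4)) 5)) 6`, computed in two ways. -/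
theorem QuasiBialgebra.coherence_nested :
    ⦅u₁, u₂ ⋄ u₃ ⋄ u₄, u₅⦆ * ⦅u₁, u₂, u₃ ⋄ u₄⦆ * ⦅(u₁ ⋄ u₂) ⋄ u₃ ⋄ u₄, u₅, u₆⦆⁻¹
        * ⦅u₁ ⋄ u₂, u₃, u₄⦆ * ⦅(u₁ ⋄ u₂) ⋄ u₃, u₄, u₅ ⋄ u₆⦆⁻¹ * ⦅u₄, u₅, u₆⦆
      = ⦅u₂, u₃, u₄⦆ * ⦅u₂ ⋄ u₃, u₄, u₅⦆⁻¹ * ⦅u₁, u₂ ⋄ u₃, u₄ ⋄ u₅⦆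
        * ⦅u₁ ⋄ u₂ ⋄ u₃, u₄ ⋄ u₅, u₆⦆⁻¹ * ⦅u₁, u₂, u₃⦆ := by
  -- Three naturality squares and five pentagons fill the diagram between the two composites. Each
  -- is solved for one cell.
  have n1 := (Q.assoc_intw u₁ u₂ u₃).cell Q.Φ (cell_intw_right Q.Φ u₁ u₂ u₃ (u₄ ⋄ u₅))
    (cell_intw_right Q.Φ u₁ u₂ u₃ u₆)
  have n2 := Intw.cell Q.Φ (cell_intw_left Q.Φ u₃ u₄ u₅ u₁)
    (cell_intw_left Q.Φ u₃ u₄ u₅ u₂) (Q.assoc_intw u₃ u₄ u₅)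
  have n3 := (Q.assoc_intw (u₁ ⋄ u₂) u₃ u₄).cell Q.Φ
    (cell_intw_right Q.Φ (u₁ ⋄ u₂) u₃ u₄ u₅) (cell_intw_right Q.Φ (u₁ ⋄ u₂) u₃ u₄ u₆)
  have p1 := Q.assoc_pentagon u₁ u₂ u₃ (u₄ ⋄ u₅)
  have p2 := Q.assoc_pentagon u₂ u₃ u₄ u₅
  have p3 := Q.assoc_pentagon u₁ u₂ (u₃ ⋄ u₄) u₅
  have p4 := Q.assoc_pentagon ((u₁ ⋄ u₂) ⋄ u₃) u₄ u₅ u₆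
  have p5 := Q.assoc_pentagon (u₁ ⋄ u₂) u₃ u₄ u₅
  rw [eq_mul_inv_iff_mul_eq.mpr n1.symm, eq_inv_mul_iff_mul_eq.mpr (eq_mul_inv_iff_mul_eq.mpr p1),
    eq_inv_mul_iff_mul_eq.mpr p2, eq_mul_inv_iff_mul_eq.mpr n2.symm,
    eq_inv_mul_iff_mul_eq.mpr (eq_mul_inv_iff_mul_eq.mpr p3), eq_mul_inv_iff_mul_eq.mpr n3.symm,
    eq_inv_mul_iff_mul_eq.mpr p4.symm, eq_inv_mul_iff_mul_eq.mpr (eq_mul_inv_iff_mul_eq.mpr p5)]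
  simp only [mul_assoc, mul_inv_rev, inv_inv, inv_mul_cancel_left, mul_inv_cancel_left,
    mul_inv_cancel, inv_mul_cancel, mul_one]

variable {u₁ u₂ u₃ u₄ u₅ u₆} in
/-- The two ways to contract `3 4`, then `2 5`, then `1 6`. -/
theorem QuasiBialgebra.nested_contraction {V : Type*} [AddCommGroup V] [Module k V]
    {G : C →ₗ[k] V} (h₃₄ : LAbs G (u₃ ⋄ u₄) (Q.unit C)) :
    G (⦅u₁, u₂, u₅⦆ * ⦅u₁ ⋄ u₂, u₅, u₆⦆⁻¹ * (⦅u₁ ⋄ u₂, u₃, u₄⦆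
        * ⦅(u₁ ⋄ u₂) ⋄ u₃, u₄, u₅ ⋄ u₆⦆⁻¹) * ⦅u₄, u₅, u₆⦆ : Cˣ)
      = G (⦅u₂, u₃, u₄⦆ * ⦅u₂ ⋄ u₃, u₄, u₅⦆⁻¹ * (⦅u₁, u₂ ⋄ u₃, u₄ ⋄ u₅⦆
        * ⦅u₁ ⋄ u₂ ⋄ u₃, u₄ ⋄ u₅, u₆⦆⁻¹) * ⦅u₁, u₂, u₃⦆ : Cˣ) := by
  have a1 : LAbs G (u₂ ⋄ u₃ ⋄ u₄) u₂ := by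
    simpa only [Q.tens_unit] using h₃₄.ten_right Q.comul u₂
  have c : Intw ⦅u₁, u₂, u₅⦆ (u₃ ⋄ u₄) (u₃ ⋄ u₄) := by
    have := CommHom.symm (u₃ ⋄ u₄) u₅
    exact cell_intw_right Q.Φ u₁ u₂ u₅ (u₃ ⋄ u₄)
  have h₃₄' := h₃₄.mul_left c fun p =>
    (CommHom.comm (v := Q.unit C) (u := AlgHom.id k C) ⦅u₁, u₂, u₅⦆.val p).eq
  have a2 : LAbs (G.comp (LinearMap.mulLeft k ⦅u₁, u₂, u₅⦆.val)) ((u₁ ⋄ u₂) ⋄ u₃ ⋄ u₄)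
      (u₁ ⋄ u₂) := by
    simpa only [Q.tens_unit] using h₃₄'.ten_right Q.comul (u₁ ⋄ u₂)
  have s1 := h₃₄'.cell_last (Φ := Q.Φ) (u := u₁) (v := u₂)
    (⦅(u₁ ⋄ u₂) ⋄ u₃ ⋄ u₄, u₅, u₆⦆⁻¹ * (⦅u₁ ⋄ u₂, u₃, u₄⦆
        * (⦅(u₁ ⋄ u₂) ⋄ u₃, u₄, u₅ ⋄ u₆⦆⁻¹ * ⦅u₄, u₅, u₆⦆)) : Cˣ).val
  have s2 := a2.cell_inv_first (Φ := Q.Φ) (v := u₅) (w := u₆) (⦅u₁ ⋄ u₂, u₃, u₄⦆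
        * (⦅(u₁ ⋄ u₂) ⋄ u₃, u₄, u₅ ⋄ u₆⦆⁻¹ * ⦅u₄, u₅, u₆⦆) : Cˣ).val
  rw [Q.assoc_unit_last] at s1
  simp only [LinearMap.comp_apply, LinearMap.mulLeft_apply, Units.val_mul, Units.val_one,
    one_mul] at s1 s2
  have co := congrArg Units.val (Q.coherence_nested u₁ u₂ u₃ u₄ u₅ u₆)
  simp only [Units.val_mul, mul_assoc] at co ⊢
  -- The longer side of `coherence_nested` begins with three cells containing `3 4`. Contracting
  -- that pair turns the first into `⦅u₁, u₂, u₅⦆`; behind it the second becomes `1` and the third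
  -- becomes `⦅u₁ ⋄ u₂, u₅, u₆⦆⁻¹`.
  rw [← co, a1.cell_mid, s1, s2]

end SixLegs

end Coherence

end

end QuasiHopfTheory

namespace QuasiHopfTheory

noncomputable section

/-! ### Antipodes relative to an algebra map -/

section RelativeAntipode

variable {k : Type*} [Field k] {H B M N E : Type*} [Ring H] [Algebra k H] [Ring B] [Algebra k B]
  [Ring M] [Algebra k M] [Ring N] [Algebra k N] [Ring E] [Algebra k E]

/-- `x ⊗ y ↦ p(x) q(y)`. -/
def mulMap (p : M →ₗ[k] B) (q : N →ₗ[k] B) : M ⊗[k] N →ₗ[k] B :=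
  (LinearMap.mul' k B).comp (TensorProduct.map p q)

@[simp] theorem mulMap_tmul (p : M →ₗ[k] B) (q : N →ₗ[k] B) (x : M) (y : N) :
    mulMap p q (x ⊗ₜ y) = p x * q y := rfl

/-- `x ⊗ y ↦ T(x) α φ(y)`. -/
def relLeft (φ : H →ₐ[k] B) (T : H →ₗ[k] B) (α : B) : H ⊗[k] H →ₗ[k] B :=
  mulMap ((LinearMap.mulRight k α).comp T) φ.toLinearMap

/-- `x ⊗ y ↦ φ(x) β T(y)`. -/
def relRight (φ : H →ₐ[k] B) (T : H →ₗ[k] B) (β : B) : H ⊗[k] H →ₗ[k] B :=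
  mulMap ((LinearMap.mulRight k β).comp φ.toLinearMap) T

@[simp] theorem relLeft_tmul (φ : H →ₐ[k] B) (T : H →ₗ[k] B) (α : B) (x y : H) :
    relLeft φ T α (x ⊗ₜ y) = T x * α * φ y := rfl

@[simp] theorem relRight_tmul (φ : H →ₐ[k] B) (T : H →ₗ[k] B) (β : B) (x y : H) :
    relRight φ T β (x ⊗ₜ y) = φ x * β * T y := rfl

/-- The data `(T, α, β)` of an antipode of `H` with values in `B`, relative to `φ : H → B`. -/
structure RelAntipode (Q : QuasiBialgebra k H) (φ : H →ₐ[k] B) where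
  T : H →ₗ[k] B
  α : B
  β : B
  T_one : T 1 = 1
  T_mul : ∀ x y, T (x * y) = T y * T x
  left : ∀ h, relLeft φ T α (Q.comul h) = Q.counit h • α
  right : ∀ h, relRight φ T β (Q.comul h) = Q.counit h • β
  zigzag_left : mulMap ((LinearMap.mulRight k β).comp φ.toLinearMap) (relLeft φ T α) Q.Φ.val = 1
  zigzag_right : mulMap ((LinearMap.mulRight k α).comp T) (relRight φ T β) Q.Φ⁻¹.val = 1

section Absorption

open Algebra.TensorProduct

instance CommHom.includeRight_includeLeft :
    CommHom (includeRight : N →ₐ[k] M ⊗[k] N) (includeLeft : M →ₐ[k] M ⊗[k] N) :=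
  CommHom.symm _ _

theorem comp_unitHom (f : M →ₐ[k] N) (ε : H →ₐ[k] k) : f.comp (unitHom M ε) = unitHom N ε := by
  ext x
  simp [unitHom_apply]

theorem LAbs.mulMap_right {q : N →ₗ[k] B} {u u' : H →ₐ[k] N} (h : LAbs q u u') (p : M →ₗ[k] B) :
    LAbs (mulMap p q) (includeRight.comp u) (includeRight.comp u') := fun x t => by
  induction t with
  | zero => simp
  | add a b ha hb => rw [mul_add, mul_add, map_add, map_add, ha, hb]
  | tmul a b => simp [h x b]

theorem RAbs.mulMap_right {q : N →ₗ[k] B} {u u' : H →ₐ[k] N} (h : RAbs q u u') (p : M →ₗ[k] B) :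
    RAbs (mulMap p q) (includeRight.comp u) (includeRight.comp u') := fun x t => by
  induction t with
  | zero => simp
  | add a b ha hb => rw [add_mul, add_mul, map_add, map_add, ha, hb]
  | tmul a b => simp [h x b]

variable {M' N' : Type*} [AddCommGroup M'] [Module k M'] [AddCommGroup N'] [Module k N']

theorem LAbs.map_left {p : M →ₗ[k] M'} {u u' : H →ₐ[k] M} (h : LAbs p u u') (q : N →ₗ[k] N') :
    LAbs (TensorProduct.map p q) ((includeLeft : M →ₐ[k] M ⊗[k] N).comp u)
      (includeLeft.comp u') := fun x t => by
  induction t with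
  | zero => simp
  | add a b ha hb => rw [mul_add, mul_add, map_add, map_add, ha, hb]
  | tmul a b => simp [h x a]

theorem LAbs.map_right {q : N →ₗ[k] N'} {u u' : H →ₐ[k] N} (h : LAbs q u u') (p : M →ₗ[k] M') :
    LAbs (TensorProduct.map p q) ((includeRight : N →ₐ[k] M ⊗[k] N).comp u)
      (includeRight.comp u') := fun x t => by
  induction t with
  | zero => simp
  | add a b ha hb => rw [mul_add, mul_add, map_add, map_add, ha, hb]
  | tmul a b => simp [h x b]

theorem RAbs.map_left {p : M →ₗ[k] M'} {u u' : H →ₐ[k] M} (h : RAbs p u u') (q : N →ₗ[k] N') :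
    RAbs (TensorProduct.map p q) ((includeLeft : M →ₐ[k] M ⊗[k] N).comp u)
      (includeLeft.comp u') := fun x t => by
  induction t with
  | zero => simp
  | add a b ha hb => rw [add_mul, add_mul, map_add, map_add, ha, hb]
  | tmul a b => simp [h x a]

theorem RAbs.map_right {q : N →ₗ[k] N'} {u u' : H →ₐ[k] N} (h : RAbs q u u') (p : M →ₗ[k] M') :
    RAbs (TensorProduct.map p q) ((includeRight : N →ₐ[k] M ⊗[k] N).comp u)
      (includeRight.comp u') := fun x t => by
  induction t with
  | zero => simp
  | add a b ha hb => rw [add_mul, add_mul, map_add, map_add, ha, hb]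
  | tmul a b => simp [h x b]

variable {Q : QuasiBialgebra k H} {φ : H →ₐ[k] B} {T : H →ₗ[k] B} {α β : B}

/-- Identities between cells thus return to identities between the original elements. -/
theorem cell_includes {X Y Z : Type*} [Ring X] [Algebra k X] [Ring Y] [Algebra k Y] [Ring Z]
    [Algebra k Z] (Φ : (X ⊗[k] (Y ⊗[k] Z))ˣ) :
    cell Φ includeLeft (includeRight.comp includeLeft) (includeRight.comp includeRight) = Φ := by
  have h : ∀ t : X ⊗[k] (Y ⊗[k] Z), lift2 includeLeft (lift2 (includeRight.comp includeLeft)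
      (includeRight.comp includeRight)) t = t := fun t => by
    induction t with
    | zero => simp
    | add a b ha hb => rw [map_add, ha, hb]
    | tmul a s =>
      induction s with
      | zero => simp
      | add a b ha hb => rw [TensorProduct.tmul_add, map_add, ha, hb]
      | tmul b c => simp
  exact Units.ext (h Φ.val)

theorem ten_includeLeft_includeRight (d : E →ₐ[k] M ⊗[k] N) :
    ten d includeLeft includeRight = d := by
  rw [ten, lift2_includeLeft_includeRight]; rfl

/-- Since `T` reverses products, `T(h₁a) α φ(h₂b) = T(a) · T(h₁) α φ(h₂) · φ(b)`. The axiom thus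
applies in front of an arbitrary element, which makes it an absorption property. -/
theorem labs_relLeft (hT : ∀ x y, T (x * y) = T y * T x)
    (h : ∀ h, relLeft φ T α (Q.comul h) = Q.counit h • α) :
    LAbs (relLeft φ T α) (ten Q.comul includeLeft includeRight) (Q.unit _) := fun x t => by
  rw [ten_includeLeft_includeRight, unitHom_apply, smul_mul_assoc, one_mul, map_smul]
  induction t with
  | zero => simp
  | add a b ha hb => rw [mul_add, map_add, map_add, ha, hb, smul_add]
  | tmul a b =>
    have key : ∀ z, relLeft φ T α (z * (a ⊗ₜ b)) = T a * relLeft φ T α z * φ b := fun z => by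
      induction z with
      | zero => simp
      | add p q hp hq => rw [add_mul, map_add, map_add, hp, hq, mul_add, add_mul]
      | tmul p q => simp [hT, mul_assoc]
    rw [key, h, mul_smul_comm, smul_mul_assoc, relLeft_tmul]

theorem rabs_relRight (hT : ∀ x y, T (x * y) = T y * T x)
    (h : ∀ h, relRight φ T β (Q.comul h) = Q.counit h • β) :
    RAbs (relRight φ T β) (ten Q.comul includeLeft includeRight) (Q.unit _) := fun x t => by
  rw [ten_includeLeft_includeRight, unitHom_apply, mul_smul_comm, mul_one, map_smul]
  induction t with
  | zero => simp
  | add a b ha hb => rw [add_mul, map_add, map_add, ha, hb, smul_add]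
  | tmul a b =>
    have key : ∀ z, relRight φ T β ((a ⊗ₜ b) * z) = φ a * relRight φ T β z * T b := fun z => by
      induction z with
      | zero => simp
      | add p q hp hq => rw [mul_add, map_add, map_add, hp, hq, mul_add, add_mul]
      | tmul p q => simp [hT, mul_assoc]
    rw [key, h, mul_smul_comm, smul_mul_assoc, relRight_tmul]

/-- The same absorption when `φ` is only the first part of a longer functional. The hypothesis on
`p` says that `φ(h₂)` still emerges directly after `α`. -/
theorem labs_mulMap_mulMap (hT : ∀ x y, T (x * y) = T y * T x)
    (h : ∀ h, relLeft φ T α (Q.comul h) = Q.counit h • α) {p : H →ₗ[k] B}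
    (hp : ∀ x y, p (x * y) = φ x * p y) (q : M →ₗ[k] B) :
    LAbs (mulMap ((LinearMap.mulRight k α).comp T) (mulMap p q))
      (ten Q.comul includeLeft (includeRight.comp includeLeft)) (Q.unit _) := fun x t => by
  rw [unitHom_apply, smul_mul_assoc, one_mul, map_smul]
  induction t with
  | zero => simp
  | add a b ha hb => rw [mul_add, map_add, map_add, ha, hb, smul_add]
  | tmul a s =>
    induction s with
    | zero => simp
    | add a b ha hb => rw [TensorProduct.tmul_add, mul_add, map_add, map_add, ha, hb, smul_add]
    | tmul b m =>
      have key : ∀ z, mulMap ((LinearMap.mulRight k α).comp T) (mulMap p q)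
          (lift2 includeLeft (includeRight.comp includeLeft) z * (a ⊗ₜ (b ⊗ₜ m)))
          = T a * relLeft φ T α z * (p b * q m) := fun z => by
        induction z with
        | zero => simp
        | add p q hp hq => rw [map_add, add_mul, map_add, map_add, hp, hq, mul_add, add_mul]
        | tmul p q => simp [hT, hp, mul_assoc]
      rw [ten_apply, key, h, mul_smul_comm, smul_mul_assoc]; rfl

theorem rabs_mulMap_mulMap (h : ∀ h, relRight φ T β (Q.comul h) = Q.counit h • β) {p : H →ₗ[k] B}
    (hp : ∀ x y, p (x * y) = T y * p x) (q : M →ₗ[k] B) :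
    RAbs (mulMap ((LinearMap.mulRight k β).comp φ.toLinearMap) (mulMap p q))
      (ten Q.comul includeLeft (includeRight.comp includeLeft)) (Q.unit _) := fun x t => by
  rw [unitHom_apply, mul_smul_comm, mul_one, map_smul]
  induction t with
  | zero => simp
  | add a b ha hb => rw [add_mul, map_add, map_add, ha, hb, smul_add]
  | tmul a s =>
    induction s with
    | zero => simp
    | add a b ha hb => rw [TensorProduct.tmul_add, add_mul, map_add, map_add, ha, hb, smul_add]
    | tmul b m =>
      have key : ∀ z, mulMap ((LinearMap.mulRight k β).comp φ.toLinearMap) (mulMap p q)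
          ((a ⊗ₜ (b ⊗ₜ m)) * lift2 includeLeft (includeRight.comp includeLeft) z)
          = φ a * relRight φ T β z * (p b * q m) := fun z => by
        induction z with
        | zero => simp
        | add p q hp hq => rw [map_add, mul_add, map_add, map_add, hp, hq, mul_add, add_mul]
        | tmul p q => simp [hp, mul_assoc]
      rw [ten_apply, key, h, mul_smul_comm, smul_mul_assoc]; rfl

end Absorption

namespace RelAntipode

open Algebra.TensorProduct

variable {Q : QuasiBialgebra k H} {φ : H →ₐ[k] B} (D D' : RelAntipode Q φ)

/-- The functional `x ⊗ y ⊗ z ↦ T(x) α φ(y) β' T'(z)`. -/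
def compareMap : H ⊗[k] (H ⊗[k] H) →ₗ[k] B :=
  mulMap ((LinearMap.mulRight k D.α).comp D.T) (relRight φ D'.T D'.β)

/-- The element `T(x¹) α φ(x²) β' T'(x³)`, which compares two relative antipodes. -/
def compare : B := compareMap D D' Q.Φ⁻¹.val

/-- Apply `compareMap` to `Φ⁻¹ (id ⊗ Δ)Δ(h) = (Δ ⊗ id)Δ(h) Φ⁻¹`. On the first side `φ(h₂) β' T'(h₃)`
contracts and leaves `T(h)` in front; on the second `T(h₁) α φ(h₂)` contracts and leaves `T'(h)`
behind. -/
theorem compare_intw (h : H) : D.T h * compare D D' = compare D D' * D'.T h := by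
  have hL := labs_mulMap_mulMap D.T_mul D.left (p := (LinearMap.mulRight k D'.β).comp φ.toLinearMap)
    (fun x y => by simp [mul_assoc]) D'.T
  have hR := (rabs_relRight D'.T_mul D'.right).mulMap_right
    ((LinearMap.mulRight k D.α).comp D.T)
  rw [comp_ten, comp_unitHom] at hR
  have hΦ := (Q.assoc_intw (C := H ⊗[k] (H ⊗[k] H)) includeLeft (includeRight.comp includeLeft)
    (includeRight.comp includeRight)).inv h
  have e : (cell Q.Φ (C := H ⊗[k] (H ⊗[k] H)) includeLeft (includeRight.comp includeLeft)
      (includeRight.comp includeRight))⁻¹.val = Q.Φ⁻¹.val := by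
    rw [cell_includes]
  rw [e] at hΦ
  have hΦ' := congrArg (compareMap D D') hΦ
  have l := hL.ten_left Q.comul (includeRight.comp includeRight) h Q.Φ⁻¹.val
  have r := hR.ten_right Q.comul includeLeft h Q.Φ⁻¹.val
  rw [Q.unit_tens] at l
  rw [Q.tens_unit] at r
  have hl : ∀ t, compareMap D D'
      ((includeRight.comp includeRight : H →ₐ[k] H ⊗[k] (H ⊗[k] H)) h * t)
        = compareMap D D' t * D'.T h := fun t => by
    induction t with
    | zero => simp
    | add a b ha hb => rw [mul_add, map_add, map_add, ha, hb, add_mul]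
    | tmul a s =>
      induction s with
      | zero => simp
      | add a b ha hb => rw [TensorProduct.tmul_add, mul_add, map_add, map_add, ha, hb, add_mul]
      | tmul b c => simp [compareMap, D'.T_mul, mul_assoc]
  have hr : ∀ t, compareMap D D' (t * (includeLeft : H →ₐ[k] H ⊗[k] (H ⊗[k] H)) h)
        = D.T h * compareMap D D' t := fun t => by
    induction t with
    | zero => simp
    | add a b ha hb => rw [add_mul, map_add, map_add, ha, hb, mul_add]
    | tmul a s => simp [compareMap, D.T_mul, mul_assoc]
  exact (hr _).symm.trans (r.symm.trans (hΦ'.trans (l.trans (hl _))))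

/-- Evaluate the pentagon under `T(·) α φ(·) β' T'(·) α' φ(·)`. The pairs `1 2` and `3 4` contract
from the left and `2 3` from the right, so only the cells on legs `1 2 3` and `2 3 4` survive. The
former gives the left side; the latter gives `α` times the zigzag of `D'`, which is `1`. -/
theorem compare_mul_α : compare D D' * D'.α = D.α := by
  let u₁ : H →ₐ[k] H ⊗[k] (H ⊗[k] (H ⊗[k] H)) := includeLeft
  let u₂ : H →ₐ[k] H ⊗[k] (H ⊗[k] (H ⊗[k] H)) := includeRight.comp includeLeft
  let u₃ : H →ₐ[k] H ⊗[k] (H ⊗[k] (H ⊗[k] H)) := includeRight.comp (includeRight.comp includeLeft)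
  let u₄ : H →ₐ[k] H ⊗[k] (H ⊗[k] (H ⊗[k] H)) := includeRight.comp (includeRight.comp includeRight)
  let G : H ⊗[k] (H ⊗[k] (H ⊗[k] H)) →ₗ[k] B := mulMap ((LinearMap.mulRight k D.α).comp D.T)
    (mulMap ((LinearMap.mulRight k D'.β).comp φ.toLinearMap) (relLeft φ D'.T D'.α))
  have h12 : LAbs G (ten Q.comul u₁ u₂) (Q.unit _) :=
    labs_mulMap_mulMap D.T_mul D.left (p := (LinearMap.mulRight k D'.β).comp φ.toLinearMap)
      (fun x y => by simp [mul_assoc]) _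
  have h34 : LAbs G (ten Q.comul u₃ u₄) (Q.unit _) := by
    have := ((labs_relLeft D'.T_mul D'.left).mulMap_right
      ((LinearMap.mulRight k D'.β).comp φ.toLinearMap)).mulMap_right
      ((LinearMap.mulRight k D.α).comp D.T)
    rwa [comp_ten, comp_ten, comp_unitHom, comp_unitHom] at this
  have h23 : RAbs G (ten Q.comul u₂ u₃) (Q.unit _) := by
    have := (rabs_mulMap_mulMap D'.right (p := (LinearMap.mulRight k D'.α).comp D'.T)
      (fun x y => by simp [D'.T_mul, mul_assoc]) φ.toLinearMap).mulMap_right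
      ((LinearMap.mulRight k D.α).comp D.T)
    rwa [comp_ten, comp_unitHom] at this
  have p : (cell Q.Φ u₁ u₂ u₃)⁻¹ = (cell Q.Φ (ten Q.comul u₁ u₂) u₃ u₄)⁻¹
      * ((cell Q.Φ u₁ u₂ (ten Q.comul u₃ u₄))⁻¹
      * (cell Q.Φ u₂ u₃ u₄ * cell Q.Φ u₁ (ten Q.comul u₂ u₃) u₄)) := by
    rw [eq_inv_mul_iff_mul_eq, eq_inv_mul_iff_mul_eq, ← mul_assoc, mul_inv_eq_iff_eq_mul,
      Q.assoc_pentagon]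
  have hp := congrArg (fun x : (H ⊗[k] (H ⊗[k] (H ⊗[k] H)))ˣ => G x.val) p
  simp only [Units.val_mul] at hp
  rw [h12.cell_inv_first, Q.assoc_unit_first, inv_one, Units.val_one, one_mul, h34.cell_inv_last,
    Q.assoc_unit_last, inv_one, Units.val_one, one_mul, h23.cell_mid, Q.assoc_unit_mid,
    Units.val_one, mul_one] at hp
  have hl : ∀ t, G (lift2 u₁ (lift2 u₂ u₃) t) = compareMap D D' t * D'.α := fun t => by
    induction t with
    | zero => simp
    | add a b ha hb => rw [map_add, map_add, map_add, ha, hb, add_mul]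
    | tmul a s =>
      induction s with
      | zero => simp
      | add a b ha hb =>
        rw [TensorProduct.tmul_add, map_add, map_add, map_add, ha, hb, add_mul]
      | tmul b c => simp [compareMap, u₁, u₂, u₃, G, mul_assoc]
  have hr : ∀ t, G (lift2 u₂ (lift2 u₃ u₄) t) = D.α *
      mulMap ((LinearMap.mulRight k D'.β).comp φ.toLinearMap) (relLeft φ D'.T D'.α) t := fun t => by
    induction t with
    | zero => simp
    | add a b ha hb => rw [map_add, map_add, map_add, ha, hb, mul_add]
    | tmul a s =>
      induction s with
      | zero => simp
      | add a b ha hb =>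
        rw [TensorProduct.tmul_add, map_add, map_add, map_add, ha, hb, mul_add]
      | tmul b c => simp [u₂, u₃, u₄, G, mul_assoc, D.T_one]
  rw [cell_inv_val, cell_val, hl, hr, D'.zigzag_left, mul_one] at hp
  exact hp

/-- Moving the first factor past `T'(x¹)` and into `α'` turns `T'(x¹) α'` into `T(x¹) α`. What is
left is the right zigzag of `D`. -/
theorem compare_mul_compare : compare D D' * compare D' D = 1 := by
  have key : ∀ t, compare D D' * compareMap D' D t = mulMap ((LinearMap.mulRight k D.α).comp D.T)
      (relRight φ D.T D.β) t := fun t => by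
    induction t with
    | zero => simp
    | add a b ha hb => rw [map_add, map_add, mul_add, ha, hb]
    | tmul a s =>
      simp only [compareMap, mulMap_tmul, LinearMap.comp_apply, LinearMap.mulRight_apply]
      rw [← mul_assoc, ← mul_assoc, ← compare_intw, mul_assoc (D.T a), compare_mul_α]
  exact (key _).trans D.zigzag_right

/-- The comparison element is invertible. -/
def compareUnit : Bˣ where
  val := compare D D'
  inv := compare D' D
  val_inv := compare_mul_compare D D'
  inv_val := compare_mul_compare D' D

end RelAntipode

end RelativeAntipode

end

end QuasiHopfTheory

namespace QuasiHopfTheory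

noncomputable section

/-! ### The Drinfeld twist -/

namespace QuasiHopf

open Algebra.TensorProduct

variable {k H C : Type*} [Field k] [Ring H] [Algebra k H] [Ring C] [Algebra k C]
  (Q : QuasiHopf k H)

theorem antiLin_mul (S : H ≃ₐ[k] Hᵐᵒᵖ) (x y : H) : antiLin S (x * y) = antiLin S y * antiLin S x := by
  simp

theorem antiLeft_eq : antiLeft Q.S Q.α = relLeft (AlgHom.id k H) (antiLin Q.S) Q.α := rfl

theorem antiRight_eq : antiRight Q.S Q.β = relRight (AlgHom.id k H) (antiLin Q.S) Q.β :=
  TensorProduct.ext' fun _ _ => by simp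

/-- `(x ⊗ y) ↦ S(y) ⊗ S(x)`. -/
def revS : H ⊗[k] H →ₗ[k] H ⊗[k] H :=
  (TensorProduct.map (antiLin Q.S) (antiLin Q.S)).comp (TensorProduct.comm k H H).toLinearMap

@[simp] theorem revS_tmul (x y : H) : Q.revS (x ⊗ₜ y) = (Q.S y).unop ⊗ₜ (Q.S x).unop := by
  simp [revS]

theorem antiComulCop_apply (h : H) : Q.antiComulCop h = Q.revS (Q.comul h) := rfl

theorem revS_mul (x y : H ⊗[k] H) : Q.revS (x * y) = Q.revS y * Q.revS x := by
  induction x with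
  | zero => simp
  | add a b ha hb => rw [add_mul, map_add, map_add, mul_add, ha, hb]
  | tmul a b =>
    induction y with
    | zero => simp
    | add p q hp hq => rw [mul_add, map_add, map_add, add_mul, hp, hq]
    | tmul c d => simp

theorem revS_one : Q.revS 1 = 1 := by simp [one_def]

/-- `(b ⊗ c) ⊗ (a ⊗ d) ↦ S(b) α c ⊗ S(a) α d`. -/
def evalMap : (H ⊗[k] H) ⊗[k] (H ⊗[k] H) →ₗ[k] H ⊗[k] H :=
  TensorProduct.map (antiLeft Q.S Q.α) (antiLeft Q.S Q.α)

/-- `(a ⊗ d) ⊗ (b ⊗ c) ↦ a β S(d) ⊗ b β S(c)`. -/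
def coevalMap : (H ⊗[k] H) ⊗[k] (H ⊗[k] H) →ₗ[k] H ⊗[k] H :=
  TensorProduct.map (antiRight Q.S Q.β) (antiRight Q.S Q.β)

/-- The four inclusions `H → (H ⊗ H) ⊗ (H ⊗ H)`. -/
abbrev incl₁ : H →ₐ[k] (H ⊗[k] H) ⊗[k] (H ⊗[k] H) := includeLeft.comp includeLeft
abbrev incl₂ : H →ₐ[k] (H ⊗[k] H) ⊗[k] (H ⊗[k] H) := includeLeft.comp includeRight
abbrev incl₃ : H →ₐ[k] (H ⊗[k] H) ⊗[k] (H ⊗[k] H) := includeRight.comp includeLeft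
abbrev incl₄ : H →ₐ[k] (H ⊗[k] H) ⊗[k] (H ⊗[k] H) := includeRight.comp includeRight

/-- The legs `A¹, A², A³, A⁴` of `γ` sit at `incl₃`, `incl₁`, `incl₂`, `incl₄`. Legs under `S`
receive the reversed factor and the others receive `w`, all by right multiplication inside the
functional. -/
theorem revS_mul_evalMap_mul (z w : H ⊗[k] H) (t : (H ⊗[k] H) ⊗[k] (H ⊗[k] H)) :
    Q.revS z * Q.evalMap t * w
      = Q.evalMap (t * (lift2 incl₃ incl₁ z * lift2 incl₂ incl₄ w)) := by
  induction t with
  | zero => simp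
  | add a b ha hb => rw [map_add, mul_add, add_mul, add_mul, map_add, ha, hb]
  | tmul s t =>
    induction s with
    | zero => simp
    | add a b ha hb =>
      rw [TensorProduct.add_tmul, map_add, mul_add, add_mul, add_mul, map_add, ha, hb]
    | tmul s₁ s₂ =>
      induction t with
      | zero => simp
      | add a b ha hb =>
        rw [TensorProduct.tmul_add, map_add, mul_add, add_mul, add_mul, map_add, ha, hb]
      | tmul t₁ t₂ =>
        induction z with
        | zero => simp
        | add a b ha hb => simp only [map_add, mul_add, add_mul, ha, hb]
        | tmul a b =>
          induction w with
          | zero => simp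
          | add a b ha hb => simp only [map_add, mul_add, ha, hb]
          | tmul c d => simp [evalMap, mul_assoc]

theorem mul_coevalMap_mul_revS (z w : H ⊗[k] H) (t : (H ⊗[k] H) ⊗[k] (H ⊗[k] H)) :
    z * Q.coevalMap t * Q.revS w
      = Q.coevalMap (lift2 incl₁ incl₃ z * lift2 incl₄ incl₂ w * t) := by
  induction t with
  | zero => simp
  | add a b ha hb => rw [map_add, mul_add, add_mul, mul_add, map_add, ha, hb]
  | tmul s t =>
    induction s with
    | zero => simp
    | add a b ha hb =>
      rw [TensorProduct.add_tmul, map_add, mul_add, add_mul, mul_add, map_add, ha, hb]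
    | tmul s₁ s₂ =>
      induction t with
      | zero => simp
      | add a b ha hb =>
        rw [TensorProduct.tmul_add, map_add, mul_add, add_mul, mul_add, map_add, ha, hb]
      | tmul t₁ t₂ =>
        induction z with
        | zero => simp
        | add a b ha hb => simp only [map_add, add_mul, ha, hb]
        | tmul a b =>
          induction w with
          | zero => simp
          | add a b ha hb => simp only [map_add, mul_add, add_mul, ha, hb]
          | tmul c d => simp [coevalMap, mul_assoc]

local infixr:75 "⋄" => ten (QuasiBialgebra.comul (QuasiHopf.toQuasiBialgebra Q))
local notation:max "⦅" u "," v "," w "⦆" =>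
  cell (QuasiBialgebra.Φ (QuasiHopf.toQuasiBialgebra Q)) u v w

theorem gammaMap_eq (t : H ⊗[k] (H ⊗[k] (H ⊗[k] H))) :
    Q.gammaMap t = Q.evalMap (lift2 incl₃ (lift2 incl₁ (lift2 incl₂ incl₄)) t) := by
  have h : Q.gammaMap = Q.evalMap.comp
      (lift2 incl₃ (lift2 incl₁ (lift2 incl₂ incl₄)) : _ →ₐ[k] _).toLinearMap := by
    ext a b c d
    simp [gammaMap_tmul, evalMap]
  exact LinearMap.congr_fun h t

theorem lift_elemA (a b c d : H →ₐ[k] C) [CommHom a b] [CommHom a c] [CommHom a d] [CommHom b c]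
    [CommHom b d] [CommHom c d] :
    lift2 a (lift2 b (lift2 c d)) Q.elemA = (⦅a, b, c⦆ * ⦅a ⋄ b, c, d⦆⁻¹ : Cˣ).val := by
  have e3 : (lift2 a (lift2 b (lift2 c d))).comp (onTail H (onTail H (padOne H H)))
      = lift2 a (lift2 b c) :=
    (lift2_comp_onTail _ _ _).trans (lift2_congr rfl
      ((lift2_comp_onTail _ _ _).trans (lift2_congr rfl (lift2_comp_padOne _ _))))
  have e5 : (lift2 a (lift2 b (lift2 c d))).comp (onHead (H ⊗[k] H) Q.comul)
      = lift2 (a ⋄ b) (lift2 c d) := lift2_comp_onHead _ _ _ _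
  rw [elemA, map_mul, ← AlgHom.comp_apply, e3, ← AlgHom.comp_apply, e5]
  rfl

theorem gamma_eq : Q.gamma = Q.evalMap
    (⦅incl₃, incl₁, incl₂⦆ * ⦅incl₃ ⋄ incl₁, incl₂, incl₄⦆⁻¹ : ((H ⊗[k] H) ⊗[k] (H ⊗[k] H))ˣ).val := by
  rw [gamma, gammaMap_eq, lift_elemA]

/-- `δ = B¹ β S(B⁴) ⊗ B² β S(B³)`, where `B = (Δ ⊗ id ⊗ id)(Φ)(Φ⁻¹ ⊗ 1)`. -/
def delta : H ⊗[k] H := Q.coevalMap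
    (⦅incl₁ ⋄ incl₃, incl₄, incl₂⦆ * ⦅incl₁, incl₃, incl₄⦆⁻¹ : ((H ⊗[k] H) ⊗[k] (H ⊗[k] H))ˣ).val

theorem labs_antiLeft : LAbs (antiLeft Q.S Q.α) (includeLeft ⋄ includeRight) (Q.unit _) := by
  rw [antiLeft_eq]
  exact labs_relLeft (antiLin_mul Q.S) fun h => by rw [← antiLeft_eq, Q.antipode_left]

theorem rabs_antiRight : RAbs (antiRight Q.S Q.β) (includeLeft ⋄ includeRight) (Q.unit _) := by
  rw [antiRight_eq]
  exact rabs_relRight (antiLin_mul Q.S) fun h => by rw [← antiRight_eq, Q.antipode_right]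

/-- This rebracketing puts the inner pair `b c` together, so that it can be contracted before the
outer pair `a d`. -/
theorem assoc_inv_intw (a b c d : H →ₐ[k] C) [CommHom a b] [CommHom a c] [CommHom a d]
    [CommHom b c] [CommHom b d] [CommHom c d] :
    Intw (⦅a, b, c⦆ * ⦅a ⋄ b, c, d⦆⁻¹) ((a ⋄ b) ⋄ c ⋄ d) ((a ⋄ b ⋄ c) ⋄ d) :=
  (Intw.ten _ (Q.assoc_intw a b c) (cell_intw_right _ a b c d)).mul
    (Q.assoc_intw (a ⋄ b) c d).inv

/-- The left side inserts `(Δ ⊗ Δ)Δ(h)` to the right of `A`. Moved across `A`, it becomes bracketed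
with the inner pair `1 2` together; the antipode axiom contracts that pair and then the outer pair
`3 4`. -/
theorem relLeft_gamma (h : H) :
    relLeft Q.comul Q.antiComulCop Q.gamma (Q.comul h) = Q.counit h • Q.gamma := by
  have key : ∀ z, relLeft Q.comul Q.antiComulCop Q.gamma z = Q.evalMap
      ((⦅incl₃, incl₁, incl₂⦆ * ⦅incl₃ ⋄ incl₁, incl₂, incl₄⦆⁻¹ : ((H ⊗[k] H) ⊗[k] (H ⊗[k] H))ˣ).val *
        lift2 (incl₃ ⋄ incl₁) (incl₂ ⋄ incl₄) z) := fun z => by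
    induction z with
    | zero => simp
    | add a b ha hb => rw [map_add, map_add, mul_add, map_add, ha, hb]
    | tmul a b =>
      rw [relLeft_tmul, antiComulCop_apply, gamma_eq, revS_mul_evalMap_mul]; rfl
  have h12 : LAbs Q.evalMap (incl₁ ⋄ incl₂) (Q.unit _) := by
    have := Q.labs_antiLeft.map_left (antiLeft Q.S Q.α)
    rwa [comp_ten, comp_unitHom] at this
  have h34 : LAbs Q.evalMap (incl₃ ⋄ incl₄) (Q.unit _) := by
    have := Q.labs_antiLeft.map_right (antiLeft Q.S Q.α)
    rwa [comp_ten, comp_unitHom] at this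
  have l := (h12.ten_right Q.comul incl₃).ten_left Q.comul incl₄
  simp only [Q.tens_unit] at l
  rw [key, ← ten_apply, Q.assoc_inv_intw, l, h34, unitHom_apply, smul_mul_assoc,
    one_mul, map_smul, ← gamma_eq]

/-- Dual to `relLeft_gamma`: the element defining `δ` is the inverse of the one for `γ` on the legs
`1, 3, 4, 2`, whose inner pair is `3 4` and outer pair `1 2`. -/
theorem relRight_delta (h : H) :
    relRight Q.comul Q.antiComulCop Q.delta (Q.comul h) = Q.counit h • Q.delta := by
  have key : ∀ z, relRight Q.comul Q.antiComulCop Q.delta z = Q.coevalMap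
      (lift2 (incl₁ ⋄ incl₃) (incl₄ ⋄ incl₂) z *
      (⦅incl₁, incl₃, incl₄⦆ * ⦅incl₁ ⋄ incl₃, incl₄, incl₂⦆⁻¹ :
        ((H ⊗[k] H) ⊗[k] (H ⊗[k] H))ˣ)⁻¹.val) := fun z => by
    induction z with
    | zero => simp
    | add a b ha hb => rw [map_add, map_add, add_mul, map_add, ha, hb]
    | tmul a b =>
      rw [relRight_tmul, antiComulCop_apply, delta, mul_coevalMap_mul_revS, mul_inv_rev, inv_inv]
      rfl
  have h34 : RAbs Q.coevalMap (incl₃ ⋄ incl₄) (Q.unit _) := by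
    have := Q.rabs_antiRight.map_right (antiRight Q.S Q.β)
    rwa [comp_ten, comp_unitHom] at this
  have h12 : RAbs Q.coevalMap (incl₁ ⋄ incl₂) (Q.unit _) := by
    have := Q.rabs_antiRight.map_left (antiRight Q.S Q.β)
    rwa [comp_ten, comp_unitHom] at this
  have l := (h34.ten_right Q.comul incl₁).ten_left Q.comul incl₂
  simp only [Q.tens_unit] at l
  rw [key, ← ten_apply, ← (Q.assoc_inv_intw incl₁ incl₃ incl₄ incl₂).inv, l, h12, unitHom_apply,
    mul_smul_comm, mul_one, map_smul, mul_inv_rev, inv_inv, ← delta]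

/-- `(t₄ ⊗ t₅) ⊗ (t₃ ⊗ t₆)` and `(s₁ ⊗ s₄) ⊗ (s₂ ⊗ s₃)` in terms of single zigzags. -/
theorem coevalMap_mul_evalMap (s t : (H ⊗[k] H) ⊗[k] (H ⊗[k] H)) :
    Q.coevalMap s * Q.evalMap t
      = TensorProduct.map (zigzagLeft Q.S Q.α Q.β) (zigzagLeft Q.S Q.α Q.β)
          (Algebra.TensorProduct.map includeRight includeRight t
            * Algebra.TensorProduct.map (onTail H includeLeft) (onTail H includeLeft) s) := by
  induction s with
  | zero => simp
  | add a b ha hb => simp only [map_add, mul_add, add_mul, ha, hb]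
  | tmul s s' =>
    induction s with
    | zero => simp
    | add a b ha hb => simp only [TensorProduct.add_tmul, map_add, mul_add, add_mul, ha, hb]
    | tmul s₁ s₂ =>
      induction s' with
      | zero => simp
      | add a b ha hb => simp only [TensorProduct.tmul_add, map_add, mul_add, add_mul, ha, hb]
      | tmul s₃ s₄ =>
        induction t with
        | zero => simp
        | add a b ha hb => simp only [map_add, mul_add, add_mul, ha, hb]
        | tmul t t' =>
          induction t with
          | zero => simp
          | add a b ha hb =>
            simp only [TensorProduct.add_tmul, map_add, mul_add, add_mul, ha, hb]
          | tmul t₁ t₂ =>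
            induction t' with
            | zero => simp
            | add a b ha hb =>
              simp only [TensorProduct.tmul_add, map_add, mul_add, add_mul, ha, hb]
            | tmul t₃ t₄ => simp [coevalMap, evalMap, mul_assoc]

/-- The legs that meet are not under `S`, so they multiply in the given order, `t` before `s`, into
the middle leg of a right zigzag. -/
theorem evalMap_mul_coevalMap (s t : (H ⊗[k] H) ⊗[k] (H ⊗[k] H)) :
    Q.evalMap t * Q.coevalMap s
      = TensorProduct.map (zigzagRight Q.S Q.α Q.β) (zigzagRight Q.S Q.α Q.β)
          (Algebra.TensorProduct.map (onTail H includeLeft) (onTail H includeLeft) t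
            * Algebra.TensorProduct.map includeRight includeRight s) := by
  induction s with
  | zero => simp
  | add a b ha hb => simp only [map_add, mul_add, ha, hb]
  | tmul s s' =>
    induction s with
    | zero => simp
    | add a b ha hb => simp only [TensorProduct.add_tmul, map_add, mul_add, ha, hb]
    | tmul s₁ s₂ =>
      induction s' with
      | zero => simp
      | add a b ha hb => simp only [TensorProduct.tmul_add, map_add, mul_add, ha, hb]
      | tmul s₃ s₄ =>
        induction t with
        | zero => simp
        | add a b ha hb => simp only [map_add, add_mul, ha, hb]
        | tmul t t' =>
          induction t with
          | zero => simp
          | add a b ha hb =>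
            simp only [TensorProduct.add_tmul, map_add, add_mul, ha, hb]
          | tmul t₁ t₂ =>
            induction t' with
            | zero => simp
            | add a b ha hb =>
              simp only [TensorProduct.tmul_add, map_add, add_mul, ha, hb]
            | tmul t₃ t₄ => simp [coevalMap, evalMap, mul_assoc]

end QuasiHopf

end

end QuasiHopfTheory

/-! ### Images of cells under algebra maps, and the zigzag identities for `γ` and `δ`. -/

namespace QuasiHopfTheory

noncomputable section

section MapCell

variable {k : Type*} [Field k] {C E X Y Z P : Type*} [Ring C] [Algebra k C] [Ring E] [Algebra k E]
  [Ring X] [Algebra k X] [Ring Y] [Algebra k Y] [Ring Z] [Algebra k Z] [Ring P] [Algebra k P]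

theorem map_cell_of_eq {f : C →ₐ[k] E} {Φ : (X ⊗[k] (Y ⊗[k] Z))ˣ} {u : X →ₐ[k] C} {v : Y →ₐ[k] C}
    {w : Z →ₐ[k] C} {u' : X →ₐ[k] E} {v' : Y →ₐ[k] E} {w' : Z →ₐ[k] E}
    [CommHom u v] [CommHom u w] [CommHom v w] [CommHom u' v'] [CommHom u' w'] [CommHom v' w']
    (hu : f.comp u = u') (hv : f.comp v = v') (hw : f.comp w = w') :
    Units.map (f : C →* E) (cell Φ u v w) = cell Φ u' v' w' := by
  subst hu; subst hv; subst hw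
  exact map_cell f Φ u v w

theorem map_units_val (f : C →ₐ[k] E) (x : Cˣ) : f x.val = (Units.map (f : C →* E) x).val := rfl

theorem comp_ten_of_eq {f : C →ₐ[k] E} {d : P →ₐ[k] X ⊗[k] Y} {u : X →ₐ[k] C} {v : Y →ₐ[k] C}
    {u' : X →ₐ[k] E} {v' : Y →ₐ[k] E} [CommHom u v] [CommHom u' v']
    (hu : f.comp u = u') (hv : f.comp v = v') : f.comp (ten d u v) = ten d u' v' := by
  subst hu; subst hv
  exact comp_ten f d u v

end MapCell

namespace QuasiHopf

open Algebra.TensorProduct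

variable {k H C : Type*} [Field k] [Ring H] [Algebra k H] [Ring C] [Algebra k C]
  (Q : QuasiHopf k H)

local infixr:75 "⋄" => ten (QuasiBialgebra.comul (QuasiHopf.toQuasiBialgebra Q))
local notation:max "⦅" u "," v "," w "⦆" =>
  cell (QuasiBialgebra.Φ (QuasiHopf.toQuasiBialgebra Q)) u v w

/-- The six inclusions `H → (H ⊗ H ⊗ H) ⊗ (H ⊗ H ⊗ H)`. -/
abbrev inclL₁ : H →ₐ[k] (H ⊗[k] (H ⊗[k] H)) ⊗[k] (H ⊗[k] (H ⊗[k] H)) :=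
  includeLeft.comp includeLeft
abbrev inclL₂ : H →ₐ[k] (H ⊗[k] (H ⊗[k] H)) ⊗[k] (H ⊗[k] (H ⊗[k] H)) :=
  includeLeft.comp (includeRight.comp includeLeft)
abbrev inclL₃ : H →ₐ[k] (H ⊗[k] (H ⊗[k] H)) ⊗[k] (H ⊗[k] (H ⊗[k] H)) :=
  includeLeft.comp (includeRight.comp includeRight)
abbrev inclR₁ : H →ₐ[k] (H ⊗[k] (H ⊗[k] H)) ⊗[k] (H ⊗[k] (H ⊗[k] H)) :=
  includeRight.comp includeLeft
abbrev inclR₂ : H →ₐ[k] (H ⊗[k] (H ⊗[k] H)) ⊗[k] (H ⊗[k] (H ⊗[k] H)) :=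
  includeRight.comp (includeRight.comp includeLeft)
abbrev inclR₃ : H →ₐ[k] (H ⊗[k] (H ⊗[k] H)) ⊗[k] (H ⊗[k] (H ⊗[k] H)) :=
  includeRight.comp (includeRight.comp includeRight)

theorem inclL_cell (Φ : (H ⊗[k] (H ⊗[k] H))ˣ) :
    (cell Φ inclL₁ inclL₂ inclL₃).val = Φ.val ⊗ₜ[k] (1 : H ⊗[k] (H ⊗[k] H)) := by
  rw [← map_cell, cell_includes]; rfl

theorem inclR_cell (Φ : (H ⊗[k] (H ⊗[k] H))ˣ) :
    (cell Φ inclR₁ inclR₂ inclR₃).val = (1 : H ⊗[k] (H ⊗[k] H)) ⊗ₜ[k] Φ.val := by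
  rw [← map_cell, cell_includes]; rfl

theorem inclL_cell_inv (Φ : (H ⊗[k] (H ⊗[k] H))ˣ) :
    (cell Φ inclL₁ inclL₂ inclL₃)⁻¹.val = Φ⁻¹.val ⊗ₜ[k] (1 : H ⊗[k] (H ⊗[k] H)) :=
  inclL_cell Φ⁻¹

theorem inclR_cell_inv (Φ : (H ⊗[k] (H ⊗[k] H))ˣ) :
    (cell Φ inclR₁ inclR₂ inclR₃)⁻¹.val = (1 : H ⊗[k] (H ⊗[k] H)) ⊗ₜ[k] Φ⁻¹.val :=
  inclR_cell Φ⁻¹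

theorem zigzagLeft_eq : zigzagLeft Q.S Q.α Q.β = mulMap
    ((LinearMap.mulRight k Q.β).comp (AlgHom.id k H).toLinearMap) (antiLeft Q.S Q.α) := rfl

theorem zigzagRight_eq : zigzagRight Q.S Q.α Q.β = mulMap
    ((LinearMap.mulRight k Q.α).comp (antiLin Q.S)) (antiRight Q.S Q.β) := rfl

theorem labs_zigzagLeft : LAbs (zigzagLeft Q.S Q.α Q.β)
    ((includeRight.comp includeLeft) ⋄ (includeRight.comp includeRight)) (Q.unit _) := by
  have := Q.labs_antiLeft.mulMap_right
    ((LinearMap.mulRight k Q.β).comp (AlgHom.id k H).toLinearMap)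
  rwa [comp_ten, comp_unitHom] at this

theorem rabs_zigzagLeft : RAbs (zigzagLeft Q.S Q.α Q.β)
    (includeLeft ⋄ (includeRight.comp includeLeft)) (Q.unit _) := by
  rw [zigzagLeft_eq, antiLeft_eq]
  exact rabs_mulMap_mulMap (T := antiLin Q.S)
    (fun h => by rw [← antiRight_eq, Q.antipode_right]) (fun x y => by simp [mul_assoc]) _

theorem rabs_zigzagRight : RAbs (zigzagRight Q.S Q.α Q.β)
    ((includeRight.comp includeLeft) ⋄ (includeRight.comp includeRight)) (Q.unit _) := by
  have := Q.rabs_antiRight.mulMap_right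
    ((LinearMap.mulRight k Q.α).comp (antiLin Q.S))
  rwa [comp_ten, comp_unitHom] at this

theorem labs_zigzagRight : LAbs (zigzagRight Q.S Q.α Q.β)
    (includeLeft ⋄ (includeRight.comp includeLeft)) (Q.unit _) := by
  rw [zigzagRight_eq, antiRight_eq]
  exact labs_mulMap_mulMap (T := antiLin Q.S) (φ := AlgHom.id k H) (antiLin_mul Q.S)
    (fun h => by rw [← antiLeft_eq, Q.antipode_left]) (fun x y => by simp [mul_assoc]) _

theorem map_assoc_mul_inv {E : Type*} [Ring E] [Algebra k E] {f : C →ₐ[k] E} {a b c d : H →ₐ[k] C}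
    {a' b' c' d' : H →ₐ[k] E} [CommHom a b] [CommHom a c] [CommHom a d] [CommHom b c]
    [CommHom b d] [CommHom c d] [CommHom a' b'] [CommHom a' c'] [CommHom a' d'] [CommHom b' c']
    [CommHom b' d'] [CommHom c' d'] (ha : f.comp a = a') (hb : f.comp b = b') (hc : f.comp c = c')
    (hd : f.comp d = d') :
    f (⦅a, b, c⦆ * ⦅a ⋄ b, c, d⦆⁻¹ : Cˣ).val = (⦅a', b', c'⦆ * ⦅a' ⋄ b', c', d'⦆⁻¹ : Eˣ).val := by
  rw [map_units_val f, map_mul, map_inv, map_cell_of_eq ha hb hc,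
    map_cell_of_eq (comp_ten_of_eq ha hb) hc hd]

theorem map_assoc_inv_mul {E : Type*} [Ring E] [Algebra k E] {f : C →ₐ[k] E} {a b c d : H →ₐ[k] C}
    {a' b' c' d' : H →ₐ[k] E} [CommHom a b] [CommHom a c] [CommHom a d] [CommHom b c]
    [CommHom b d] [CommHom c d] [CommHom a' b'] [CommHom a' c'] [CommHom a' d'] [CommHom b' c']
    [CommHom b' d'] [CommHom c' d'] (ha : f.comp a = a') (hb : f.comp b = b') (hc : f.comp c = c')
    (hd : f.comp d = d') :
    f (⦅a ⋄ b, c, d⦆ * ⦅a, b, c⦆⁻¹ : Cˣ).val = (⦅a' ⋄ b', c', d'⦆ * ⦅a', b', c'⦆⁻¹ : Eˣ).val := by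
  rw [map_units_val f, map_mul, map_inv, map_cell_of_eq ha hb hc,
    map_cell_of_eq (comp_ten_of_eq ha hb) hc hd]

theorem gamma_mul_comul (y z : H) :
    Q.antiComulCop y * Q.gamma * Q.comul z = Q.evalMap
      ((⦅incl₃, incl₁, incl₂⦆ * ⦅incl₃ ⋄ incl₁, incl₂, incl₄⦆⁻¹ :
        ((H ⊗[k] H) ⊗[k] (H ⊗[k] H))ˣ).val
        * ((incl₃ ⋄ incl₁) y * (incl₂ ⋄ incl₄) z)) := by
  rw [antiComulCop_apply, gamma_eq, revS_mul_evalMap_mul]; rfl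

theorem antiComulCop_mul_gamma (y : H) :
    Q.antiComulCop y * Q.gamma = Q.evalMap
      ((⦅incl₃, incl₁, incl₂⦆ * ⦅incl₃ ⋄ incl₁, incl₂, incl₄⦆⁻¹ :
        ((H ⊗[k] H) ⊗[k] (H ⊗[k] H))ˣ).val
        * (incl₃ ⋄ incl₁) y) := by
  simpa using Q.gamma_mul_comul y 1

theorem comul_mul_delta (x z : H) :
    Q.comul x * Q.delta * Q.antiComulCop z = Q.coevalMap
      ((incl₁ ⋄ incl₃) x * (incl₄ ⋄ incl₂) z
        * (⦅incl₁ ⋄ incl₃, incl₄, incl₂⦆ * ⦅incl₁, incl₃, incl₄⦆⁻¹ :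
        ((H ⊗[k] H) ⊗[k] (H ⊗[k] H))ˣ).val) := by
  rw [antiComulCop_apply, delta, mul_coevalMap_mul_revS]; rfl

theorem comul_mul_delta' (x : H) :
    Q.comul x * Q.delta = Q.coevalMap
      ((incl₁ ⋄ incl₃) x
        * (⦅incl₁ ⋄ incl₃, incl₄, incl₂⦆ * ⦅incl₁, incl₃, incl₄⦆⁻¹ :
        ((H ⊗[k] H) ⊗[k] (H ⊗[k] H))ˣ).val) := by
  have h := Q.comul_mul_delta x 1
  rwa [show Q.antiComulCop 1 = 1 by rw [antiComulCop_apply, map_one, revS_one], map_one, mul_one,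
    mul_one] at h

/-- Brings the left zigzag of `(γ, δ)` into the form required by `double_zigzag`: `δ` occupies legs
`1`–`4`, `γ` legs `3`–`6`, and they meet in the legs `3` and `4`, which stand under `S`. -/
theorem zigzag_left_eq
  {u₁ u₂ u₃ u₄ u₅ u₆ : H →ₐ[k] C} [CommHom u₁ u₂] [CommHom u₁ u₃] [CommHom u₁ u₄] [CommHom u₁ u₅]
    [CommHom u₁ u₆] [CommHom u₂ u₃] [CommHom u₂ u₄] [CommHom u₂ u₅] [CommHom u₂ u₆] [CommHom u₃ u₄]
    [CommHom u₃ u₅] [CommHom u₃ u₆] [CommHom u₄ u₅] [CommHom u₄ u₆] [CommHom u₅ u₆]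
    {E₁ E₂ : (H ⊗[k] H) ⊗[k] (H ⊗[k] H) →ₐ[k] C} {G : C →ₗ[k] H ⊗[k] H}
    (a1 : E₁.comp incl₁ = u₄) (a2 : E₁.comp incl₂ = u₅) (a3 : E₁.comp incl₃ = u₃)
    (a4 : E₁.comp incl₄ = u₆) (b1 : E₂.comp incl₁ = u₁) (b2 : E₂.comp incl₂ = u₄)
    (b3 : E₂.comp incl₃ = u₂) (b4 : E₂.comp incl₄ = u₃)
    (hG : ∀ s t, Q.coevalMap s * Q.evalMap t = G (E₁ t * E₂ s)) (t : H ⊗[k] (H ⊗[k] H)) :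
    mulMap ((LinearMap.mulRight k Q.delta).comp Q.comul.toLinearMap)
      (relLeft Q.comul Q.antiComulCop Q.gamma) t
      = G ((⦅u₃, u₄, u₅⦆ * ⦅u₃ ⋄ u₄, u₅, u₆⦆⁻¹ : Cˣ).val
        * lift2 (u₁ ⋄ u₂) (lift2 (u₃ ⋄ u₄) (u₅ ⋄ u₆)) t
        * (⦅u₁ ⋄ u₂, u₃, u₄⦆ * ⦅u₁, u₂, u₃⦆⁻¹ : Cˣ).val) := by
  induction t with
  | zero => simp
  | add a b ha hb => rw [map_add, map_add, mul_add, add_mul, map_add, ha, hb]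
  | tmul x s =>
    induction s with
    | zero => simp
    | add a b ha hb =>
      rw [TensorProduct.tmul_add, map_add, map_add, mul_add, add_mul, map_add, ha, hb]
    | tmul y z =>
      change Q.comul x * Q.delta * (Q.antiComulCop y * Q.gamma * Q.comul z) = _
      rw [comul_mul_delta', gamma_mul_comul, hG, map_mul E₁, map_mul E₁, map_mul E₂,
        Q.map_assoc_mul_inv a3 a1 a2 a4, Q.map_assoc_inv_mul b1 b3 b4 b2]
      have d1 : E₁ ((incl₃ ⋄ incl₁) y) = (u₃ ⋄ u₄) y :=
        DFunLike.congr_fun (comp_ten_of_eq a3 a1) y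
      have d2 : E₁ ((incl₂ ⋄ incl₄) z) = (u₅ ⋄ u₆) z :=
        DFunLike.congr_fun (comp_ten_of_eq a2 a4) z
      have d3 : E₂ ((incl₁ ⋄ incl₃) x) = (u₁ ⋄ u₂) x :=
        DFunLike.congr_fun (comp_ten_of_eq b1 b3) x
      rw [d1, d2, d3, lift2_tmul, lift2_tmul,
        ((CommHom.comm (u := u₁ ⋄ u₂) (v := u₃ ⋄ u₄) x y).mul_right
          (CommHom.comm (u := u₁ ⋄ u₂) (v := u₅ ⋄ u₆) x z)).eq]
      simp only [mul_assoc]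

/-- The mirror image, for `double_zigzag_inv`: `γ` occupies legs `1`–`4` and `δ` legs `3`–`6`. Here
the legs under `S` are `1, 2, 5, 6`. -/
theorem zigzag_right_eq
  {u₁ u₂ u₃ u₄ u₅ u₆ : H →ₐ[k] C} [CommHom u₁ u₂] [CommHom u₁ u₃] [CommHom u₁ u₄] [CommHom u₁ u₅]
    [CommHom u₁ u₆] [CommHom u₂ u₃] [CommHom u₂ u₄] [CommHom u₂ u₅] [CommHom u₂ u₆] [CommHom u₃ u₄]
    [CommHom u₃ u₅] [CommHom u₃ u₆] [CommHom u₄ u₅] [CommHom u₄ u₆] [CommHom u₅ u₆]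
    {E₁ E₂ : (H ⊗[k] H) ⊗[k] (H ⊗[k] H) →ₐ[k] C} {G : C →ₗ[k] H ⊗[k] H}
    (a1 : E₁.comp incl₁ = u₃) (a2 : E₁.comp incl₂ = u₆) (a3 : E₁.comp incl₃ = u₄)
    (a4 : E₁.comp incl₄ = u₅) (b1 : E₂.comp incl₁ = u₂) (b2 : E₂.comp incl₂ = u₃)
    (b3 : E₂.comp incl₃ = u₁) (b4 : E₂.comp incl₄ = u₄)
    (hG : ∀ s t, Q.evalMap t * Q.coevalMap s = G (E₂ t * E₁ s)) (t : H ⊗[k] (H ⊗[k] H)) :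
    mulMap ((LinearMap.mulRight k Q.gamma).comp Q.antiComulCop)
      (relRight Q.comul Q.antiComulCop Q.delta) t
      = G ((⦅u₁, u₂, u₃⦆ * ⦅u₁ ⋄ u₂, u₃, u₄⦆⁻¹ : Cˣ).val
        * lift2 (u₁ ⋄ u₂) (lift2 (u₃ ⋄ u₄) (u₅ ⋄ u₆)) t
        * (⦅u₃ ⋄ u₄, u₅, u₆⦆ * ⦅u₃, u₄, u₅⦆⁻¹ : Cˣ).val) := by
  induction t with
  | zero => simp
  | add a b ha hb => rw [map_add, map_add, mul_add, add_mul, map_add, ha, hb]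
  | tmul x s =>
    induction s with
    | zero => simp
    | add a b ha hb =>
      rw [TensorProduct.tmul_add, map_add, map_add, mul_add, add_mul, map_add, ha, hb]
    | tmul y z =>
      change Q.antiComulCop x * Q.gamma * (Q.comul y * Q.delta * Q.antiComulCop z) = _
      rw [antiComulCop_mul_gamma, comul_mul_delta, hG, map_mul E₁, map_mul E₁, map_mul E₂,
        Q.map_assoc_mul_inv b3 b1 b2 b4, Q.map_assoc_inv_mul a1 a3 a4 a2]
      have d1 : E₂ ((incl₃ ⋄ incl₁) x) = (u₁ ⋄ u₂) x :=
        DFunLike.congr_fun (comp_ten_of_eq b3 b1) x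
      have d2 : E₁ ((incl₁ ⋄ incl₃) y) = (u₃ ⋄ u₄) y :=
        DFunLike.congr_fun (comp_ten_of_eq a1 a3) y
      have d3 : E₁ ((incl₄ ⋄ incl₂) z) = (u₅ ⋄ u₆) z :=
        DFunLike.congr_fun (comp_ten_of_eq a4 a2) z
      rw [d1, d2, d3, lift2_tmul, lift2_tmul]
      simp only [mul_assoc]

/-- `t ↦ 1 ⊗ t` on both factors. -/
abbrev padLeft₂ (k H : Type*) [Field k] [Ring H] [Algebra k H] : (H ⊗[k] H) ⊗[k] (H ⊗[k] H) →ₐ[k]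
    (H ⊗[k] (H ⊗[k] H)) ⊗[k] (H ⊗[k] (H ⊗[k] H)) :=
  Algebra.TensorProduct.map includeRight includeRight

/-- `t ↦ t ⊗ 1` on both factors. -/
abbrev padRight₂ (k H : Type*) [Field k] [Ring H] [Algebra k H] : (H ⊗[k] H) ⊗[k] (H ⊗[k] H) →ₐ[k]
    (H ⊗[k] (H ⊗[k] H)) ⊗[k] (H ⊗[k] (H ⊗[k] H)) :=
  Algebra.TensorProduct.map (onTail H includeLeft) (onTail H includeLeft)

section Pads

variable (k H)

theorem padLeft₂_incl₁ : (padLeft₂ k H).comp incl₁ = inclL₂ := by ext; simp [one_def]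
theorem padLeft₂_incl₂ : (padLeft₂ k H).comp incl₂ = inclL₃ := by ext; simp [one_def]
theorem padLeft₂_incl₃ : (padLeft₂ k H).comp incl₃ = inclR₂ := by ext; simp [one_def]
theorem padLeft₂_incl₄ : (padLeft₂ k H).comp incl₄ = inclR₃ := by ext; simp [one_def]
theorem padRight₂_incl₁ : (padRight₂ k H).comp incl₁ = inclL₁ := by ext; simp [one_def]
theorem padRight₂_incl₂ : (padRight₂ k H).comp incl₂ = inclL₂ := by ext; simp [one_def]
theorem padRight₂_incl₃ : (padRight₂ k H).comp incl₃ = inclR₁ := by ext; simp [one_def]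
theorem padRight₂_incl₄ : (padRight₂ k H).comp incl₄ = inclR₂ := by ext; simp [one_def]

end Pads

theorem zigzag_left_gamma_delta :
    mulMap ((LinearMap.mulRight k Q.delta).comp Q.comul.toLinearMap)
      (relLeft Q.comul Q.antiComulCop Q.gamma) Q.Φ.val = 1 := by
  let G := TensorProduct.map (zigzagLeft Q.S Q.α Q.β) (zigzagLeft Q.S Q.α Q.β)
  have h45 : LAbs G (inclL₂ ⋄ inclL₃) (Q.unit _) := by
    have := Q.labs_zigzagLeft.map_left (zigzagLeft Q.S Q.α Q.β)
    rwa [comp_ten, comp_unitHom] at this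
  have h36 : LAbs G (inclR₂ ⋄ inclR₃) (Q.unit _) := by
    have := Q.labs_zigzagLeft.map_right (zigzagLeft Q.S Q.α Q.β)
    rwa [comp_ten, comp_unitHom] at this
  have h14 : RAbs G (inclL₁ ⋄ inclL₂) (Q.unit _) := by
    have := Q.rabs_zigzagLeft.map_left (zigzagLeft Q.S Q.α Q.β)
    rwa [comp_ten, comp_unitHom] at this
  have h23 : RAbs G (inclR₁ ⋄ inclR₂) (Q.unit _) := by
    have := Q.rabs_zigzagLeft.map_right (zigzagLeft Q.S Q.α Q.β)
    rwa [comp_ten, comp_unitHom] at this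
  -- The legs `1 4 5` lie in the left tensor factor and `2 3 6` in the right one, so the two
  -- surviving cells are `Φ ⊗ 1` and `1 ⊗ Φ`, each evaluated to `1` by the zigzag axiom of `H`.
  have z := Q.double_zigzag h45 h36 h23 h14
  rw [Q.zigzag_left_eq (padLeft₂_incl₁ k H) (padLeft₂_incl₂ k H) (padLeft₂_incl₃ k H)
    (padLeft₂_incl₄ k H) (padRight₂_incl₁ k H) (padRight₂_incl₂ k H) (padRight₂_incl₃ k H)
    (padRight₂_incl₄ k H) Q.coevalMap_mul_evalMap]
  simp only [Units.val_mul, mul_assoc] at z ⊢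
  refine z.trans ?_
  rw [inclL_cell, inclR_cell, tmul_mul_tmul, one_mul, mul_one]
  simp [G, Q.zigzag_left, one_def]

theorem zigzag_right_gamma_delta :
    mulMap ((LinearMap.mulRight k Q.gamma).comp Q.antiComulCop)
      (relRight Q.comul Q.antiComulCop Q.delta) Q.Φ⁻¹.val = 1 := by
  let G := TensorProduct.map (zigzagRight Q.S Q.α Q.β) (zigzagRight Q.S Q.α Q.β)
  have h23 : LAbs G (inclL₁ ⋄ inclL₂) (Q.unit _) := by
    have := Q.labs_zigzagRight.map_left (zigzagRight Q.S Q.α Q.β)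
    rwa [comp_ten, comp_unitHom] at this
  have h14 : LAbs G (inclR₁ ⋄ inclR₂) (Q.unit _) := by
    have := Q.labs_zigzagRight.map_right (zigzagRight Q.S Q.α Q.β)
    rwa [comp_ten, comp_unitHom] at this
  have h36 : RAbs G (inclL₂ ⋄ inclL₃) (Q.unit _) := by
    have := Q.rabs_zigzagRight.map_left (zigzagRight Q.S Q.α Q.β)
    rwa [comp_ten, comp_unitHom] at this
  have h45 : RAbs G (inclR₂ ⋄ inclR₃) (Q.unit _) := by
    have := Q.rabs_zigzagRight.map_right (zigzagRight Q.S Q.α Q.β)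
    rwa [comp_ten, comp_unitHom] at this
  -- In this case `2 3 6` is the left tensor factor and `1 4 5` the right one, and each surviving
  -- copy of `Φ⁻¹` evaluates to `1`.
  have z := Q.double_zigzag_inv h45 h36 h23 h14
  rw [Q.zigzag_right_eq (padLeft₂_incl₁ k H) (padLeft₂_incl₂ k H) (padLeft₂_incl₃ k H)
    (padLeft₂_incl₄ k H) (padRight₂_incl₁ k H) (padRight₂_incl₂ k H) (padRight₂_incl₃ k H)
    (padRight₂_incl₄ k H) Q.evalMap_mul_coevalMap, ← cell_inv_val]
  simp only [Units.val_mul, mul_assoc, mul_inv_rev, inv_inv] at z ⊢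
  refine z.trans ?_
  rw [inclL_cell_inv, inclR_cell_inv, tmul_mul_tmul, one_mul, mul_one]
  simp [G, Q.zigzag_right, one_def]

end QuasiHopf

end

end QuasiHopfTheory

/-! ### The Drinfeld twist as the comparison of two antipodes, its counits, and its value on
objects. -/

namespace QuasiHopfTheory

noncomputable section

namespace QuasiHopf

open Algebra.TensorProduct

variable {k H C : Type*} [Field k] [Ring H] [Algebra k H] [Ring C] [Algebra k C]
  (Q : QuasiHopf k H)

local infixr:75 "⋄" => ten (QuasiBialgebra.comul (QuasiHopf.toQuasiBialgebra Q))
local notation:max "⦅" u "," v "," w "⦆" =>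
  cell (QuasiBialgebra.Φ (QuasiHopf.toQuasiBialgebra Q)) u v w

theorem antiComulCop_one : Q.antiComulCop 1 = 1 := by
  rw [antiComulCop_apply, map_one, revS_one]

/-- The antipode of the tensor product: `((S ⊗ S) ∘ Δᶜᵒᵖ, γ, δ)`. -/
def tensorAntipode : RelAntipode Q.toQuasiBialgebra Q.comul where
  T := Q.antiComulCop
  α := Q.gamma
  β := Q.delta
  T_one := Q.antiComulCop_one
  T_mul x y := by simp only [antiComulCop_apply, map_mul, revS_mul]
  left := Q.relLeft_gamma
  right := Q.relRight_delta
  zigzag_left := Q.zigzag_left_gamma_delta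
  zigzag_right := Q.zigzag_right_gamma_delta

/-- The image of the antipode under the comultiplication: `(Δ ∘ S, Δ(α), Δ(β))`. -/
def comulAntipode : RelAntipode Q.toQuasiBialgebra Q.comul where
  T := Q.comul.toLinearMap.comp (antiLin Q.S)
  α := Q.comul Q.α
  β := Q.comul Q.β
  T_one := by simp
  T_mul x y := by simp
  left h := by
    have e : relLeft Q.comul (Q.comul.toLinearMap.comp (antiLin Q.S)) (Q.comul Q.α)
        = Q.comul.toLinearMap.comp (antiLeft Q.S Q.α) := by ext; simp
    rw [e, LinearMap.comp_apply, Q.antipode_left, map_smul]; rfl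
  right h := by
    have e : relRight Q.comul (Q.comul.toLinearMap.comp (antiLin Q.S)) (Q.comul Q.β)
        = Q.comul.toLinearMap.comp (antiRight Q.S Q.β) := by ext; simp
    rw [e, LinearMap.comp_apply, Q.antipode_right, map_smul]; rfl
  zigzag_left := by
    have e : mulMap ((LinearMap.mulRight k (Q.comul Q.β)).comp Q.comul.toLinearMap)
        (relLeft Q.comul (Q.comul.toLinearMap.comp (antiLin Q.S)) (Q.comul Q.α))
        = Q.comul.toLinearMap.comp (zigzagLeft Q.S Q.α Q.β) := by ext; simp
    rw [e, LinearMap.comp_apply, Q.zigzag_left]; simp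
  zigzag_right := by
    have e : mulMap ((LinearMap.mulRight k (Q.comul Q.α)).comp
          (Q.comul.toLinearMap.comp (antiLin Q.S)))
        (relRight Q.comul (Q.comul.toLinearMap.comp (antiLin Q.S)) (Q.comul Q.β))
        = Q.comul.toLinearMap.comp (zigzagRight Q.S Q.α Q.β) := by ext; simp
    rw [e, LinearMap.comp_apply, Q.zigzag_right]; simp

/-- The Drinfeld twist is invertible. -/
def twistUnit : (H ⊗[k] H)ˣ := RelAntipode.compareUnit Q.tensorAntipode Q.comulAntipode

theorem twistUnit_val : Q.twistUnit.val = Q.drinfeldTwist := by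
  have e : RelAntipode.compareMap Q.tensorAntipode Q.comulAntipode = Q.twistMap := by
    ext a b c
    · simp [RelAntipode.compareMap, twistMap, tensorAntipode, comulAntipode]
  exact LinearMap.congr_fun e _

/-- `f Δ(S(h)) = (S ⊗ S)(Δᶜᵒᵖ(h)) f`. -/
theorem twistUnit_mul_comul_S (h : H) :
    Q.twistUnit.val * Q.comul (Q.S h).unop = Q.revS (Q.comul h) * Q.twistUnit.val :=
  (RelAntipode.compare_intw Q.tensorAntipode Q.comulAntipode h).symm

/-- `f Δ(α) = γ`. -/
theorem twistUnit_mul_comul_α : Q.twistUnit.val * Q.comul Q.α = Q.gamma :=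
  RelAntipode.compare_mul_α Q.tensorAntipode Q.comulAntipode

/-- In this form `f` can be multiplied into an evaluation: it replaces `Δ` of a contracted pair by
`γ`, with the comultiplied legs around it. -/
theorem twistUnit_mul_comul (a d : H) :
    Q.twistUnit.val * Q.comul ((Q.S a).unop * Q.α * d)
      = Q.antiComulCop a * Q.gamma * Q.comul d := by
  rw [map_mul, map_mul, ← mul_assoc, ← mul_assoc, twistUnit_mul_comul_S, mul_assoc (Q.revS _),
    twistUnit_mul_comul_α]; rfl

/-- An element that intertwines `ψ ∘ S` with `T` is determined by its product with `ψ(α)`. -/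
theorem eq_of_mul_α_eq (ψ : H →ₐ[k] C) (T : H → C) {g g' : C}
    (h : ∀ x, g * ψ (Q.S x).unop = T x * g) (h' : ∀ x, g' * ψ (Q.S x).unop = T x * g')
    (hα : g * ψ Q.α = g' * ψ Q.α) : g = g' := by
  -- Write `1 = S(x¹) α x² β S(x³)`. Moving `g` past `ψ(S(x¹))` brings it next to `ψ(α)`, where `g`
  -- and `g'` agree.
  have key : ∀ t, g * ψ (zigzagRight Q.S Q.α Q.β t) = g' * ψ (zigzagRight Q.S Q.α Q.β t) :=
    fun t => by
    induction t with
    | zero => simp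
    | add a b ha hb => simp only [map_add, mul_add, ha, hb]
    | tmul a s =>
      simp only [zigzagRight, LinearMap.comp_apply, TensorProduct.map_tmul, LinearMap.mul'_apply,
        LinearMap.mulRight_apply, antiLin_apply, map_mul]
      rw [← mul_assoc, ← mul_assoc, ← mul_assoc, ← mul_assoc, h, h', mul_assoc (T a),
        mul_assoc (T a), hα]
      simp only [mul_assoc]
  simpa [Q.zigzag_right] using key Q.Φ⁻¹.val

/-- Apply `ε` to `S(h₁) α h₂ = ε(h) α`; the normalization `ε(α) = 1` removes `α`. -/
theorem counit_S (hα : Q.counit Q.α = 1) (h : H) : Q.counit (Q.S h).unop = Q.counit h := by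
  have key : ∀ z, Q.counit (antiLeft Q.S Q.α z) = Q.counit (Q.S (counitTail H Q.counit z)).unop :=
    fun z => by
    induction z with
    | zero => simp
    | add a b ha hb => simp only [map_add, MulOpposite.unop_add, ha, hb]
    | tmul a b => simp [hα, mul_comm]
  have h1 := key (Q.comul h)
  rwa [Q.antipode_left, Q.counit_right, map_smul, hα, smul_eq_mul, mul_one, eq_comm] at h1

/-- An algebra map `χ : H ⊗ H → H` that behaves like `ε ⊗ id` or `id ⊗ ε` sends `f` to `1`. -/
theorem map_twistUnit_eq_one (χ : H ⊗[k] H →ₐ[k] H) (h₁ : ∀ h, χ (Q.comul h) = h)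
    (h₂ : ∀ h, χ (Q.revS (Q.comul h)) = (Q.S h).unop) (h₃ : χ Q.gamma = Q.α) :
    χ Q.twistUnit.val = 1 := by
  refine Q.eq_of_mul_α_eq (AlgHom.id k H) (fun x => (Q.S x).unop) (fun x => ?_)
    (fun x => by simp) ?_
  · have h := congrArg χ (Q.twistUnit_mul_comul_S x)
    rwa [map_mul, map_mul, h₁, h₂] at h
  · have h := congrArg χ Q.twistUnit_mul_comul_α
    rw [map_mul, h₁, h₃] at h
    simpa using h

theorem counitHead_twistUnit (hα : Q.counit Q.α = 1) :
    counitHead H Q.counit Q.twistUnit.val = 1 := by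
  refine Q.map_twistUnit_eq_one _ Q.counit_left (fun h => ?_) ?_
  · have e : ∀ z, counitHead H Q.counit (Q.revS z) = (Q.S (counitTail H Q.counit z)).unop :=
      fun z => by
      induction z with
      | zero => simp
      | add a b ha hb => simp only [map_add, MulOpposite.unop_add, ha, hb]
      | tmul a b => simp [Q.counit_S hα]
    rw [e, Q.counit_right]
  -- Killing the first tensor factor of `γ` puts unit objects on `A²` and `A³`. Both cells of `A`
  -- then have a unit in the middle slot, and only `α` is left.
  · have e : (counitHead H Q.counit).toLinearMap.comp Q.gammaMap = (antiLeft Q.S Q.α).comp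
        (lift2 includeLeft (lift2 (Q.unit (H ⊗[k] H)) (lift2 (Q.unit _) includeRight)) :
          _ →ₐ[k] H ⊗[k] H).toLinearMap := by
      ext a b c d
      simp [gammaMap_tmul, Q.counit_S hα, hα, unitHom_apply, mul_smul]
      rw [smul_comm]
    refine (LinearMap.congr_fun e Q.elemA).trans ?_
    rw [LinearMap.comp_apply, AlgHom.toLinearMap_apply, lift_elemA, Q.assoc_unit_mid,
      cell_congr Q.Φ (Q.tens_unit _) rfl rfl, Q.assoc_unit_mid]
    simp [one_def]

theorem counitTail_twistUnit (hα : Q.counit Q.α = 1) :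
    counitTail H Q.counit Q.twistUnit.val = 1 := by
  refine Q.map_twistUnit_eq_one _ Q.counit_right (fun h => ?_) ?_
  · have e : ∀ z, counitTail H Q.counit (Q.revS z) = (Q.S (counitHead H Q.counit z)).unop :=
      fun z => by
      induction z with
      | zero => simp
      | add a b ha hb => simp only [map_add, MulOpposite.unop_add, ha, hb]
      | tmul a b => simp [Q.counit_S hα]
    rw [e, Q.counit_left]
  -- Here the units stand on `A¹` and `A⁴`, that is, in the first slot of one cell and in the last
  -- slot of the other.
  · have e : (counitTail H Q.counit).toLinearMap.comp Q.gammaMap = (antiLeft Q.S Q.α).comp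
        (lift2 (Q.unit (H ⊗[k] H)) (lift2 includeLeft (lift2 includeRight (Q.unit _))) :
          _ →ₐ[k] H ⊗[k] H).toLinearMap := by
      ext a b c d
      simp [gammaMap_tmul, Q.counit_S hα, hα, unitHom_apply, mul_smul]
      rw [smul_comm]
    refine (LinearMap.congr_fun e Q.elemA).trans ?_
    rw [LinearMap.comp_apply, AlgHom.toLinearMap_apply, lift_elemA, Q.assoc_unit_first,
      Q.assoc_unit_last]
    simp [one_def]

/-! ### The twisted pentagon identity -/

/-- The twist on two objects. -/
def tw (u v : H →ₐ[k] C) [CommHom u v] : Cˣ :=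
  Units.map (lift2 u v : H ⊗[k] H →* C) Q.twistUnit

theorem tw_val (u v : H →ₐ[k] C) [CommHom u v] :
    (Q.tw u v).val = lift2 u v Q.twistUnit.val := rfl

/-- `x ⊗ y ⊗ z ↦ S(z) ⊗ S(y) ⊗ S(x)`. -/
def revS₃ : H ⊗[k] (H ⊗[k] H) →ₗ[k] H ⊗[k] (H ⊗[k] H) :=
  (TensorProduct.assoc k H H H).toLinearMap.comp ((TensorProduct.map Q.revS (antiLin Q.S)).comp
    (TensorProduct.comm k H (H ⊗[k] H)).toLinearMap)

@[simp] theorem revS₃_tmul (x y z : H) : Q.revS₃ (x ⊗ₜ (y ⊗ₜ z))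
    = (Q.S z).unop ⊗ₜ ((Q.S y).unop ⊗ₜ (Q.S x).unop) := by
  simp [revS₃]

theorem revS₃_mul (x y : H ⊗[k] (H ⊗[k] H)) : Q.revS₃ (x * y) = Q.revS₃ y * Q.revS₃ x := by
  induction x with
  | zero => simp
  | add a b ha hb => rw [add_mul, map_add, map_add, mul_add, ha, hb]
  | tmul a s =>
    induction s with
    | zero => simp
    | add a b ha hb => rw [TensorProduct.tmul_add, add_mul, map_add, map_add, mul_add, ha, hb]
    | tmul b c =>
      induction y with
      | zero => simp
      | add p q hp hq => rw [mul_add, map_add, map_add, add_mul, hp, hq]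
      | tmul a s =>
        induction s with
        | zero => simp
        | add a b ha hb => rw [TensorProduct.tmul_add, mul_add, map_add, map_add, add_mul, ha, hb]
        | tmul b c => simp

theorem revS₃_one : Q.revS₃ 1 = 1 := by simp [one_def]

/-- The image of an invertible element under `revS₃`. -/
def revUnit (Φ : (H ⊗[k] (H ⊗[k] H))ˣ) : (H ⊗[k] (H ⊗[k] H))ˣ where
  val := Q.revS₃ Φ.val
  inv := Q.revS₃ Φ⁻¹.val
  val_inv := by rw [← revS₃_mul, Units.inv_mul, revS₃_one]
  inv_val := by rw [← revS₃_mul, Units.mul_inv, revS₃_one]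

section ThreeObjects

variable (u v w : H →ₐ[k] C) [CommHom u v] [CommHom u w] [CommHom v w]

theorem tw_mul_tens_S (h : H) :
    (Q.tw u v).val * (u ⋄ v) (Q.S h).unop
      = lift2 u v (Q.revS (Q.comul h)) * (Q.tw u v).val := by
  rw [tw_val, ten_apply, ← map_mul, twistUnit_mul_comul_S, map_mul]

/-- The antipode reverses the legs, so the tensor product `u ⋄ v` in first position comultiplies the
last leg of `z`. -/
theorem tw_mul_lift2_tens_left (z : H ⊗[k] H) :
    (Q.tw u v).val * lift2 (u ⋄ v) w (Q.revS z)
      = lift2 u (lift2 v w) (Q.revS₃ (onTail H Q.comul z)) * (Q.tw u v).val := by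
  induction z with
  | zero => simp
  | add a b ha hb => simp only [map_add, mul_add, add_mul, ha, hb]
  | tmul a b =>
    have e : ∀ s, lift2 u (lift2 v w) (Q.revS₃ (a ⊗ₜ s)) = lift2 u v (Q.revS s) * w (Q.S a).unop :=
      fun s => by
      induction s with
      | zero => simp
      | add p q hp hq => rw [TensorProduct.tmul_add, map_add, map_add, hp, hq, map_add, map_add,
          add_mul]
      | tmul p q => simp [mul_assoc]
    have c : Commute (Q.tw u v).val (w (Q.S a).unop) :=
      CommHom.comm (u := lift2 u v) (v := w) _ _
    rw [revS_tmul, lift2_tmul, ← mul_assoc, tw_mul_tens_S, onTail_tmul, e, mul_assoc, mul_assoc,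
      c.eq]

theorem tw_mul_lift2_tens_right (z : H ⊗[k] H) :
    (Q.tw v w).val * lift2 u (v ⋄ w) (Q.revS z)
      = lift2 u (lift2 v w) (Q.revS₃ (onHead H Q.comul z)) * (Q.tw v w).val := by
  induction z with
  | zero => simp
  | add a b ha hb => simp only [map_add, mul_add, add_mul, ha, hb]
  | tmul a b =>
    have e : ∀ s, lift2 u (lift2 v w) (Q.revS₃ (Algebra.TensorProduct.assoc k k k H H H (s ⊗ₜ b)))
        = u (Q.S b).unop * lift2 v w (Q.revS s) := fun s => by
      induction s with
      | zero => simp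
      | add p q hp hq => rw [TensorProduct.add_tmul, map_add, map_add, map_add, hp, hq, map_add,
          map_add, mul_add]
      | tmul p q => simp
    have c : Commute (u (Q.S b).unop) (Q.tw v w).val :=
      CommHom.comm (u := u) (v := lift2 v w) _ _
    rw [revS_tmul, lift2_tmul, ← mul_assoc, ← c.eq, mul_assoc, tw_mul_tens_S, onHead_tmul, e,
      mul_assoc]

/-- `(b ⊗ c) ⊗ (a ⊗ d) ⊗ (a' ⊗ d') ↦ u(S(b) α c) v(S(a) α d) w(S(a') α d')`. -/
def evalMap₃ : (H ⊗[k] H) ⊗[k] ((H ⊗[k] H) ⊗[k] (H ⊗[k] H)) →ₗ[k] C :=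
  (lift2 u (lift2 v w)).toLinearMap.comp (TensorProduct.map (antiLeft Q.S Q.α) Q.evalMap)

theorem labs_evalMap₃ : LAbs (Q.evalMap₃ u v w)
    ((includeLeft.comp includeLeft) ⋄ (includeLeft.comp includeRight)) (Q.unit _) := fun x t => by
  have := Q.labs_antiLeft.map_left Q.evalMap
  rw [comp_ten, comp_unitHom] at this
  exact congrArg (lift2 u (lift2 v w)) (this x t)

theorem antiLeft_mul_mul (t : H ⊗[k] H) (x y : H) :
    antiLeft Q.S Q.α (t * x ⊗ₜ y) = (Q.S x).unop * antiLeft Q.S Q.α t * y := by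
  induction t with
  | zero => simp
  | add a b ha hb => rw [add_mul, map_add, map_add, ha, hb, mul_add, add_mul]
  | tmul a b => simp [mul_assoc]

theorem evalMap₃_tmul (r s t : H ⊗[k] H) : Q.evalMap₃ u v w (r ⊗ₜ (s ⊗ₜ t))
    = u (antiLeft Q.S Q.α r) * (v (antiLeft Q.S Q.α s) * w (antiLeft Q.S Q.α t)) := rfl

/-- Multiplication from the right reaches the legs outside `S`, in the order `u, v, w`. In the
counterpart `lift_revS₃_mul_evalMap₃`, multiplication from the left reaches the legs under `S`, in
the opposite order. -/
theorem evalMap₃_mul_lift (t : (H ⊗[k] H) ⊗[k] ((H ⊗[k] H) ⊗[k] (H ⊗[k] H)))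
    (x : H ⊗[k] (H ⊗[k] H)) :
    Q.evalMap₃ u v w t * lift2 u (lift2 v w) x = Q.evalMap₃ u v w (t *
      lift2 (includeLeft.comp includeRight) (lift2 (includeRight.comp (includeLeft.comp includeRight))
        (includeRight.comp (includeRight.comp includeRight))) x) := by
  induction t with
  | zero => simp
  | add a b ha hb => rw [map_add, add_mul, add_mul, map_add, ha, hb]
  | tmul r s =>
    induction s with
    | zero => simp
    | add a b ha hb => rw [TensorProduct.tmul_add, map_add, add_mul, add_mul, map_add, ha, hb]
    | tmul s t =>
      induction x with
      | zero => simp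
      | add a b ha hb => simp only [map_add, mul_add, ha, hb]
      | tmul a x =>
        induction x with
        | zero => simp
        | add a b ha hb => simp only [TensorProduct.tmul_add, map_add, mul_add, ha, hb]
        | tmul b c =>
          have c₁ := (CommHom.comm (u := u) (v := lift2 v w) a
            (antiLeft Q.S Q.α s ⊗ₜ antiLeft Q.S Q.α t)).eq
          have c₂ := (CommHom.comm (u := v) (v := w) b (antiLeft Q.S Q.α t)).eq
          have e : (lift2 (includeLeft.comp includeRight)
            (lift2 (includeRight.comp (includeLeft.comp includeRight))
              (includeRight.comp (includeRight.comp includeRight))) (a ⊗ₜ (b ⊗ₜ c)) :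
              (H ⊗[k] H) ⊗[k] ((H ⊗[k] H) ⊗[k] (H ⊗[k] H)))
              = ((1 : H) ⊗ₜ a) ⊗ₜ (((1 : H) ⊗ₜ b) ⊗ₜ ((1 : H) ⊗ₜ c)) := by simp [one_def]
          rw [e, tmul_mul_tmul, tmul_mul_tmul, evalMap₃_tmul, evalMap₃_tmul, antiLeft_mul_mul,
            antiLeft_mul_mul, antiLeft_mul_mul, lift2_tmul, lift2_tmul]
          simp only [map_one, MulOpposite.unop_one, one_mul, map_mul]
          rw [lift2_tmul] at c₁
          calc _ = u (antiLeft Q.S Q.α r) * ((v (antiLeft Q.S Q.α s) * w (antiLeft Q.S Q.α t))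
                * u a) * (v b * w c) := by simp only [mul_assoc]
            _ = u (antiLeft Q.S Q.α r) * u a * (v (antiLeft Q.S Q.α s) *
                (w (antiLeft Q.S Q.α t) * v b) * w c) := by rw [← c₁]; simp only [mul_assoc]
            _ = _ := by rw [← c₂]; simp only [mul_assoc]

theorem lift_revS₃_mul_evalMap₃ (t : (H ⊗[k] H) ⊗[k] ((H ⊗[k] H) ⊗[k] (H ⊗[k] H)))
    (x : H ⊗[k] (H ⊗[k] H)) :
    lift2 u (lift2 v w) (Q.revS₃ x) * Q.evalMap₃ u v w t = Q.evalMap₃ u v w (t *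
      lift2 (includeRight.comp (includeRight.comp includeLeft))
        (lift2 (includeRight.comp (includeLeft.comp includeLeft))
          (includeLeft.comp includeLeft)) x) := by
  induction t with
  | zero => simp
  | add a b ha hb => rw [map_add, mul_add, add_mul, map_add, ha, hb]
  | tmul r s =>
    induction s with
    | zero => simp
    | add a b ha hb => rw [TensorProduct.tmul_add, map_add, mul_add, add_mul, map_add, ha, hb]
    | tmul s t =>
      induction x with
      | zero => simp
      | add a b ha hb => simp only [map_add, mul_add, add_mul, ha, hb]
      | tmul a x =>
        induction x with
        | zero => simp
        | add a b ha hb => simp only [TensorProduct.tmul_add, map_add, mul_add, add_mul, ha, hb]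
        | tmul b c =>
          have c₁ := (CommHom.comm (u := u) (v := lift2 v w) (antiLeft Q.S Q.α r)
            ((Q.S b).unop ⊗ₜ (Q.S a).unop)).eq
          have c₂ := (CommHom.comm (u := v) (v := w) (antiLeft Q.S Q.α s) (Q.S a).unop).eq
          have e : (lift2 (includeRight.comp (includeRight.comp includeLeft))
              (lift2 (includeRight.comp (includeLeft.comp includeLeft))
              (includeLeft.comp includeLeft)) (a ⊗ₜ (b ⊗ₜ c)) :
              (H ⊗[k] H) ⊗[k] ((H ⊗[k] H) ⊗[k] (H ⊗[k] H)))
              = (c ⊗ₜ (1 : H)) ⊗ₜ ((b ⊗ₜ (1 : H)) ⊗ₜ (a ⊗ₜ (1 : H))) := by simp [one_def]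
          rw [e, tmul_mul_tmul, tmul_mul_tmul, evalMap₃_tmul, evalMap₃_tmul, antiLeft_mul_mul,
            antiLeft_mul_mul, antiLeft_mul_mul, revS₃_tmul, lift2_tmul, lift2_tmul]
          simp only [mul_one, map_mul]
          rw [lift2_tmul] at c₁
          calc _ = u (Q.S c).unop * ((v (Q.S b).unop * w (Q.S a).unop) * u (antiLeft Q.S Q.α r))
                * (v (antiLeft Q.S Q.α s) * w (antiLeft Q.S Q.α t)) := by simp only [mul_assoc]
            _ = u (Q.S c).unop * u (antiLeft Q.S Q.α r) * (v (Q.S b).unop *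
                (w (Q.S a).unop * v (antiLeft Q.S Q.α s)) * w (antiLeft Q.S Q.α t)) := by
              rw [← c₁]; simp only [mul_assoc]
            _ = _ := by rw [← c₂]; simp only [mul_assoc]

end ThreeObjects

end QuasiHopf

end

end QuasiHopfTheory

/-! ### Nested evaluations on six legs, and the identity that makes the twist compatible with `Φ`.
-/

namespace QuasiHopfTheory

noncomputable section

namespace QuasiHopf

open Algebra.TensorProduct

variable {k H C : Type*} [Field k] [Ring H] [Algebra k H] [Ring C] [Algebra k C]
  (Q : QuasiHopf k H)

local infixr:75 "⋄" => ten (QuasiBialgebra.comul (QuasiHopf.toQuasiBialgebra Q))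
local notation:max "⦅" u "," v "," w "⦆" =>
  cell (QuasiBialgebra.Φ (QuasiHopf.toQuasiBialgebra Q)) u v w

/-- `A = (Φ ⊗ 1)(Δ ⊗ id ⊗ id)(Φ⁻¹)`, with the legs arranged as in `evalMap`. -/
def gammaUnit : ((H ⊗[k] H) ⊗[k] (H ⊗[k] H))ˣ :=
  ⦅incl₃, incl₁, incl₂⦆ * ⦅incl₃ ⋄ incl₁, incl₂, incl₄⦆⁻¹

theorem gamma_eq_evalMap : Q.gamma = Q.evalMap Q.gammaUnit.val := Q.gamma_eq

/-- `h ⊗ g ↦ h₁ ⊗ g₂ ⊗ h₂ ⊗ g₁`, up to the arrangement of the legs. -/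
abbrev comulLegs : H ⊗[k] H →ₐ[k] (H ⊗[k] H) ⊗[k] (H ⊗[k] H) :=
  lift2 (incl₃ ⋄ incl₁) (incl₂ ⋄ incl₄)

/-- The six inclusions `H → (H ⊗ H) ⊗ ((H ⊗ H) ⊗ (H ⊗ H))`. -/
abbrev nest₁ : H →ₐ[k] (H ⊗[k] H) ⊗[k] ((H ⊗[k] H) ⊗[k] (H ⊗[k] H)) :=
  includeRight.comp (includeRight.comp includeLeft)
abbrev nest₂ : H →ₐ[k] (H ⊗[k] H) ⊗[k] ((H ⊗[k] H) ⊗[k] (H ⊗[k] H)) :=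
  includeRight.comp (includeLeft.comp includeLeft)
abbrev nest₃ : H →ₐ[k] (H ⊗[k] H) ⊗[k] ((H ⊗[k] H) ⊗[k] (H ⊗[k] H)) :=
  includeLeft.comp includeLeft
abbrev nest₄ : H →ₐ[k] (H ⊗[k] H) ⊗[k] ((H ⊗[k] H) ⊗[k] (H ⊗[k] H)) :=
  includeLeft.comp includeRight
abbrev nest₅ : H →ₐ[k] (H ⊗[k] H) ⊗[k] ((H ⊗[k] H) ⊗[k] (H ⊗[k] H)) :=
  includeRight.comp (includeLeft.comp includeRight)
abbrev nest₆ : H →ₐ[k] (H ⊗[k] H) ⊗[k] ((H ⊗[k] H) ⊗[k] (H ⊗[k] H)) :=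
  includeRight.comp (includeRight.comp includeRight)

section ThreeObjects

variable (u v w : H →ₐ[k] C) [CommHom u v] [CommHom u w] [CommHom v w]

theorem tw_mul_tens (a d : H) : (Q.tw u v).val * (u ⋄ v) ((Q.S a).unop * Q.α * d)
    = lift2 u v (Q.evalMap (Q.gammaUnit.val * Q.comulLegs (a ⊗ₜ d))) := by
  rw [tw_val, ten_apply, ← map_mul, twistUnit_mul_comul, gamma_mul_comul]; rfl

/-- The twist opens the outer evaluation into two, with a new copy of `A` in front. In
`tw_mul_evalMap_left` it is the inner evaluation that is opened. -/
theorem tw_mul_evalMap_right (t : (H ⊗[k] H) ⊗[k] (H ⊗[k] H)) :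
    (Q.tw v w).val * lift2 u (v ⋄ w) (Q.evalMap t)
      = Q.evalMap₃ u v w ((1 : H ⊗[k] H) ⊗ₜ Q.gammaUnit.val * onTail (H ⊗[k] H) Q.comulLegs t) := by
  induction t with
  | zero => simp
  | add a b ha hb => simp only [map_add, mul_add, ha, hb]
  | tmul r s =>
    induction s with
    | zero => simp
    | add a b ha hb => simp only [TensorProduct.tmul_add, map_add, mul_add, ha, hb]
    | tmul a d =>
      have c : Commute (u (antiLeft Q.S Q.α r)) (Q.tw v w).val :=
        CommHom.comm (u := u) (v := lift2 v w) _ _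
      have e : lift2 u (v ⋄ w) (Q.evalMap (r ⊗ₜ (a ⊗ₜ d)))
          = u (antiLeft Q.S Q.α r) * (v ⋄ w) ((Q.S a).unop * Q.α * d) := by
        simp [evalMap]
      rw [e, ← mul_assoc, ← c.eq, mul_assoc, tw_mul_tens, onTail_tmul, tmul_mul_tmul, one_mul]
      rfl

theorem tw_mul_evalMap_left (t : (H ⊗[k] H) ⊗[k] (H ⊗[k] H)) :
    (Q.tw u v).val * lift2 (u ⋄ v) w (Q.evalMap t)
      = Q.evalMap₃ u v w (onTail (H ⊗[k] H) includeLeft Q.gammaUnit.val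
          * onHead (H ⊗[k] H) Q.comulLegs t) := by
  induction t with
  | zero => simp
  | add a b ha hb => simp only [map_add, mul_add, ha, hb]
  | tmul s r =>
    induction s with
    | zero => simp
    | add a b ha hb => simp only [TensorProduct.add_tmul, map_add, mul_add, ha, hb]
    | tmul a d =>
      have e : lift2 (u ⋄ v) w (Q.evalMap ((a ⊗ₜ d) ⊗ₜ r))
          = (u ⋄ v) ((Q.S a).unop * Q.α * d) * w (antiLeft Q.S Q.α r) := by
        simp [evalMap]
      have key : ∀ s t : (H ⊗[k] H) ⊗[k] (H ⊗[k] H), Q.evalMap₃ u v w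
          (onTail (H ⊗[k] H) includeLeft s
            * Algebra.TensorProduct.assoc k k k (H ⊗[k] H) (H ⊗[k] H) (H ⊗[k] H) (t ⊗ₜ r))
          = lift2 u v (Q.evalMap (s * t)) * w (antiLeft Q.S Q.α r) := fun s t => by
        induction s with
        | zero => simp
        | add a b ha hb => simp only [map_add, add_mul, ha, hb]
        | tmul s₁ s₂ =>
          induction t with
          | zero => simp
          | add a b ha hb => simp only [TensorProduct.add_tmul, map_add, mul_add, add_mul, ha, hb]
          | tmul t₁ t₂ =>
            simp [evalMap, evalMap₃_tmul, mul_assoc]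
      rw [e, ← mul_assoc, tw_mul_tens, onHead_tmul, key]

theorem onTail_comulLegs_incl₁ : (onTail (H ⊗[k] H) Q.comulLegs).comp incl₁ = nest₃ := by
  ext; simp

theorem onTail_comulLegs_incl₂ : (onTail (H ⊗[k] H) Q.comulLegs).comp incl₂ = nest₄ := by
  ext; simp

theorem onTail_comulLegs_incl₃ :
    (onTail (H ⊗[k] H) Q.comulLegs).comp incl₃ = nest₁ ⋄ nest₂ := by
  have e : (onTail (H ⊗[k] H) Q.comulLegs).comp incl₃ = includeRight.comp (incl₃ ⋄ incl₁) := by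
    ext; simp
  rw [e, comp_ten]

theorem onTail_comulLegs_incl₄ :
    (onTail (H ⊗[k] H) Q.comulLegs).comp incl₄ = nest₅ ⋄ nest₆ := by
  have e : (onTail (H ⊗[k] H) Q.comulLegs).comp incl₄ = includeRight.comp (incl₂ ⋄ incl₄) := by
    ext; simp
  rw [e, comp_ten]

theorem assoc_tmul_one {X Y Z : Type*} [Ring X] [Algebra k X] [Ring Y] [Algebra k Y] [Ring Z]
    [Algebra k Z] (t : X ⊗[k] Y) :
    Algebra.TensorProduct.assoc k k k X Y Z (t ⊗ₜ 1) = onTail X includeLeft t := by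
  induction t with
  | zero => simp
  | add a b ha hb => rw [TensorProduct.add_tmul, map_add, map_add, ha, hb]
  | tmul a b => simp

theorem onHead_comulLegs_incl₁ :
    (onHead (H ⊗[k] H) Q.comulLegs).comp incl₁ = nest₂ ⋄ nest₃ := by
  have e : (onHead (H ⊗[k] H) Q.comulLegs).comp incl₁
      = (onTail (H ⊗[k] H) includeLeft).comp (incl₃ ⋄ incl₁) := by
    ext; simp [onHead_tmul, assoc_tmul_one]
  rw [e]
  exact comp_ten_of_eq (by ext; simp) (by ext; simp [one_def])

theorem onHead_comulLegs_incl₂ :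
    (onHead (H ⊗[k] H) Q.comulLegs).comp incl₂ = nest₄ ⋄ nest₅ := by
  have e : (onHead (H ⊗[k] H) Q.comulLegs).comp incl₂
      = (onTail (H ⊗[k] H) includeLeft).comp (incl₂ ⋄ incl₄) := by
    ext; simp [onHead_tmul, assoc_tmul_one]
  rw [e]
  exact comp_ten_of_eq (by ext; simp [one_def]) (by ext; simp)

theorem onHead_comulLegs_incl₃ : (onHead (H ⊗[k] H) Q.comulLegs).comp incl₃ = nest₁ := by
  ext; simp [onHead_tmul, one_def]

theorem onHead_comulLegs_incl₄ : (onHead (H ⊗[k] H) Q.comulLegs).comp incl₄ = nest₆ := by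
  ext; simp [onHead_tmul, one_def]

/-- `(1 ⊗ f)(id ⊗ Δ)(f) Φ = (S ⊗ S ⊗ S)(X³ ⊗ X² ⊗ X¹) (f ⊗ 1)(Δ ⊗ id)(f)`. -/
theorem tw_pentagon : Q.tw v w * Q.tw u (v ⋄ w) * ⦅u, v, w⦆
    = cell (Q.revUnit Q.Φ) u v w * Q.tw u v * Q.tw (u ⋄ v) w := by
  apply Units.ext
  have hΦ := Q.assoc_intw u v w
  -- Both sides intertwine the threefold tensor product composed with `S` with the reversed iterated
  -- coproduct. They are therefore equal as soon as they agree after multiplication by the image of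
  -- `α`.
  refine Q.eq_of_mul_α_eq ((u ⋄ v) ⋄ w)
    (fun h => lift2 u (lift2 v w) (Q.revS₃ (onHead H Q.comul (Q.comul h)))) (fun h => ?_)
    (fun h => ?_) ?_
  · rw [Units.val_mul, Units.val_mul, mul_assoc, hΦ, ← mul_assoc, mul_assoc (Q.tw v w).val,
      tw_mul_tens_S, ← mul_assoc, tw_mul_lift2_tens_right]
    simp only [mul_assoc]
  · have e : Q.revS₃ Q.Φ.val * Q.revS₃ (onTail H Q.comul (Q.comul h))
        = Q.revS₃ (onHead H Q.comul (Q.comul h)) * Q.revS₃ Q.Φ.val := by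
      rw [← revS₃_mul, ← revS₃_mul, Q.quasi_coassoc, mul_assoc, Units.inv_mul, mul_one]
    rw [Units.val_mul, Units.val_mul, mul_assoc, tw_mul_tens_S, ← mul_assoc,
      mul_assoc (cell _ _ _ _).val, tw_mul_lift2_tens_left, ← mul_assoc]
    have e' := congrArg (lift2 u (lift2 v w)) e
    rw [map_mul, map_mul] at e'
    simp only [← mul_assoc]
    exact congrArg (fun x => x * (Q.tw u v).val * (Q.tw (u ⋄ v) w).val) e'
  -- Multiplied by `α`, the innermost twist becomes `γ` and the next one opens an evaluation of it.
  -- Both sides are then evaluations with `3 4` contracted for `u`, `2 5` for `v` and `1 6` for `w`,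
  -- as in `nested_contraction`.
  · have hα : ∀ (x y : H →ₐ[k] C) [CommHom x y],
        (Q.tw x y).val * (x ⋄ y) Q.α = lift2 x y (Q.evalMap Q.gammaUnit.val) := fun x y _ => by
      rw [tw_val, ten_apply, ← map_mul, twistUnit_mul_comul_α, gamma_eq_evalMap]
    have h₃₄ := Q.labs_evalMap₃ u v w
    have nc := QuasiBialgebra.nested_contraction (u₁ := nest₁) (u₂ := nest₂) (u₃ := nest₃)
      (u₄ := nest₄) (u₅ := nest₅) (u₆ := nest₆) Q.toQuasiBialgebra h₃₄
    have m₁ : (1 : H ⊗[k] H) ⊗ₜ Q.gammaUnit.val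
        = (⦅nest₁, nest₂, nest₅⦆ * ⦅nest₁ ⋄ nest₂, nest₅, nest₆⦆⁻¹ : (_ ⊗[k] _)ˣ).val :=
      Q.map_assoc_mul_inv (f := (includeRight : (H ⊗[k] H) ⊗[k] (H ⊗[k] H) →ₐ[k]
        (H ⊗[k] H) ⊗[k] ((H ⊗[k] H) ⊗[k] (H ⊗[k] H)))) (a := incl₃) (b := incl₁) (c := incl₂)
        (d := incl₄) (a' := nest₁) (b' := nest₂) (c' := nest₅) (d' := nest₆) rfl rfl rfl rfl
    have m₂ : onTail (H ⊗[k] H) Q.comulLegs Q.gammaUnit.val = (⦅nest₁ ⋄ nest₂, nest₃, nest₄⦆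
        * ⦅(nest₁ ⋄ nest₂) ⋄ nest₃, nest₄, nest₅ ⋄ nest₆⦆⁻¹ : (_ ⊗[k] _)ˣ).val :=
      Q.map_assoc_mul_inv Q.onTail_comulLegs_incl₃ Q.onTail_comulLegs_incl₁
        Q.onTail_comulLegs_incl₂ Q.onTail_comulLegs_incl₄
    have m₃ : onTail (H ⊗[k] H) includeLeft Q.gammaUnit.val
        = (⦅nest₂, nest₃, nest₄⦆ * ⦅nest₂ ⋄ nest₃, nest₄, nest₅⦆⁻¹ : (_ ⊗[k] _)ˣ).val :=
      Q.map_assoc_mul_inv (by ext; simp) (by ext; simp [one_def]) (by ext; simp [one_def])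
        (by ext; simp)
    have m₄ : onHead (H ⊗[k] H) Q.comulLegs Q.gammaUnit.val = (⦅nest₁, nest₂ ⋄ nest₃, nest₄ ⋄ nest₅⦆
        * ⦅nest₁ ⋄ nest₂ ⋄ nest₃, nest₄ ⋄ nest₅, nest₆⦆⁻¹ : (_ ⊗[k] _)ˣ).val :=
      Q.map_assoc_mul_inv Q.onHead_comulLegs_incl₃ Q.onHead_comulLegs_incl₁
        Q.onHead_comulLegs_incl₂ Q.onHead_comulLegs_incl₄
    have l : (Q.tw v w * Q.tw u (v ⋄ w) * ⦅u, v, w⦆ : Cˣ).val * ((u ⋄ v) ⋄ w) Q.α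
        = Q.evalMap₃ u v w ((1 : H ⊗[k] H) ⊗ₜ Q.gammaUnit.val
          * onTail (H ⊗[k] H) Q.comulLegs Q.gammaUnit.val * ⦅nest₄, nest₅, nest₆⦆.val) := by
      rw [Units.val_mul, Units.val_mul, mul_assoc, hΦ, ← mul_assoc, mul_assoc (Q.tw v w).val, hα,
        tw_mul_evalMap_right, cell_val, evalMap₃_mul_lift]; rfl
    have r : (cell (Q.revUnit Q.Φ) u v w * Q.tw u v * Q.tw (u ⋄ v) w : Cˣ).val * ((u ⋄ v) ⋄ w) Q.α
        = Q.evalMap₃ u v w (onTail (H ⊗[k] H) includeLeft Q.gammaUnit.val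
          * onHead (H ⊗[k] H) Q.comulLegs Q.gammaUnit.val * ⦅nest₁, nest₂, nest₃⦆.val) := by
      rw [Units.val_mul, Units.val_mul, mul_assoc, hα, mul_assoc, tw_mul_evalMap_left]
      exact Q.lift_revS₃_mul_evalMap₃ u v w _ _
    rw [l, r, m₁, m₂, m₃, m₄]
    simpa only [Units.val_mul] using nc

end ThreeObjects

end QuasiHopf

end

end QuasiHopfTheory

namespace QuasiHopfTheory

noncomputable section

namespace QuasiHopf

open Algebra.TensorProduct

variable {k H A C E : Type*} [Field k] [Ring H] [Algebra k H] [Ring A] [Algebra k A]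
  [Ring C] [Algebra k C] [Ring E] [Algebra k E] (Q : QuasiHopf k H)

local infixr:75 "⋄" => ten (QuasiBialgebra.comul (QuasiHopf.toQuasiBialgebra Q))
local notation:max "⦅" u "," v "," w "⦆" =>
  cell (QuasiBialgebra.Φ (QuasiHopf.toQuasiBialgebra Q)) u v w

/-! ### Objects over `Hᵒᵖ ⊗ H` -/

/-- The quasi-bialgebra `Hᵒᵖ ⊗ H`. -/
abbrev env : QuasiBialgebra k (Hᵐᵒᵖ ⊗[k] H) := Q.toQuasiBialgebra.op.tensor Q.toQuasiBialgebra

/-- The part of an object over `Hᵒᵖ ⊗ H` that acts from the left: `h ↦ κ(S⁻¹(h) ⊗ 1)`. -/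
def lpart (κ : Hᵐᵒᵖ ⊗[k] H →ₐ[k] C) : H →ₐ[k] C := (κ.comp includeLeft).comp Q.Sinv

/-- The part of an object over `Hᵒᵖ ⊗ H` that acts from the right: `h ↦ κ(1 ⊗ h)`. -/
def rpart (κ : Hᵐᵒᵖ ⊗[k] H →ₐ[k] C) : H →ₐ[k] C := κ.comp includeRight

theorem lpart_apply (κ : Hᵐᵒᵖ ⊗[k] H →ₐ[k] C) (h : H) : Q.lpart κ h = κ (Q.Sinv h ⊗ₜ 1) := rfl

theorem rpart_apply (κ : Hᵐᵒᵖ ⊗[k] H →ₐ[k] C) (h : H) : rpart κ h = κ (1 ⊗ₜ h) := rfl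

theorem Sinv_S (h : H) : Q.Sinv (Q.S h).unop = MulOpposite.op h :=
  MulOpposite.unop_injective (by rw [unop_Sinv]; simp)

theorem lpart_S (κ : Hᵐᵒᵖ ⊗[k] H →ₐ[k] C) (h : H) :
    Q.lpart κ (Q.S h).unop = κ (MulOpposite.op h ⊗ₜ 1) := by rw [lpart_apply, Sinv_S]

theorem comp_lpart (f : C →ₐ[k] E) (κ : Hᵐᵒᵖ ⊗[k] H →ₐ[k] C) :
    f.comp (Q.lpart κ) = Q.lpart (f.comp κ) := rfl

theorem comp_rpart (f : C →ₐ[k] E) (κ : Hᵐᵒᵖ ⊗[k] H →ₐ[k] C) :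
    f.comp (rpart κ) = rpart (f.comp κ) := rfl

instance commHom_lpart_rpart (κ : Hᵐᵒᵖ ⊗[k] H →ₐ[k] C) : CommHom (Q.lpart κ) (rpart κ) where
  comm x y := ((CommHom.includeLeft_includeRight (k := k)).comm (Q.Sinv x) y).map κ

instance commHom_lpart {X : Type*} [Ring X] [Algebra k X] (a : X →ₐ[k] C)
    (κ : Hᵐᵒᵖ ⊗[k] H →ₐ[k] C) [CommHom a κ] : CommHom (Q.lpart κ) a where
  comm _ y := (CommHom.comm (u := a) (v := κ) y _).symm

instance commHom_rpart {X : Type*} [Ring X] [Algebra k X] (a : X →ₐ[k] C)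
    (κ : Hᵐᵒᵖ ⊗[k] H →ₐ[k] C) [CommHom a κ] : CommHom a (rpart κ) where
  comm x _ := CommHom.comm (u := a) (v := κ) x _

section TwoObjects

variable (κ₁ κ₂ κ₃ : Hᵐᵒᵖ ⊗[k] H →ₐ[k] C) [CommHom κ₁ κ₂] [CommHom κ₁ κ₃] [CommHom κ₂ κ₃]

instance commHom_rpart_rpart : CommHom (rpart κ₁) (rpart κ₂) where
  comm _ _ := CommHom.comm (u := κ₁) (v := κ₂) _ _

instance commHom_lpart_lpart : CommHom (Q.lpart κ₂) (Q.lpart κ₁) where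
  comm _ _ := (CommHom.comm (u := κ₁) (v := κ₂) _ _).symm

instance commHom_lpart_rpart_of : CommHom (Q.lpart κ₁) (rpart κ₂) where
  comm _ _ := CommHom.comm (u := κ₁) (v := κ₂) _ _

instance commHom_lpart_rpart_of' : CommHom (Q.lpart κ₂) (rpart κ₁) where
  comm _ _ := (CommHom.comm (u := κ₁) (v := κ₂) _ _).symm

theorem lift2_shuffle₂_right (t : H ⊗[k] H) :
    lift2 κ₁ κ₂ (shuffle₂ k Hᵐᵒᵖ H (1 ⊗ₜ t)) = lift2 (rpart κ₁) (rpart κ₂) t := by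
  induction t with
  | zero => simp
  | add a b ha hb => rw [TensorProduct.tmul_add, map_add, map_add, ha, hb, map_add]
  | tmul a b => rw [one_def, shuffle₂_tmul]; rfl

/-- The element `h` of `Hᵒᵖ` is the value of the left part at `S(h)`. This is why `S` and the
reversal of the two objects appear. -/
theorem lift2_shuffle₂_left (t : H ⊗[k] H) :
    lift2 κ₁ κ₂ (shuffle₂ k Hᵐᵒᵖ H (op₂ k H t ⊗ₜ 1))
      = lift2 (Q.lpart κ₂) (Q.lpart κ₁) (Q.revS t) := by
  induction t with
  | zero => simp
  | add a b ha hb => simp only [TensorProduct.add_tmul, map_add, ha, hb]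
  | tmul a b =>
    rw [revS_tmul, lift2_tmul, lpart_S, lpart_S, ← (CommHom.comm (u := κ₁) (v := κ₂) _ _).eq,
      one_def]
    rfl

theorem rpart_ten : rpart (ten Q.env.comul κ₁ κ₂) = rpart κ₁ ⋄ rpart κ₂ := by
  ext h
  change lift2 κ₁ κ₂ (shuffle₂ k Hᵐᵒᵖ H (opComul Q.comul 1 ⊗ₜ Q.comul h)) = _
  rw [map_one, lift2_shuffle₂_right]; rfl

theorem lpart_ten_S (h : H) : Q.lpart (ten Q.env.comul κ₁ κ₂) (Q.S h).unop
    = lift2 (Q.lpart κ₂) (Q.lpart κ₁) (Q.revS (Q.comul h)) := by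
  rw [lpart_S, ← lift2_shuffle₂_left]
  change lift2 κ₁ κ₂ (shuffle₂ k Hᵐᵒᵖ H (op₂ k H (Q.comul h) ⊗ₜ Q.comul 1)) = _
  rw [map_one]

/-- The Drinfeld twist compares the left part of a tensor product with the tensor product of the
left parts. -/
theorem tw_intw : Intw (Q.tw (Q.lpart κ₂) (Q.lpart κ₁)) (Q.lpart κ₂ ⋄ Q.lpart κ₁)
    (Q.lpart (ten Q.env.comul κ₁ κ₂)) := fun h => by
  obtain ⟨g, rfl⟩ : ∃ g, (Q.S g).unop = h := ⟨Q.S.symm (MulOpposite.op h), by simp⟩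
  rw [tw_mul_tens_S, lpart_ten_S]

theorem lift3_shuffle₃_right (t : H ⊗[k] (H ⊗[k] H)) :
    lift2 κ₁ (lift2 κ₂ κ₃) (shuffle₃ k Hᵐᵒᵖ H (1 ⊗ₜ t))
      = lift2 (rpart κ₁) (lift2 (rpart κ₂) (rpart κ₃)) t := by
  induction t with
  | zero => simp
  | add a b ha hb => rw [TensorProduct.tmul_add, map_add, map_add, ha, hb, map_add]
  | tmul a t =>
    rw [one_def, shuffle₃, glue_tmul, lift2_tmul, lift2_shuffle₂_right, lift2_tmul, rpart_apply]

theorem lift3_shuffle₃_left (t : H ⊗[k] (H ⊗[k] H)) :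
    lift2 κ₁ (lift2 κ₂ κ₃) (shuffle₃ k Hᵐᵒᵖ H (op₃ k H t ⊗ₜ 1))
      = lift2 (Q.lpart κ₃) (lift2 (Q.lpart κ₂) (Q.lpart κ₁)) (Q.revS₃ t) := by
  induction t with
  | zero => simp
  | add a b ha hb => simp only [TensorProduct.add_tmul, map_add, ha, hb]
  | tmul a t =>
    have e : lift2 κ₁ (lift2 κ₂ κ₃) (shuffle₃ k Hᵐᵒᵖ H (op₃ k H (a ⊗ₜ t) ⊗ₜ 1))
        = κ₁ (MulOpposite.op a ⊗ₜ 1)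
          * lift2 κ₂ κ₃ (shuffle₂ k Hᵐᵒᵖ H (op₂ k H t ⊗ₜ 1)) := by
      rw [one_def, op₃, opGlue_tmul, shuffle₃, glue_tmul, lift2_tmul, op₂]
    have e' : lift2 (Q.lpart κ₃) (lift2 (Q.lpart κ₂) (Q.lpart κ₁)) (Q.revS₃ (a ⊗ₜ t))
        = lift2 (Q.lpart κ₃) (Q.lpart κ₂) (Q.revS t) * Q.lpart κ₁ (Q.S a).unop := by
      rw [← lift2_assoc]; rfl
    rw [e, e', lift2_shuffle₂_left, ← lpart_S]
    exact (CommHom.comm (u := lift2 (Q.lpart κ₃) (Q.lpart κ₂)) (v := Q.lpart κ₁) _ _).eq.symm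

/-- `Hᵒᵖ` has reassociator `Φ⁻¹`, which in terms of left parts is the inverse of `S(X³) ⊗ S(X²) ⊗
S(X¹)` on the objects in reverse order. This is the factor that also occurs in `tw_pentagon`. -/
theorem cell_env : cell Q.env.Φ κ₁ κ₂ κ₃
    = (cell (Q.revUnit Q.Φ) (Q.lpart κ₃) (Q.lpart κ₂) (Q.lpart κ₁))⁻¹
      * ⦅rpart κ₁, rpart κ₂, rpart κ₃⦆ := by
  apply Units.ext
  have e : Q.env.Φ.val = shuffle₃ k Hᵐᵒᵖ H (op₃ k H Q.Φ⁻¹.val ⊗ₜ 1)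
      * shuffle₃ k Hᵐᵒᵖ H (1 ⊗ₜ Q.Φ.val) := by
    rw [← map_mul, tmul_mul_tmul, mul_one, one_mul]; rfl
  rw [cell_val, e, map_mul, lift3_shuffle₃_left, lift3_shuffle₃_right]
  rfl

end TwoObjects

theorem lpart_unit (hα : Q.counit Q.α = 1) : Q.lpart (Q.env.unit C) = Q.unit C := by
  ext h
  obtain ⟨g, rfl⟩ : ∃ g, (Q.S g).unop = h := ⟨Q.S.symm (MulOpposite.op h), by simp⟩
  rw [lpart_S, unitHom_apply, unitHom_apply, Q.counit_S hα]
  change (opCounit Q.counit (MulOpposite.op g) * Q.counit 1) • (1 : C) = _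
  rw [map_one, mul_one, opCounit_op]

theorem rpart_unit : rpart (Q.env.unit C) = Q.unit C := by
  ext h
  rw [rpart_apply, unitHom_apply, unitHom_apply]
  change (opCounit Q.counit 1 * Q.counit h) • (1 : C) = _
  rw [map_one, one_mul]

theorem tw_unit_left (hα : Q.counit Q.α = 1) (v : H →ₐ[k] C) : Q.tw (Q.unit C) v = 1 :=
  Units.ext (by rw [tw_val, lift2_unit_left, AlgHom.comp_apply, Q.counitHead_twistUnit hα, map_one,
    Units.val_one])

theorem tw_unit_right (hα : Q.counit Q.α = 1) (u : H →ₐ[k] C) : Q.tw u (Q.unit C) = 1 :=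
  Units.ext (by rw [tw_val, lift2_unit_right, AlgHom.comp_apply, Q.counitTail_twistUnit hα, map_one,
    Units.val_one])

theorem map_tw (f : C →ₐ[k] E) (u v : H →ₐ[k] C) [CommHom u v] :
    Units.map (f : C →* E) (Q.tw u v) = Q.tw (f.comp u) (f.comp v) :=
  Units.ext (DFunLike.congr_fun (comp_lift2 f u v) _)

theorem Intw.tw {c : Cˣ} {u u' v v' : H →ₐ[k] C} [CommHom u v] [CommHom u' v']
    (hu : Intw c u u') (hv : Intw c v v') : c * Q.tw u v = Q.tw u' v' * c :=
  Units.ext (hu.lift2 hv _)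

theorem tw_intw_left {X : Type*} [Ring X] [Algebra k X] (u v : H →ₐ[k] C) [CommHom u v]
    (z : X →ₐ[k] C) [CommHom z u] [CommHom z v] : Intw (Q.tw u v) z z := fun p =>
  ((CommHom.comm (u := z) (v := lift2 u v) p _).eq).symm

theorem tw_intw_right {X : Type*} [Ring X] [Algebra k X] (u v : H →ₐ[k] C) [CommHom u v]
    (z : X →ₐ[k] C) [CommHom u z] [CommHom v z] : Intw (Q.tw u v) z z := fun p =>
  (CommHom.comm (u := lift2 u v) (v := z) _ p).eq

section Arrange

variable (a : A →ₐ[k] C) (κ : Hᵐᵒᵖ ⊗[k] H →ₐ[k] C) [CommHom a κ]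

/-- Permuting legs is invisible after lifting to commuting objects; only the passage through `S⁻¹`
to the left part remains. -/
theorem lift2_comp_arrange₃ :
    (lift2 a κ).comp Q.arrange₃ = lift2 (Q.lpart κ) (lift2 a (rpart κ)) := by
  refine AlgHom.ext fun t => ?_
  induction t with
  | zero => simp
  | add p q hp hq => rw [map_add, map_add, hp, hq]
  | tmul h t =>
    induction t with
    | zero => simp
    | add p q hp hq => rw [TensorProduct.tmul_add, map_add, map_add, hp, hq]
    | tmul b g =>
      rw [AlgHom.comp_apply, arrange₃_tmul, lift2_tmul, lift2_tmul, lift2_tmul, ← mul_assoc,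
        (CommHom.comm (u := Q.lpart κ) (v := a) h b).eq, mul_assoc, lpart_apply, rpart_apply,
        ← map_mul, tmul_mul_tmul, one_mul, mul_one]

variable (B : BicomoduleAlgebra Q.toQuasiBialgebra A)

theorem ten_rho₂ : ten (rho₂ Q B) a κ = ten B.lam (Q.lpart κ) (ten B.ρ a (rpart κ)) := by
  rw [ten, rho₂, ← AlgHom.comp_assoc, lift2_comp_arrange₃, ← AlgHom.comp_assoc, lift2_comp_onTail]
  rfl

end Arrange

end QuasiHopf

end

end QuasiHopfTheory

namespace QuasiHopfTheory

noncomputable section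

/-! ### Coherence in a bicomodule algebra -/

theorem RightComoduleAlgebra.rho_intw {k H A C : Type*} [Field k] [Ring H] [Algebra k H] [Ring A]
    [Algebra k A] [Ring C] [Algebra k C] {Q : QuasiBialgebra k H} (R : RightComoduleAlgebra Q A)
    (a : A →ₐ[k] C) (p q : H →ₐ[k] C) [CommHom a p] [CommHom a q] [CommHom p q] :
    Intw (cell R.Φρ a p q) (ten R.ρ (ten R.ρ a p) q) (ten R.ρ a (ten Q.comul p q)) :=
  cell_intw R.quasi_coassoc_ρ a p q

namespace BicomoduleAlgebra

variable {k H A C : Type*} [Field k] [Ring H] [Algebra k H] [Ring A] [Algebra k A]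
  [Ring C] [Algebra k C] {Q : QuasiBialgebra k H} (B : BicomoduleAlgebra Q A)

local infixr:75 "⋄" => ten (QuasiBialgebra.comul Q)
local infixr:75 "▷" => ten (LeftComoduleAlgebra.lam (BicomoduleAlgebra.toLeftComoduleAlgebra B))
local infixr:75 "◁" => ten (RightComoduleAlgebra.ρ (BicomoduleAlgebra.toRightComoduleAlgebra B))
local notation:max "⦅" u "," v "," w "⦆" => cell (QuasiBialgebra.Φ Q) u v w
local notation:max "λ⟦" u "," v "," w "⟧" =>
  cell (LeftComoduleAlgebra.Φlam (BicomoduleAlgebra.toLeftComoduleAlgebra B)) u v w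
local notation:max "ρ⟦" u "," v "," w "⟧" =>
  cell (RightComoduleAlgebra.Φρ (BicomoduleAlgebra.toRightComoduleAlgebra B)) u v w
local notation:max "μ⟦" u "," v "," w "⟧" => cell (BicomoduleAlgebra.Φlr B) u v w

section Basic

variable (x y : H →ₐ[k] C) (a : A →ₐ[k] C) (p q : H →ₐ[k] C)
  [CommHom x y] [CommHom x a] [CommHom x p] [CommHom x q] [CommHom y a] [CommHom y p] [CommHom y q]
  [CommHom a p] [CommHom a q] [CommHom p q]

theorem lam_intw : Intw λ⟦x, y, a⟧ ((x ⋄ y) ▷ a) (x ▷ y ▷ a) :=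
  cell_intw (fun b => (B.quasi_coassoc_lam b).symm) x y a

theorem lr_intw : Intw μ⟦x, a, p⟧ ((x ▷ a) ◁ p) (x ▷ a ◁ p) := cell_intw B.compat x a p

theorem unit_lam : Q.unit C ▷ a = a := ten_unit_left B.counit_lam a

theorem rho_unit : a ◁ Q.unit C = a := ten_unit_right B.counit_ρ a

theorem lam_unit_first : λ⟦Q.unit C, y, a⟧ = 1 := cell_unit_first B.counit_Φlam_first y a

theorem lam_unit_mid : λ⟦x, Q.unit C, a⟧ = 1 := cell_unit_mid B.counit_Φlam_mid x a

theorem rho_unit_mid : ρ⟦a, Q.unit C, q⟧ = 1 := cell_unit_mid B.counit_Φρ_mid a q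

theorem rho_unit_last : ρ⟦a, p, Q.unit C⟧ = 1 := cell_unit_last B.counit_Φρ_last a p

theorem lr_pentagon_lam : μ⟦y, a, p⟧ * μ⟦x, y ▷ a, p⟧ * λ⟦x, y, a⟧
    = λ⟦x, y, a ◁ p⟧ * μ⟦x ⋄ y, a, p⟧ := cell_pentagon B.pentagon_lr_lam x y a p

theorem lr_pentagon_rho : ρ⟦a, p, q⟧ * μ⟦x, a ◁ p, q⟧ * μ⟦x, a, p⟧
    = μ⟦x, a, p ⋄ q⟧ * ρ⟦x ▷ a, p, q⟧ := cell_pentagon B.pentagon_lr_ρ x a p q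

/-- The axioms contain no counit condition for `Φλρ`; the mixed pentagon with two unit objects makes
this cell idempotent. -/
theorem lr_unit_first : μ⟦Q.unit C, a, p⟧ = 1 := by
  have h := B.lr_pentagon_lam (Q.unit C) (Q.unit C) a p
  rw [lam_unit_mid, lam_unit_mid, cell_congr B.Φlr rfl (B.unit_lam a) rfl,
    cell_congr B.Φlr (Q.unit_tens (Q.unit C)) rfl rfl, mul_one, one_mul] at h
  exact mul_eq_left.mp h

theorem lr_unit_last : μ⟦x, a, Q.unit C⟧ = 1 := by
  have h := B.lr_pentagon_rho x a (Q.unit C) (Q.unit C)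
  rw [rho_unit_mid, rho_unit_mid, cell_congr B.Φlr rfl (B.rho_unit a) rfl,
    cell_congr B.Φlr rfl rfl (Q.unit_tens (Q.unit C)), mul_one, one_mul] at h
  exact mul_eq_left.mp h

end Basic

section Coherence

variable (x y z : H →ₐ[k] C) (a : A →ₐ[k] C) (p q r : H →ₐ[k] C)
  [CommHom x y] [CommHom x z] [CommHom x a] [CommHom x p] [CommHom x q] [CommHom x r]
  [CommHom y z] [CommHom y a] [CommHom y p] [CommHom y q] [CommHom y r]
  [CommHom z a] [CommHom z p] [CommHom z q] [CommHom z r]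
  [CommHom a p] [CommHom a q] [CommHom a r] [CommHom p q] [CommHom p r] [CommHom q r]

/-- The isomorphism `(y ((z a) p)) q → (y z) (a (p q))`, computed in two ways. -/
theorem coherence_twist :
    λ⟦y, z, a ◁ p ⋄ q⟧⁻¹ * ρ⟦a, p, q⟧ * μ⟦z, a ◁ p, q⟧ * μ⟦y, z ▷ a ◁ p, q⟧ * μ⟦z, a, p⟧
      = μ⟦y ⋄ z, a, p ⋄ q⟧ * ρ⟦(y ⋄ z) ▷ a, p, q⟧ * λ⟦y, z, a⟧⁻¹ * μ⟦y, z ▷ a, p⟧⁻¹ := by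
  -- The pentagons of `Φλρ` with `Φρ`, at `a` and at `z ▷ a`, move `ρ` outwards past `▷`; naturality
  -- exchanges it with `Φλ`, and the pentagon with `Φλ` merges the two mixed cells.
  have h1 := B.lr_pentagon_rho z a p q
  have h2 := B.lr_pentagon_rho y (z ▷ a) p q
  have h3 := (B.lam_intw y z a).cell B.Φρ (cell_intw_right B.Φlam y z a p)
    (cell_intw_right B.Φlam y z a q)
  have h4 := B.lr_pentagon_lam y z a (p ⋄ q)
  have h5 := Intw.cell B.Φlr (cell_intw_left B.Φlr z a p y) (B.lr_intw z a p)
    (cell_intw_right B.Φlr z a p q)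
  rw [mul_assoc _ μ⟦y, z ▷ a ◁ p, q⟧, ← h5, eq_mul_inv_iff_mul_eq, eq_mul_inv_iff_mul_eq]
  simp only [mul_assoc]
  rw [inv_mul_eq_iff_eq_mul]
  calc _ = ρ⟦a, p, q⟧ * μ⟦z, a ◁ p, q⟧ * μ⟦z, a, p⟧ * (μ⟦y, (z ▷ a) ◁ p, q⟧ * μ⟦y, z ▷ a, p⟧)
        * λ⟦y, z, a⟧ := by simp only [mul_assoc]
    _ = μ⟦z, a, p ⋄ q⟧ * (ρ⟦z ▷ a, p, q⟧ * μ⟦y, (z ▷ a) ◁ p, q⟧ * μ⟦y, z ▷ a, p⟧)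
        * λ⟦y, z, a⟧ := by rw [h1]; simp only [mul_assoc]
    _ = μ⟦z, a, p ⋄ q⟧ * μ⟦y, z ▷ a, p ⋄ q⟧ * (ρ⟦y ▷ z ▷ a, p, q⟧ * λ⟦y, z, a⟧) := by
      rw [h2]; simp only [mul_assoc]
    _ = _ := by rw [← h3, ← mul_assoc, h4, mul_assoc]

/-- The isomorphism `(y ((z (a p)) q)) r → ((x y) z) (a (p (q r)))`, computed in two ways. -/
theorem coherence_pentagon :
    ⦅x, y, z⦆⁻¹ * ⦅p, q, r⦆ * λ⟦x, y ⋄ z, a ◁ (p ⋄ q) ⋄ r⟧⁻¹ * ρ⟦a, p ⋄ q, r⟧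
        * μ⟦y ⋄ z, a ◁ p ⋄ q, r⟧ * λ⟦y, z, a ◁ p ⋄ q⟧⁻¹ * ρ⟦a, p, q⟧ * μ⟦z, a ◁ p, q⟧
      = λ⟦x ⋄ y, z, a ◁ p ⋄ q ⋄ r⟧⁻¹ * ρ⟦a, p, q ⋄ r⟧ * μ⟦z, a ◁ p, q ⋄ r⟧
        * λ⟦x, y, (z ▷ a ◁ p) ◁ q ⋄ r⟧⁻¹ * ρ⟦z ▷ a ◁ p, q, r⟧ * μ⟦y, (z ▷ a ◁ p) ◁ q, r⟧ := by
  have h1 := B.lr_pentagon_lam y z (a ◁ p ⋄ q) r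
  have h2 := Intw.cell B.Φlam (cell_intw_left B.Φρ a (p ⋄ q) r y)
    (cell_intw_left B.Φρ a (p ⋄ q) r z) (B.rho_intw a (p ⋄ q) r)
  have hpqr : Intw ⦅p, q, r⦆ (a ◁ (p ⋄ q) ⋄ r) (a ◁ p ⋄ q ⋄ r) :=
    Intw.ten _ (cell_intw_left Q.Φ p q r a) (Q.assoc_intw p q r)
  have h3 := Intw.cell B.Φlam (cell_intw_left Q.Φ p q r x) (cell_intw_left Q.Φ p q r (y ⋄ z)) hpqr
  have h4 := Intw.cell B.Φlam (cell_intw_left Q.Φ p q r y) (cell_intw_left Q.Φ p q r z) hpqr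
  have h5 := cell_pentagon B.pentagon_lam x y z (a ◁ p ⋄ q ⋄ r)
  have h6 := Intw.cell B.Φlr (cell_intw_left B.Φρ a p q z) (B.rho_intw a p q)
    (cell_intw_right B.Φρ a p q r)
  have h7 := Intw.cell B.Φlr (cell_intw_left B.Φρ a p q y)
    (Intw.ten B.lam (cell_intw_left B.Φρ a p q z) (B.rho_intw a p q))
    (cell_intw_right B.Φρ a p q r)
  have h8 := cell_pentagon B.pentagon_ρ a p q r
  have h9 := Intw.cell B.Φlr (cell_intw_left B.Φlr z (a ◁ p) q y) (B.lr_intw z (a ◁ p) q)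
    (cell_intw_right B.Φlr z (a ◁ p) q r)
  have h10 := B.lr_pentagon_rho z (a ◁ p) q r
  have h11 := Intw.cell B.Φlam (cell_intw_left B.Φρ a p (q ⋄ r) x)
    (cell_intw_left B.Φρ a p (q ⋄ r) y)
    (Intw.ten B.lam (cell_intw_left B.Φρ a p (q ⋄ r) z) (B.rho_intw a p (q ⋄ r)))
  have h12 := Intw.cell B.Φlam (cell_intw_left B.Φlr z (a ◁ p) (q ⋄ r) x)
    (cell_intw_left B.Φlr z (a ◁ p) (q ⋄ r) y) (B.lr_intw z (a ◁ p) (q ⋄ r))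
  -- The four pentagons `h1`, `h5`, `h8`, `h10` carry the content; the other identities substituted
  -- here are naturality squares.
  rw [eq_inv_mul_iff_mul_eq.mpr h1.symm,
    eq_inv_mul_iff_mul_eq.mpr h2, eq_inv_mul_iff_mul_eq.mpr h3, eq_inv_mul_iff_mul_eq.mpr h4,
    eq_inv_mul_iff_mul_eq.mpr h5.symm, eq_mul_inv_iff_mul_eq.mpr h6.symm,
    eq_mul_inv_iff_mul_eq.mpr h7.symm, eq_mul_inv_iff_mul_eq.mpr h8.symm,
    eq_inv_mul_iff_mul_eq.mpr h9, eq_inv_mul_iff_mul_eq.mpr h12,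
    eq_mul_inv_iff_mul_eq.mpr h11.symm, eq_inv_mul_iff_mul_eq.mpr h10.symm,
    eq_mul_inv_iff_mul_eq.mpr h8.symm]
  simp only [mul_assoc, mul_inv_rev, inv_inv, inv_mul_cancel_left, mul_inv_cancel_left,
    mul_inv_cancel, inv_mul_cancel, mul_one]

end Coherence

end BicomoduleAlgebra

end

end QuasiHopfTheory

namespace QuasiHopfTheory

noncomputable section

open Algebra.TensorProduct

/-! ### Identities checked on the universal legs -/

section Universal

variable {k X₁ X₂ X₃ X₄ P P₁₂ P₂₃ P₃₄ : Type*} [Field k] [Ring X₁] [Algebra k X₁] [Ring X₂]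
  [Algebra k X₂] [Ring X₃] [Algebra k X₃] [Ring X₄] [Algebra k X₄] [Ring P] [Algebra k P]
  [Ring P₁₂] [Algebra k P₁₂] [Ring P₂₃] [Algebra k P₂₃] [Ring P₃₄] [Algebra k P₃₄]

/-- The three inclusions into `X₁ ⊗ (X₂ ⊗ X₃)`. -/
abbrev leg₁ (X₁ X₂ X₃ : Type*) [Ring X₁] [Algebra k X₁] [Ring X₂] [Algebra k X₂] [Ring X₃]
    [Algebra k X₃] : X₁ →ₐ[k] X₁ ⊗[k] (X₂ ⊗[k] X₃) := includeLeft
abbrev leg₂ (X₁ X₂ X₃ : Type*) [Ring X₁] [Algebra k X₁] [Ring X₂] [Algebra k X₂] [Ring X₃]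
    [Algebra k X₃] : X₂ →ₐ[k] X₁ ⊗[k] (X₂ ⊗[k] X₃) := includeRight.comp includeLeft
abbrev leg₃ (X₁ X₂ X₃ : Type*) [Ring X₁] [Algebra k X₁] [Ring X₂] [Algebra k X₂] [Ring X₃]
    [Algebra k X₃] : X₃ →ₐ[k] X₁ ⊗[k] (X₂ ⊗[k] X₃) := includeRight.comp includeRight

variable (k X₁ X₂ X₃ X₄) in
theorem lift2_legs : lift2 (leg₁ (k := k) X₁ X₂ X₃) (lift2 (leg₂ X₁ X₂ X₃) (leg₃ X₁ X₂ X₃))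
    = AlgHom.id k _ := by
  rw [← lift2_includeLeft_includeRight]
  refine lift2_congr rfl ?_
  rw [← comp_lift2, lift2_includeLeft_includeRight, AlgHom.comp_id]

variable (k X₁ X₂ X₃ X₄) in
theorem lift2_legs_four : lift2 (includeLeft : X₁ →ₐ[k] X₁ ⊗[k] (X₂ ⊗[k] (X₃ ⊗[k] X₄)))
    (lift2 (includeRight.comp (leg₁ X₂ X₃ X₄))
      (lift2 (includeRight.comp (leg₂ X₂ X₃ X₄)) (includeRight.comp (leg₃ X₂ X₃ X₄))))
    = AlgHom.id k _ := by
  rw [← lift2_includeLeft_includeRight]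
  refine lift2_congr rfl ?_
  have e : (includeRight : _ →ₐ[k] X₁ ⊗[k] (X₂ ⊗[k] (X₃ ⊗[k] X₄))).comp
      (lift2 (leg₁ X₂ X₃ X₄) (lift2 (leg₂ X₂ X₃ X₄) (leg₃ X₂ X₃ X₄))) = includeRight := by
    rw [lift2_legs, AlgHom.comp_id]
  rw [comp_lift2] at e
  exact (lift2_congr rfl (comp_lift2 _ _ _).symm).trans e

/-- On the universal legs the lift is the identity (`lift2_legs_four`), so the cell identity there
is the axiom itself. -/
theorem pentagon_of_cells {d₁₂ : P₁₂ →ₐ[k] X₁ ⊗[k] X₂} {d₂₃ : P₂₃ →ₐ[k] X₂ ⊗[k] X₃}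
    {d₃₄ : P₃₄ →ₐ[k] X₃ ⊗[k] X₄}
    {Φ₁ : (X₂ ⊗[k] (X₃ ⊗[k] X₄))ˣ} {Φ₂ : (X₁ ⊗[k] (P₂₃ ⊗[k] X₄))ˣ}
    {Φ₃ : (X₁ ⊗[k] (X₂ ⊗[k] X₃))ˣ} {Φ₄ : (X₁ ⊗[k] (X₂ ⊗[k] P₃₄))ˣ}
    {Φ₅ : (P₁₂ ⊗[k] (X₃ ⊗[k] X₄))ˣ}
    (h : ∀ (a : X₁ →ₐ[k] X₁ ⊗[k] (X₂ ⊗[k] (X₃ ⊗[k] X₄))) (b : X₂ →ₐ[k] _) (c : X₃ →ₐ[k] _)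
      (d : X₄ →ₐ[k] _) [CommHom a b] [CommHom a c] [CommHom a d] [CommHom b c] [CommHom b d]
      [CommHom c d], cell Φ₁ b c d * cell Φ₂ a (ten d₂₃ b c) d * cell Φ₃ a b c
        = cell Φ₄ a b (ten d₃₄ c d) * cell Φ₅ (ten d₁₂ a b) c d) :
    ((1 : X₁) ⊗ₜ[k] (Φ₁ : X₂ ⊗[k] (X₃ ⊗[k] X₄))) * onTail X₁ (onHead X₄ d₂₃) Φ₂.val
        * onTail X₁ (onTail X₂ (padOne X₃ X₄)) Φ₃.val
      = onTail X₁ (onTail X₂ d₃₄) Φ₄.val * onHead (X₃ ⊗[k] X₄) d₁₂ Φ₅.val := by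
  have h1 := (lift_pentagon_iff d₁₂ d₂₃ d₃₄ Φ₁ Φ₂ Φ₃ Φ₄ Φ₅ includeLeft
    (includeRight.comp (leg₁ X₂ X₃ X₄)) (includeRight.comp (leg₂ X₂ X₃ X₄))
    (includeRight.comp (leg₃ X₂ X₃ X₄))).mpr (h _ _ _ _)
  rwa [lift2_legs_four] at h1

theorem intw_of_cells {d₁₂ : P₁₂ →ₐ[k] X₁ ⊗[k] X₂} {d₂₃ : P₂₃ →ₐ[k] X₂ ⊗[k] X₃}
    {d : P →ₐ[k] P₁₂ ⊗[k] X₃} {d' : P →ₐ[k] X₁ ⊗[k] P₂₃} {Φ : (X₁ ⊗[k] (X₂ ⊗[k] X₃))ˣ}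
    (h : ∀ (u : X₁ →ₐ[k] X₁ ⊗[k] (X₂ ⊗[k] X₃)) (v : X₂ →ₐ[k] _) (w : X₃ →ₐ[k] _)
      [CommHom u v] [CommHom u w] [CommHom v w],
      Intw (cell Φ u v w) (ten d (ten d₁₂ u v) w) (ten d' u (ten d₂₃ v w))) (p : P) :
    Φ.val * onHead X₃ d₁₂ (d p) = onTail X₁ d₂₃ (d' p) * Φ.val := by
  have h1 := (lift_intw_iff d₁₂ d₂₃ d d' Φ (leg₁ X₁ X₂ X₃) (leg₂ X₁ X₂ X₃)
    (leg₃ X₁ X₂ X₃)).mpr (h _ _ _) p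
  rwa [lift2_legs] at h1

theorem counit_mid_of_cells {ε : X₂ →ₐ[k] k} {Φ : (X₁ ⊗[k] (X₂ ⊗[k] X₃))ˣ}
    (h : ∀ (u : X₁ →ₐ[k] X₁ ⊗[k] X₃) (w : X₃ →ₐ[k] _) [CommHom u w],
      cell Φ u (unitHom _ ε) w = 1) : onTail X₁ (counitHead X₃ ε) Φ.val = 1 := by
  have e : lift2 (includeLeft : X₁ →ₐ[k] X₁ ⊗[k] X₃) (lift2 (unitHom _ ε) includeRight)
      = onTail X₁ (counitHead X₃ ε) := by
    rw [lift2_congr rfl (lift2_unit_left ε _), ← lift2_comp_onTail,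
      lift2_includeLeft_includeRight]; rfl
  rw [← e]
  exact congrArg Units.val (h includeLeft includeRight)

theorem counit_last_of_cells {ε : X₃ →ₐ[k] k} {Φ : (X₁ ⊗[k] (X₂ ⊗[k] X₃))ˣ}
    (h : ∀ (u : X₁ →ₐ[k] X₁ ⊗[k] X₂) (v : X₂ →ₐ[k] _) [CommHom u v],
      cell Φ u v (unitHom _ ε) = 1) : onTail X₁ (counitTail X₂ ε) Φ.val = 1 := by
  have e : lift2 (includeLeft : X₁ →ₐ[k] X₁ ⊗[k] X₂) (lift2 includeRight (unitHom _ ε))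
      = onTail X₁ (counitTail X₂ ε) := by
    rw [lift2_congr rfl (lift2_unit_right ε _), ← lift2_comp_onTail,
      lift2_includeLeft_includeRight]; rfl
  rw [← e]
  exact congrArg Units.val (h includeLeft includeRight)

end Universal

/-! ### Twisting a comodule algebra -/

section Twist

variable {k H A C X Y : Type*} [Field k] [Ring H] [Algebra k H] [Ring A] [Algebra k A]
  [Ring C] [Algebra k C] [Ring X] [Algebra k X] [Ring Y] [Algebra k Y]

/-- The invertible element of `C` given by `W ∈ X ⊗ Y`. -/
def cell₂ (W : (X ⊗[k] Y)ˣ) (a : X →ₐ[k] C) (u : Y →ₐ[k] C) [CommHom a u] : Cˣ :=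
  Units.map (lift2 a u : X ⊗[k] Y →* C) W

theorem Intw.cell₂ {c : Cˣ} {a a' : X →ₐ[k] C} {u u' : Y →ₐ[k] C} [CommHom a u] [CommHom a' u']
    (W : (X ⊗[k] Y)ˣ) (ha : Intw c a a') (hu : Intw c u u') :
    c * cell₂ W a u = cell₂ W a' u' * c := Units.ext (ha.lift2 hu W.val)

theorem cell₂_intw_right (W : (X ⊗[k] Y)ˣ) (a : X →ₐ[k] C) (u : Y →ₐ[k] C) [CommHom a u]
    {Z : Type*} [Ring Z] [Algebra k Z] (z : Z →ₐ[k] C) [CommHom a z] [CommHom u z] :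
    Intw (cell₂ W a u) z z := fun p =>
  (CommHom.comm (u := lift2 a u) (v := z) W.val p).eq

theorem cell₂_unit_right {W : (X ⊗[k] Y)ˣ} {ε : Y →ₐ[k] k} (h : counitTail X ε W.val = 1)
    (a : X →ₐ[k] C) : cell₂ W a (unitHom C ε) = 1 :=
  Units.ext <| (DFunLike.congr_fun (lift2_unit_right ε a) _).trans <| by
    rw [AlgHom.comp_apply, h, map_one]; rfl

theorem map_inv_eq_one {f : X →ₐ[k] C} {W : Xˣ} (h : f W.val = 1) : f W⁻¹.val = 1 := by
  rw [← one_mul (f W⁻¹.val), ← h, ← map_mul, Units.mul_inv, map_one, h]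

/-- Conjugation by an invertible element. -/
def conjHom (c : Cˣ) (u : X →ₐ[k] C) : X →ₐ[k] C :=
  AlgHom.ofLinearMap ((LinearMap.mulLeft k c.val).comp
      ((LinearMap.mulRight k c⁻¹.val).comp u.toLinearMap))
    (by simp) (fun x y => by simp [mul_assoc])

theorem conjHom_apply (c : Cˣ) (u : X →ₐ[k] C) (x : X) :
    conjHom c u x = c.val * u x * c⁻¹.val := by simp [conjHom, mul_assoc]

namespace RightComoduleAlgebra

variable {Q : QuasiBialgebra k H} (R : RightComoduleAlgebra Q A) (W : (A ⊗[k] H)ˣ)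

local infixr:75 "⋄" => ten (QuasiBialgebra.comul Q)
local infixr:75 "◁" => ten (RightComoduleAlgebra.ρ R)
local infixr:75 "◀" => ten (conjHom W (RightComoduleAlgebra.ρ R))
local notation:max "ρ⟦" u "," v "," w "⟧" => cell (RightComoduleAlgebra.Φρ R) u v w

/-- `(id ⊗ Δ)(W) Φρ (ρ ⊗ id)(W⁻¹) (W⁻¹ ⊗ 1)`. -/
def twistΦ : (A ⊗[k] (H ⊗[k] H))ˣ :=
  Units.map (onTail A Q.comul : A ⊗[k] H →* A ⊗[k] (H ⊗[k] H)) W * R.Φρ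
    * (Units.map (onHead H R.ρ : A ⊗[k] H →* A ⊗[k] (H ⊗[k] H)) W)⁻¹
    * (Units.map (onTail A (padOne (k := k) H H) : A ⊗[k] H →* A ⊗[k] (H ⊗[k] H)) W)⁻¹

variable (a : A →ₐ[k] C) (u v w : H →ₐ[k] C) [CommHom a u] [CommHom a v] [CommHom a w]
  [CommHom u v] [CommHom u w] [CommHom v w]

theorem cell_twistΦ : cell (R.twistΦ W) a u v
    = cell₂ W a (u ⋄ v) * ρ⟦a, u, v⟧ * (cell₂ W (a ◁ u) v)⁻¹ * (cell₂ W a u)⁻¹ := by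
  have e : ∀ f : A ⊗[k] H →ₐ[k] A ⊗[k] (H ⊗[k] H), Units.map (lift2 a (lift2 u v) : _ →* C)
      (Units.map (f : A ⊗[k] H →* A ⊗[k] (H ⊗[k] H)) W)
      = Units.map ((lift2 a (lift2 u v)).comp f : A ⊗[k] H →* C) W := fun f => rfl
  rw [cell, twistΦ, map_mul, map_mul, map_mul, map_inv, map_inv, e, e, e, lift2_comp_onTail,
    lift2_comp_onTail, lift2_comp_onHead, lift2_congr rfl (lift2_comp_padOne u v)]
  rfl

theorem twist_intw : Intw (cell₂ W a u) (a ◁ u) (a ◀ u) := fun x => by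
  change lift2 a u W.val * lift2 a u (R.ρ x) = lift2 a u (conjHom W R.ρ x) * lift2 a u W.val
  rw [← map_mul, ← map_mul, conjHom_apply, mul_assoc, Units.inv_mul, mul_one]

theorem twistΦ_intw : Intw (cell (R.twistΦ W) a u v) ((a ◀ u) ◀ v) (a ◀ u ⋄ v) := by
  rw [cell_twistΦ]
  refine (Intw.mul (Intw.mul (R.twist_intw W a (u ⋄ v)) (R.rho_intw a u v))
    (R.twist_intw W (a ◁ u) v).inv).mul ?_
  exact (Intw.ten _ (R.twist_intw W a u) (cell₂_intw_right W a u v)).inv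

/-- Naturality carries the factors of `W` past `Φ` and `Φρ`; they cancel in pairs, and the pentagon
of `Φρ` remains. -/
theorem twistΦ_pentagon :
    cell Q.Φ u v w * cell (R.twistΦ W) a (u ⋄ v) w * cell (R.twistΦ W) a u v
      = cell (R.twistΦ W) a u (v ⋄ w) * cell (R.twistΦ W) (a ◀ u) v w := by
  have h1 := Intw.cell (R.twistΦ W) (R.twist_intw W a u) (cell₂_intw_right W a u v)
    (cell₂_intw_right W a u w)
  have h2 := Intw.cell₂ W (cell_intw_left Q.Φ u v w a) (Q.assoc_intw u v w)
  have h3 := Intw.cell₂ W (R.rho_intw a u v) (cell_intw_right R.Φρ a u v w)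
  have h4 := cell_pentagon R.pentagon_ρ a u v w
  rw [eq_mul_inv_iff_mul_eq.mpr h1.symm]
  simp only [cell_twistΦ]
  rw [eq_mul_inv_iff_mul_eq.mpr h2.symm, eq_inv_mul_iff_mul_eq.mpr h3,
    eq_mul_inv_iff_mul_eq.mpr (eq_mul_inv_iff_mul_eq.mpr h4)]
  simp only [mul_assoc, mul_inv_rev, inv_inv, inv_mul_cancel_left, mul_inv_cancel_left,
    inv_mul_cancel, mul_one]

/-- The twist of a comodule algebra. -/
def twist (hW : counitTail A Q.counit W.val = 1) : RightComoduleAlgebra Q A where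
  ρ := conjHom W R.ρ
  Φρ := R.twistΦ W
  quasi_coassoc_ρ := intw_of_cells fun a u v => R.twistΦ_intw W a u v
  pentagon_ρ := pentagon_of_cells fun a u v w => R.twistΦ_pentagon W a u v w
  counit_ρ x := by
    rw [conjHom_apply, map_mul, map_mul, hW, map_inv_eq_one hW, R.counit_ρ, one_mul, mul_one]
  counit_Φρ_mid := counit_mid_of_cells fun a v _ => by
    rw [cell_twistΦ, cell₂_unit_right hW, cell_unit_mid R.counit_Φρ_mid, mul_one, inv_one, mul_one]
    have e : (unitHom _ Q.counit : H →ₐ[k] A ⊗[k] H) ⋄ v = v := Q.unit_tens v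
    have e' : a ◁ unitHom _ Q.counit = a := ten_unit_right R.counit_ρ a
    simp only [e, e', mul_inv_cancel]
  counit_Φρ_last := counit_last_of_cells fun a u _ => by
    rw [cell_twistΦ, cell₂_unit_right hW, cell_unit_last R.counit_Φρ_last, mul_one, inv_one, mul_one]
    have e : u ⋄ (unitHom _ Q.counit : H →ₐ[k] A ⊗[k] H) = u := Q.tens_unit u
    simp only [e, mul_inv_cancel]

theorem onHead_conjHom (t : A ⊗[k] H) : onHead H (conjHom W R.ρ) t
    = onTail A (padOne H H) W.val * onHead H R.ρ t * onTail A (padOne H H) W⁻¹.val := by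
  induction t with
  | zero => simp
  | add s t hs ht => simp only [map_add, mul_add, add_mul, hs, ht]
  | tmul b h =>
    rw [onHead_tmul, onHead_tmul, ← QuasiHopf.assoc_tmul_one, ← QuasiHopf.assoc_tmul_one, ← map_mul,
      ← map_mul, tmul_mul_tmul, tmul_mul_tmul, one_mul, mul_one, conjHom_apply]

theorem twistEquivalent_twist (hW : counitTail A Q.counit W.val = 1) :
    TwistEquivalent (R.twist W hW) R := by
  -- The equivalence leads from the twisted structure back to the original one, hence `W⁻¹`.
  refine ⟨W⁻¹, map_inv_eq_one hW, fun x => ?_, ?_⟩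
  · change _ = W⁻¹.val * conjHom W R.ρ x * W⁻¹⁻¹.val
    rw [conjHom_apply, inv_inv, mul_assoc, mul_assoc, mul_assoc, Units.inv_mul, mul_one,
      Units.inv_mul_cancel_left]
  · change _ = onTail A Q.comul W⁻¹.val * (onTail A Q.comul W.val * R.Φρ.val
      * onHead H R.ρ W⁻¹.val * onTail A (padOne H H) W⁻¹.val)
      * onHead H (conjHom W R.ρ) W.val * onTail A (padOne H H) W.val
    rw [onHead_conjHom]
    have c : ∀ f : A ⊗[k] H →ₐ[k] A ⊗[k] (H ⊗[k] H), f W⁻¹.val * f W.val = 1 := fun f => by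
      rw [← map_mul, Units.inv_mul, map_one]
    have c' : ∀ (f : A ⊗[k] H →ₐ[k] A ⊗[k] (H ⊗[k] H)) (x : A ⊗[k] (H ⊗[k] H)),
      f W⁻¹.val * (f W.val * x) = x := fun f x => by rw [← mul_assoc, c, one_mul]
    simp only [mul_assoc, c, c', mul_one]

end RightComoduleAlgebra

end Twist

end

end QuasiHopfTheory

namespace QuasiHopfTheory

noncomputable section

open Algebra.TensorProduct

section Congr

variable {k C E X Y P : Type*} [Field k] [Ring C] [Algebra k C] [Ring E] [Algebra k E] [Ring X]
  [Algebra k X] [Ring Y] [Algebra k Y] [Ring P] [Algebra k P]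

theorem ten_congr (d : P →ₐ[k] X ⊗[k] Y) {u u' : X →ₐ[k] C} {v v' : Y →ₐ[k] C} [CommHom u v]
    [CommHom u' v'] (hu : u = u') (hv : v = v') : ten d u v = ten d u' v' := by
  subst hu; subst hv; rfl

end Congr

namespace QuasiHopf

variable {k H A C E : Type*} [Field k] [Ring H] [Algebra k H] [Ring A] [Algebra k A]
  [Ring C] [Algebra k C] [Ring E] [Algebra k E] (Q : QuasiHopf k H)
  (B : BicomoduleAlgebra Q.toQuasiBialgebra A)

local infixr:75 "⋄" => ten (QuasiBialgebra.comul (QuasiHopf.toQuasiBialgebra Q))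
local infixr:75 "▷" => ten (LeftComoduleAlgebra.lam (BicomoduleAlgebra.toLeftComoduleAlgebra B))
local infixr:75 "◁" => ten (RightComoduleAlgebra.ρ (BicomoduleAlgebra.toRightComoduleAlgebra B))
local notation:max "⦅" u "," v "," w "⦆" =>
  cell (QuasiBialgebra.Φ (QuasiHopf.toQuasiBialgebra Q)) u v w
local notation:max "λ⟦" u "," v "," w "⟧" =>
  cell (LeftComoduleAlgebra.Φlam (BicomoduleAlgebra.toLeftComoduleAlgebra B)) u v w
local notation:max "ρ⟦" u "," v "," w "⟧" =>
  cell (RightComoduleAlgebra.Φρ (BicomoduleAlgebra.toRightComoduleAlgebra B)) u v w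
local notation:max "μ⟦" u "," v "," w "⟧" => cell (BicomoduleAlgebra.Φlr B) u v w

/-! ### The coaction `ρ₂` -/

section PhiCell

variable (x y z : H →ₐ[k] C) (a : A →ₐ[k] C) (p q r : H →ₐ[k] C)
  [CommHom x y] [CommHom x z] [CommHom x a] [CommHom x p] [CommHom x q] [CommHom x r]
  [CommHom y z] [CommHom y a] [CommHom y p] [CommHom y q] [CommHom y r]
  [CommHom z a] [CommHom z p] [CommHom z q] [CommHom z r]
  [CommHom a p] [CommHom a q] [CommHom a r] [CommHom p q] [CommHom p r] [CommHom q r]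

/-- The reassociator of `ρ₂`, as a cell. -/
def phiCell : Cˣ :=
  Q.tw y z * λ⟦y, z, a ◁ p ⋄ q⟧⁻¹ * ρ⟦a, p, q⟧ * μ⟦z, a ◁ p, q⟧

variable {y z a p q} in
theorem phiCell_congr {y' z' : H →ₐ[k] C} {a' : A →ₐ[k] C} {p' q' : H →ₐ[k] C}
    [CommHom y' z'] [CommHom y' a'] [CommHom y' p'] [CommHom y' q'] [CommHom z' a'] [CommHom z' p']
    [CommHom z' q'] [CommHom a' p'] [CommHom a' q'] [CommHom p' q'] (hy : y = y') (hz : z = z')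
    (ha : a = a') (hp : p = p') (hq : q = q') :
    Q.phiCell B y z a p q = Q.phiCell B y' z' a' p' q' := by
  subst hy; subst hz; subst ha; subst hp; subst hq; rfl

theorem map_phiCell (f : C →ₐ[k] E) : Units.map (f : C →* E) (Q.phiCell B y z a p q)
    = Q.phiCell B (f.comp y) (f.comp z) (f.comp a) (f.comp p) (f.comp q) := by
  rw [phiCell, map_mul, map_mul, map_mul, map_inv, map_tw, map_cell_of_eq rfl rfl
    (comp_ten_of_eq rfl (comp_ten_of_eq rfl rfl)), map_cell_of_eq rfl rfl rfl,
    map_cell_of_eq rfl (comp_ten_of_eq rfl rfl) rfl]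
  rfl

variable {y z a p q} in
theorem Intw.phiCell {c : Cˣ} {y' z' : H →ₐ[k] C} {a' : A →ₐ[k] C} {p' q' : H →ₐ[k] C}
    [CommHom y' z'] [CommHom y' a'] [CommHom y' p'] [CommHom y' q'] [CommHom z' a'] [CommHom z' p']
    [CommHom z' q'] [CommHom a' p'] [CommHom a' q'] [CommHom p' q'] (hy : Intw c y y')
    (hz : Intw c z z') (ha : Intw c a a') (hp : Intw c p p') (hq : Intw c q q') :
    c * Q.phiCell B y z a p q = Q.phiCell B y' z' a' p' q' * c := by
  rw [QuasiHopf.phiCell, QuasiHopf.phiCell,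
    eq_mul_inv_iff_mul_eq.mpr (Intw.tw Q hy hz).symm,
    eq_mul_inv_iff_mul_eq.mpr (Intw.cell B.Φlam hy hz (ha.ten B.ρ (hp.ten Q.comul hq))).symm,
    eq_mul_inv_iff_mul_eq.mpr (Intw.cell B.Φρ ha hp hq).symm,
    eq_mul_inv_iff_mul_eq.mpr (Intw.cell B.Φlr hz (ha.ten B.ρ hp) hq).symm]
  simp only [mul_assoc, mul_inv_rev, inv_inv, inv_mul_cancel_left, inv_mul_cancel, mul_one]

/-- The twists live on `x, y, z`, so they commute with the associator of `p, q, r` and can be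
collected in front. There `tw_pentagon` applies, and `coherence_pentagon` settles the rest. -/
theorem phiCell_pentagon : (cell (Q.revUnit Q.Φ) x y z)⁻¹ * ⦅p, q, r⦆
      * (Q.tw y z * Q.phiCell B x (y ⋄ z) a (p ⋄ q) r * (Q.tw y z)⁻¹) * Q.phiCell B y z a p q
    = (Q.tw x y * Q.phiCell B (x ⋄ y) z a p (q ⋄ r) * (Q.tw x y)⁻¹)
      * Q.phiCell B x y (z ▷ a ◁ p) q r := by
  have co := B.coherence_pentagon x y z a p q r
  have d := Q.tw_pentagon x y z
  have c1 := Intw.tw Q (cell_intw_left Q.Φ p q r y) (cell_intw_left Q.Φ p q r z)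
  have c2 := Intw.tw Q (cell_intw_left Q.Φ p q r x) (cell_intw_left Q.Φ p q r (y ⋄ z))
  have d' : (cell (Q.revUnit Q.Φ) x y z)⁻¹ * (Q.tw y z * Q.tw x (y ⋄ z))
      = Q.tw x y * Q.tw (x ⋄ y) z * ⦅x, y, z⦆⁻¹ := by
    rw [inv_mul_eq_iff_eq_mul, ← mul_assoc, ← mul_assoc, ← d, mul_inv_cancel_right]
  calc _ = (cell (Q.revUnit Q.Φ) x y z)⁻¹ * (⦅p, q, r⦆ * Q.tw y z * Q.tw x (y ⋄ z))
        * (λ⟦x, y ⋄ z, a ◁ (p ⋄ q) ⋄ r⟧⁻¹ * ρ⟦a, p ⋄ q, r⟧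
        * μ⟦y ⋄ z, a ◁ p ⋄ q, r⟧ * λ⟦y, z, a ◁ p ⋄ q⟧⁻¹ * ρ⟦a, p, q⟧ * μ⟦z, a ◁ p, q⟧) := by
        simp only [phiCell, mul_assoc, inv_mul_cancel_left]
    _ = (cell (Q.revUnit Q.Φ) x y z)⁻¹ * (Q.tw y z * Q.tw x (y ⋄ z)) * (⦅p, q, r⦆
        * (λ⟦x, y ⋄ z, a ◁ (p ⋄ q) ⋄ r⟧⁻¹ * ρ⟦a, p ⋄ q, r⟧
        * μ⟦y ⋄ z, a ◁ p ⋄ q, r⟧ * λ⟦y, z, a ◁ p ⋄ q⟧⁻¹ * ρ⟦a, p, q⟧ * μ⟦z, a ◁ p, q⟧)) := by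
        rw [c1, mul_assoc (Q.tw y z), c2]
        simp only [mul_assoc]
    _ = Q.tw x y * Q.tw (x ⋄ y) z * (⦅x, y, z⦆⁻¹ * ⦅p, q, r⦆
        * λ⟦x, y ⋄ z, a ◁ (p ⋄ q) ⋄ r⟧⁻¹ * ρ⟦a, p ⋄ q, r⟧
        * μ⟦y ⋄ z, a ◁ p ⋄ q, r⟧ * λ⟦y, z, a ◁ p ⋄ q⟧⁻¹ * ρ⟦a, p, q⟧ * μ⟦z, a ◁ p, q⟧) := by
        rw [d']
        simp only [mul_assoc]
    _ = _ := by
        rw [co]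
        simp only [phiCell, mul_assoc, inv_mul_cancel_left]

variable {y z p q} in
theorem phiCell_intw {l s : H →ₐ[k] C} [CommHom l a] [CommHom l s] [CommHom a s]
    (hl : Intw (Q.tw y z) (y ⋄ z) l) (hs : p ⋄ q = s) :
    Intw (Q.phiCell B y z a p q) (y ▷ (z ▷ a ◁ p) ◁ q) (l ▷ a ◁ s) := by
  subst hs
  have h₁ : Intw ρ⟦a, p, q⟧ (y ▷ z ▷ (a ◁ p) ◁ q) (y ▷ z ▷ a ◁ p ⋄ q) :=
    Intw.ten B.lam (cell_intw_left B.Φρ a p q y)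
      (Intw.ten B.lam (cell_intw_left B.Φρ a p q z) (B.rho_intw a p q))
  have h₂ : Intw μ⟦z, a ◁ p, q⟧ (y ▷ (z ▷ a ◁ p) ◁ q) (y ▷ z ▷ (a ◁ p) ◁ q) :=
    Intw.ten B.lam (cell_intw_left B.Φlr z (a ◁ p) q y) (B.lr_intw z (a ◁ p) q)
  exact (((Intw.ten B.lam hl (Q.tw_intw_right y z (a ◁ p ⋄ q))).mul
    (B.lam_intw y z (a ◁ p ⋄ q)).inv).mul h₁).mul h₂

theorem phiCell_unit_mid (hα : Q.counit Q.α = 1) :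
    Q.phiCell B y (Q.unit C) a (Q.unit C) q = 1 := by
  rw [phiCell, Q.tw_unit_right hα, B.lam_unit_mid, B.rho_unit_mid, B.lr_unit_first]
  simp

theorem phiCell_unit_last (hα : Q.counit Q.α = 1) :
    Q.phiCell B (Q.unit C) z a p (Q.unit C) = 1 := by
  rw [phiCell, Q.tw_unit_left hα, B.lam_unit_first, B.rho_unit_last, B.lr_unit_last]
  simp

end PhiCell

section Objects

variable (a : A →ₐ[k] C) (κ₁ κ₂ κ₃ : Hᵐᵒᵖ ⊗[k] H →ₐ[k] C) [CommHom a κ₁] [CommHom a κ₂]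
  [CommHom a κ₃] [CommHom κ₁ κ₂] [CommHom κ₁ κ₃] [CommHom κ₂ κ₃]

/-- The reassociator of `ρ₂` for objects over `Hᵒᵖ ⊗ H`. -/
abbrev phiTwo : Cˣ := Q.phiCell B (Q.lpart κ₂) (Q.lpart κ₁) a (rpart κ₁) (rpart κ₂)

theorem phiTwo_intw : Intw (Q.phiTwo B a κ₁ κ₂) (ten (rho₂ Q B) (ten (rho₂ Q B) a κ₁) κ₂)
    (ten (rho₂ Q B) a (ten Q.env.comul κ₁ κ₂)) := by
  have e : ten (rho₂ Q B) (ten (rho₂ Q B) a κ₁) κ₂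
      = Q.lpart κ₂ ▷ (Q.lpart κ₁ ▷ a ◁ rpart κ₁) ◁ rpart κ₂ := by
    rw [Q.ten_rho₂]
    exact ten_congr _ rfl (ten_congr _ (Q.ten_rho₂ a κ₁ B) rfl)
  rw [e, Q.ten_rho₂]
  exact Q.phiCell_intw B a (Q.tw_intw κ₁ κ₂) (Q.rpart_ten κ₁ κ₂).symm

/-- The left part of `κ₁ ⊗ κ₂` is a twist conjugate of the tensor product of left parts, and the
twist fixes every other object involved. So the whole cell is conjugated. -/
theorem phiTwo_ten_left : Q.phiTwo B a (ten Q.env.comul κ₁ κ₂) κ₃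
    = Q.tw (Q.lpart κ₂) (Q.lpart κ₁) * Q.phiCell B (Q.lpart κ₃) (Q.lpart κ₂ ⋄ Q.lpart κ₁) a
      (rpart κ₁ ⋄ rpart κ₂) (rpart κ₃) * (Q.tw (Q.lpart κ₂) (Q.lpart κ₁))⁻¹ := by
  rw [eq_mul_inv_iff_mul_eq]
  refine (Intw.phiCell Q B ?_ (Q.tw_intw κ₁ κ₂) ?_ ?_ ?_).symm
  · exact Q.tw_intw_left _ _ _
  · exact Q.tw_intw_right _ _ _
  · rw [Q.rpart_ten]
    exact Q.tw_intw_right _ _ _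
  · exact Q.tw_intw_right _ _ _

theorem phiTwo_ten_right : Q.phiTwo B a κ₁ (ten Q.env.comul κ₂ κ₃)
    = Q.tw (Q.lpart κ₃) (Q.lpart κ₂) * Q.phiCell B (Q.lpart κ₃ ⋄ Q.lpart κ₂) (Q.lpart κ₁) a
      (rpart κ₁) (rpart κ₂ ⋄ rpart κ₃) * (Q.tw (Q.lpart κ₃) (Q.lpart κ₂))⁻¹ := by
  rw [eq_mul_inv_iff_mul_eq]
  refine (Intw.phiCell Q B (Q.tw_intw κ₂ κ₃) ?_ ?_ ?_ ?_).symm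
  · exact Q.tw_intw_right _ _ _
  · exact Q.tw_intw_right _ _ _
  · exact Q.tw_intw_right _ _ _
  · rw [Q.rpart_ten]
    exact Q.tw_intw_right _ _ _

theorem phiTwo_pentagon : cell Q.env.Φ κ₁ κ₂ κ₃ * Q.phiTwo B a (ten Q.env.comul κ₁ κ₂) κ₃
      * Q.phiTwo B a κ₁ κ₂
    = Q.phiTwo B a κ₁ (ten Q.env.comul κ₂ κ₃) * Q.phiTwo B (ten (rho₂ Q B) a κ₁) κ₂ κ₃ := by
  rw [cell_env, phiTwo_ten_left, phiTwo_ten_right, phiCell_pentagon]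
  exact congrArg _ (Q.phiCell_congr B rfl rfl (Q.ten_rho₂ a κ₁ B).symm rfl rfl)

/-- The reassociator of `ρ₂`. -/
def phiUnit₂ : (A ⊗[k] ((Hᵐᵒᵖ ⊗[k] H) ⊗[k] (Hᵐᵒᵖ ⊗[k] H)))ˣ :=
  Q.phiTwo B (leg₁ A (Hᵐᵒᵖ ⊗[k] H) (Hᵐᵒᵖ ⊗[k] H)) (leg₂ A (Hᵐᵒᵖ ⊗[k] H) (Hᵐᵒᵖ ⊗[k] H))
    (leg₃ A (Hᵐᵒᵖ ⊗[k] H) (Hᵐᵒᵖ ⊗[k] H))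

/-- The element is the cell on the universal legs, and lifting to any other objects carries those
legs to them. -/
theorem cell_phiUnit₂ : cell (Q.phiUnit₂ B) a κ₁ κ₂ = Q.phiTwo B a κ₁ κ₂ := by
  rw [cell, phiUnit₂, phiTwo, map_phiCell]
  refine Q.phiCell_congr B ?_ ?_ ?_ ?_ ?_
  · rw [comp_lpart]; congr 1; ext <;> simp
  · rw [comp_lpart]; congr 1; ext <;> simp
  · ext; simp
  · rw [comp_rpart]; congr 1; ext <;> simp
  · rw [comp_rpart]; congr 1; ext <;> simp

end Objects

/-- The comodule algebra `(A, ρ₂, Φρ₂)`. -/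
def comoduleTwo (hα : Q.counit Q.α = 1) : RightComoduleAlgebra Q.env A where
  ρ := rho₂ Q B
  Φρ := Q.phiUnit₂ B
  quasi_coassoc_ρ := intw_of_cells fun a κ₁ κ₂ _ _ _ => by
    rw [cell_phiUnit₂]
    exact Q.phiTwo_intw B a κ₁ κ₂
  pentagon_ρ := pentagon_of_cells fun a κ₁ κ₂ κ₃ _ _ _ _ _ _ => by
    simp only [cell_phiUnit₂]
    exact Q.phiTwo_pentagon B a κ₁ κ₂ κ₃
  counit_ρ x := by
    -- Both parts of the unit object over `Hᵒᵖ ⊗ H` are unit objects over `H`; for the left part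
    -- this rests on `ε ∘ S = ε`.
    have e : ten (rho₂ Q B) (AlgHom.id k A) (Q.env.unit A) = AlgHom.id k A := by
      rw [ten_rho₂, ten_congr _ (Q.lpart_unit hα) (ten_congr _ rfl Q.rpart_unit), B.unit_lam,
        B.rho_unit]
    have h := DFunLike.congr_fun e x
    rwa [ten_apply, lift2_unit_right] at h
  counit_Φρ_mid := counit_mid_of_cells fun a κ _ => by
    rw [cell_phiUnit₂, phiTwo,
      Q.phiCell_congr B rfl (Q.lpart_unit hα) rfl Q.rpart_unit rfl, Q.phiCell_unit_mid B _ _ _ hα]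
  counit_Φρ_last := counit_last_of_cells fun a κ _ => by
    rw [cell_phiUnit₂, phiTwo,
      Q.phiCell_congr B (Q.lpart_unit hα) rfl rfl rfl Q.rpart_unit, Q.phiCell_unit_last B _ _ _ hα]

end QuasiHopf

end

end QuasiHopfTheory

namespace QuasiHopfTheory

noncomputable section

open Algebra.TensorProduct

namespace QuasiHopf

variable {k H A C : Type*} [Field k] [Ring H] [Algebra k H] [Ring A] [Algebra k A]
  [Ring C] [Algebra k C] (Q : QuasiHopf k H)
  (B : BicomoduleAlgebra Q.toQuasiBialgebra A)

local infixr:75 "⋄" => ten (QuasiBialgebra.comul (QuasiHopf.toQuasiBialgebra Q))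
local infixr:75 "▷" => ten (LeftComoduleAlgebra.lam (BicomoduleAlgebra.toLeftComoduleAlgebra B))
local infixr:75 "◁" => ten (RightComoduleAlgebra.ρ (BicomoduleAlgebra.toRightComoduleAlgebra B))
local notation:max "λ⟦" u "," v "," w "⟧" =>
  cell (LeftComoduleAlgebra.Φlam (BicomoduleAlgebra.toLeftComoduleAlgebra B)) u v w
local notation:max "ρ⟦" u "," v "," w "⟧" =>
  cell (RightComoduleAlgebra.Φρ (BicomoduleAlgebra.toRightComoduleAlgebra B)) u v w
local notation:max "μ⟦" u "," v "," w "⟧" => cell (BicomoduleAlgebra.Φlr B) u v w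

/-! ### The elements `Φρ₁` and `Φρ₂` as cells -/

section FiveLegs

variable (y z : H →ₐ[k] C) (a : A →ₐ[k] C) (p q : H →ₐ[k] C)
  [CommHom y z] [CommHom y a] [CommHom y p] [CommHom y q] [CommHom z a] [CommHom z p]
  [CommHom z q] [CommHom a p] [CommHom a q] [CommHom p q]

/-- `h ⊗ h' ⊗ b ⊗ g ⊗ g' ↦ y(h) z(h') a(b) p(g) q(g')`. -/
abbrev lift5 : H ⊗[k] (H ⊗[k] (A ⊗[k] (H ⊗[k] H))) →ₐ[k] C :=
  lift2 y (lift2 z (lift2 a (lift2 p q)))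

theorem lift5_twist₅ : lift5 y z a p q (Q.twist₅ A) = (Q.tw y z).val := by
  rw [twist₅, ← AlgHom.comp_apply, lift2_comp_onTail, lift2_congr rfl (lift2_comp_padOne _ _),
    ← twistUnit_val]
  rfl

theorem lift5_onTail_rho (t : H ⊗[k] (H ⊗[k] A)) :
    lift5 y z a p q (onTail H (onTail H ((onTail A Q.comul).comp B.ρ)) t)
      = lift2 y (lift2 z (a ◁ p ⋄ q)) t := by
  have e : (lift2 a (lift2 p q)).comp ((onTail A Q.comul).comp B.ρ) = a ◁ p ⋄ q := by
    rw [← AlgHom.comp_assoc, lift2_comp_onTail]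
    rfl
  rw [← AlgHom.comp_apply, lift2_comp_onTail, lift2_congr rfl (lift2_comp_onTail _ _ _),
    lift2_congr rfl (lift2_congr rfl e)]

theorem lift5_onTail_onHead_rho (t : H ⊗[k] (A ⊗[k] H)) :
    lift5 y z a p q ((1 : H) ⊗ₜ onTail H (onHead H B.ρ) t) = lift2 z (lift2 (a ◁ p) q) t := by
  rw [lift2_one_tmul, ← AlgHom.comp_apply, lift2_comp_onTail,
    lift2_congr rfl (lift2_comp_onHead _ _ _ _)]

theorem lift5_onHead_onHead (t : A ⊗[k] (H ⊗[k] H)) :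
    lift5 y z a p q (onHead (A ⊗[k] (H ⊗[k] H)) Q.comul (onHead (H ⊗[k] H) B.lam t))
      = lift2 ((y ⋄ z) ▷ a) (lift2 p q) t := by
  rw [← AlgHom.comp_apply, lift2_comp_onHead, ← AlgHom.comp_apply, lift2_comp_onHead]

theorem lift5_onTail_padOne (t : H ⊗[k] (H ⊗[k] A)) :
    lift5 y z a p q (onTail H (onTail H (padOne A (H ⊗[k] H))) t) = lift2 y (lift2 z a) t := by
  rw [← AlgHom.comp_apply, lift2_comp_onTail, lift2_congr rfl (lift2_comp_onTail _ _ _),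
    lift2_congr rfl (lift2_congr rfl (lift2_comp_padOne _ _))]

theorem lift5_onTail_onHead_lam (t : H ⊗[k] (A ⊗[k] H)) :
    lift5 y z a p q (onTail H (onHead (H ⊗[k] H) B.lam) (onTail H (onTail A (padOne H H)) t))
      = lift2 y (lift2 (z ▷ a) p) t := by
  rw [← AlgHom.comp_apply, lift2_comp_onTail, lift2_congr rfl (lift2_comp_onHead _ _ _ _),
    ← AlgHom.comp_apply, lift2_comp_onTail, lift2_congr rfl (lift2_comp_onTail _ _ _),
    lift2_congr rfl (lift2_congr rfl (lift2_comp_padOne _ _))]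

end FiveLegs

/-- The three inclusions into `A ⊗ (Hᵒᵖ ⊗ H) ⊗ (Hᵒᵖ ⊗ H)`. -/
abbrev envLeg₁ (k H A : Type*) [Field k] [Ring H] [Algebra k H] [Ring A] [Algebra k A] :
    A →ₐ[k] A ⊗[k] ((Hᵐᵒᵖ ⊗[k] H) ⊗[k] (Hᵐᵒᵖ ⊗[k] H)) :=
  leg₁ A (Hᵐᵒᵖ ⊗[k] H) (Hᵐᵒᵖ ⊗[k] H)
abbrev envLeg₂ (k H A : Type*) [Field k] [Ring H] [Algebra k H] [Ring A] [Algebra k A] :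
    Hᵐᵒᵖ ⊗[k] H →ₐ[k] A ⊗[k] ((Hᵐᵒᵖ ⊗[k] H) ⊗[k] (Hᵐᵒᵖ ⊗[k] H)) :=
  leg₂ A (Hᵐᵒᵖ ⊗[k] H) (Hᵐᵒᵖ ⊗[k] H)
abbrev envLeg₃ (k H A : Type*) [Field k] [Ring H] [Algebra k H] [Ring A] [Algebra k A] :
    Hᵐᵒᵖ ⊗[k] H →ₐ[k] A ⊗[k] ((Hᵐᵒᵖ ⊗[k] H) ⊗[k] (Hᵐᵒᵖ ⊗[k] H)) :=
  leg₃ A (Hᵐᵒᵖ ⊗[k] H) (Hᵐᵒᵖ ⊗[k] H)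

theorem arrange₅_eq_lift5 : (Q.arrange₅ : _ →ₐ[k] A ⊗[k] ((Hᵐᵒᵖ ⊗[k] H) ⊗[k] (Hᵐᵒᵖ ⊗[k] H)))
    = lift5 (Q.lpart (envLeg₃ k H A)) (Q.lpart (envLeg₂ k H A)) (envLeg₁ k H A)
      (rpart (envLeg₂ k H A)) (rpart (envLeg₃ k H A)) := by
  refine AlgHom.ext fun t => ?_
  induction t with
  | zero => simp
  | add s t hs ht => rw [map_add, map_add, hs, ht]
  | tmul h t =>
    induction t with
    | zero => simp
    | add s t hs ht => rw [TensorProduct.tmul_add, map_add, map_add, hs, ht]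
    | tmul h' t =>
      induction t with
      | zero => simp
      | add s t hs ht =>
        rw [TensorProduct.tmul_add, TensorProduct.tmul_add, map_add, map_add, hs, ht]
      | tmul b t =>
        induction t with
        | zero => simp
        | add s t hs ht =>
          rw [TensorProduct.tmul_add, TensorProduct.tmul_add, TensorProduct.tmul_add, map_add,
            map_add, hs, ht]
        | tmul g g' =>
          rw [arrange₅_tmul]
          simp only [lift2_tmul, lpart_apply, rpart_apply, AlgHom.comp_apply, includeLeft_apply,
            includeRight_apply, tmul_mul_tmul, one_mul, mul_one, one_def]

theorem phiUnit₂_val : (Q.phiUnit₂ B).val = phiRho₂ Q B := by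
  rw [phiRho₂, arrange₅_eq_lift5, map_mul, map_mul, map_mul, lift5_twist₅, lift5_onTail_rho,
    lift5_onTail_onHead_rho, lift2_one_tmul, lift2_one_tmul]
  rfl

theorem phiRho₁_eq : phiRho₁ Q B
    = (Q.tw (Q.lpart (envLeg₃ k H A)) (Q.lpart (envLeg₂ k H A))
      * ρ⟦(Q.lpart (envLeg₃ k H A) ⋄ Q.lpart (envLeg₂ k H A)) ▷ envLeg₁ k H A,
          rpart (envLeg₂ k H A), rpart (envLeg₃ k H A)⟧
      * λ⟦Q.lpart (envLeg₃ k H A), Q.lpart (envLeg₂ k H A), envLeg₁ k H A⟧⁻¹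
      * μ⟦Q.lpart (envLeg₃ k H A), Q.lpart (envLeg₂ k H A) ▷ envLeg₁ k H A,
          rpart (envLeg₂ k H A)⟧⁻¹ : (A ⊗[k] ((Hᵐᵒᵖ ⊗[k] H) ⊗[k] (Hᵐᵒᵖ ⊗[k] H)))ˣ).val := by
  rw [phiRho₁, arrange₅_eq_lift5, map_mul, map_mul, map_mul, lift5_twist₅, lift5_onHead_onHead,
    lift5_onTail_padOne, lift5_onTail_onHead_lam]
  rfl

/-! ### The twist relating `ρ₁` and `ρ₂` -/

/-- The image of `Φλρ` in `A ⊗ (Hᵒᵖ ⊗ H)`. -/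
def twistElem : (A ⊗[k] (Hᵐᵒᵖ ⊗[k] H))ˣ :=
  Units.map ((Q.arrange₃ : H ⊗[k] (A ⊗[k] H) →ₐ[k] A ⊗[k] (Hᵐᵒᵖ ⊗[k] H)) : _ →* _) B.Φlr

theorem cell₂_twistElem (a : A →ₐ[k] C) (κ : Hᵐᵒᵖ ⊗[k] H →ₐ[k] C) [CommHom a κ] :
    cell₂ (Q.twistElem B) a κ = μ⟦Q.lpart κ, a, rpart κ⟧ :=
  Units.ext (DFunLike.congr_fun (Q.lift2_comp_arrange₃ a κ) B.Φlr.val)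

theorem twistElem_mul_rho₁ (u : A) :
    (Q.twistElem B).val * rho₁ Q B u = rho₂ Q B u * (Q.twistElem B).val := by
  have h := congrArg Q.arrange₃ (B.compat u)
  rw [map_mul, map_mul] at h
  exact h

/-- The compatibility axiom of `Φλρ`, transported by `arrange₃`, says precisely that its image
conjugates `ρ₁` to `ρ₂`. -/
theorem conjHom_rho₂ : conjHom (Q.twistElem B)⁻¹ (rho₂ Q B) = rho₁ Q B := by
  ext u
  rw [conjHom_apply, inv_inv, mul_assoc, ← twistElem_mul_rho₁, Units.inv_mul_cancel_left]

theorem counitTail_twistElem (hα : Q.counit Q.α = 1) :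
    counitTail A Q.env.counit (Q.twistElem B).val = 1 := by
  have h := Q.cell₂_twistElem B (AlgHom.id k A) (Q.env.unit A)
  rw [cell_congr B.Φlr (Q.lpart_unit hα) rfl Q.rpart_unit, B.lr_unit_last] at h
  have h' := congrArg Units.val h
  change lift2 (AlgHom.id k A) (Q.env.unit A) (Q.twistElem B).val = 1 at h'
  rwa [lift2_unit_right] at h'

/-- The factor `Φλρ` on `κ₁ ⊗ κ₂` passes through the Drinfeld twist by naturality and becomes `Φλρ`
on tensor products of left and of right parts. Then `coherence_twist` applies, and that factor
cancels. -/
theorem cell_twistΦ_twistElem (hα : Q.counit Q.α = 1) (a : A →ₐ[k] C)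
    (κ₁ κ₂ : Hᵐᵒᵖ ⊗[k] H →ₐ[k] C) [CommHom a κ₁] [CommHom a κ₂] [CommHom κ₁ κ₂] :
    cell ((Q.comoduleTwo B hα).twistΦ (Q.twistElem B)⁻¹) a κ₁ κ₂
      = Q.tw (Q.lpart κ₂) (Q.lpart κ₁)
        * ρ⟦(Q.lpart κ₂ ⋄ Q.lpart κ₁) ▷ a, rpart κ₁, rpart κ₂⟧
        * λ⟦Q.lpart κ₂, Q.lpart κ₁, a⟧⁻¹ * μ⟦Q.lpart κ₂, Q.lpart κ₁ ▷ a, rpart κ₁⟧⁻¹ := by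
  have e : ∀ (a : A →ₐ[k] C) (κ : Hᵐᵒᵖ ⊗[k] H →ₐ[k] C) [CommHom a κ],
      cell₂ (Q.twistElem B)⁻¹ a κ = μ⟦Q.lpart κ, a, rpart κ⟧⁻¹ := fun a κ _ => by
    rw [← cell₂_twistElem, cell₂, cell₂, map_inv]
  have h₁ : Q.tw (Q.lpart κ₂) (Q.lpart κ₁)
      * μ⟦Q.lpart κ₂ ⋄ Q.lpart κ₁, a, rpart κ₁ ⋄ rpart κ₂⟧
      = μ⟦Q.lpart (ten Q.env.comul κ₁ κ₂), a, rpart (ten Q.env.comul κ₁ κ₂)⟧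
        * Q.tw (Q.lpart κ₂) (Q.lpart κ₁) := by
    refine Intw.cell B.Φlr (Q.tw_intw κ₁ κ₂) (Q.tw_intw_right _ _ _) ?_
    rw [Q.rpart_ten]
    exact Q.tw_intw_right _ _ _
  have h₂ : μ⟦Q.lpart κ₂, ten (rho₂ Q B) a κ₁, rpart κ₂⟧
      = μ⟦Q.lpart κ₂, Q.lpart κ₁ ▷ a ◁ rpart κ₁, rpart κ₂⟧ :=
    cell_congr B.Φlr rfl (Q.ten_rho₂ a κ₁ B) rfl
  have co := B.coherence_twist (Q.lpart κ₂) (Q.lpart κ₁) a (rpart κ₁) (rpart κ₂)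
  rw [RightComoduleAlgebra.cell_twistΦ, e, e, e, inv_inv, inv_inv]
  change _ * cell (Q.phiUnit₂ B) a κ₁ κ₂ * μ⟦Q.lpart κ₂, ten (rho₂ Q B) a κ₁, rpart κ₂⟧ * _ = _
  rw [h₂, cell_phiUnit₂, phiTwo, phiCell, mul_assoc, mul_assoc, inv_mul_eq_iff_eq_mul]
  simp only [mul_assoc] at co ⊢
  rw [co, ← mul_assoc, h₁]
  simp only [mul_assoc]

/-- The comodule algebra `(A, ρ₁, Φρ₁)`. -/
def comoduleOne (hα : Q.counit Q.α = 1) : RightComoduleAlgebra Q.env A :=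
  (Q.comoduleTwo B hα).twist (Q.twistElem B)⁻¹ (map_inv_eq_one (Q.counitTail_twistElem B hα))

theorem comoduleOne_Φρ (hα : Q.counit Q.α = 1) :
    (Q.comoduleOne B hα).Φρ.val = phiRho₁ Q B := by
  rw [phiRho₁_eq, ← Q.cell_twistΦ_twistElem B hα, cell_includes]
  rfl

end QuasiHopf

end

end QuasiHopfTheory

theorem proposition3p3 {k H A : Type*} [Field k] [Ring H] [Algebra k H] [Ring A] [Algebra k A]
    (Q : QuasiHopfTheory.QuasiHopf k H) (hα : Q.counit Q.α = 1)
    (B : QuasiHopfTheory.BicomoduleAlgebra Q.toQuasiBialgebra A) :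
    ∃ A₁ A₂ : QuasiHopfTheory.RightComoduleAlgebra
        (Q.toQuasiBialgebra.op.tensor Q.toQuasiBialgebra) A,
      A₁.ρ = QuasiHopfTheory.rho₁ Q B ∧ A₁.Φρ.val = QuasiHopfTheory.phiRho₁ Q B ∧
      A₂.ρ = QuasiHopfTheory.rho₂ Q B ∧ A₂.Φρ.val = QuasiHopfTheory.phiRho₂ Q B ∧
      QuasiHopfTheory.TwistEquivalent A₁ A₂ :=
  -- The first structure is the second twisted by `(Q.twistElem B)⁻¹`, so the equivalence is
  -- implemented by the image of `Φλρ` itself.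
  ⟨Q.comoduleOne B hα, Q.comoduleTwo B hα, Q.conjHom_rho₂ B, Q.comoduleOne_Φρ B hα, rfl,
    Q.phiUnit₂_val B, QuasiHopfTheory.RightComoduleAlgebra.twistEquivalent_twist _ _ _⟩
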